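/- Let $\mathbb{D}=\{z\in\mathbb{C}:|z|<1\}$ and $dA=\frac{dx\,dy}{\pi}$. A radial weight is a non-negative function $\omega\in L^1(\mathbb{D})$ with $\omega(z)=\omega(|z|)$ for all $z\in\mathbb{D}$ and $\widehat\omega(r)=\int_r^1\omega(s)\,ds>0$ for all $0\le r<1$. The class $\mathcal{D}$ consists of the radial weights $\omega$ for which there exist constants $C_1\ge1$, $C_2>1$ and $K>1$ such that $$\widehat\omega(r)\le C_1\,\widehat\omega\left(\tfrac{1+r}{2}\right)<\infty\quad\text{and}\quad \widehat\omega(r)\ge C_2\,\widehat\omega\left(1-\tfrac{1-r}{K}\right)\quad\text{for all }0\le r<1.$$ Write $\widetilde\omega(r)=\widehat\omega(r)/(1-r)$ for $0\le r<1$. For $1\le p<\infty$, let $A^p_\omega$ be the space of analytic functions $f$ on $\mathbb{D}$ with $\|f\|_{A^p_\omega}=\left(\int_{\mathbb{D}}|f|^p\omega\,dA\right)^{1/p}<\infty$. For two Banach spaces $A,B$ of functions on the same domain, the weakly factored space $A\odot B$ is the completion of the space of finite sums $f=\sum_k\varphi_k\psi_k$, $\varphi_k\in A$, $\psi_k\in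 B$, with respect to the norm $$\|f\|_{A\odot B}=\inf\left\{\sum_k\|\varphi_k\|_A\|\psi_k\|_B:\ f=\sum_k\varphi_k\psi_k \text{ (finite sum)},\ \varphi_k\in A,\ \psi_k\in B\right\}.$$ \textbf{Theorem.} Let $1<p_1,p_2,q<\infty$ with $\frac1q=\frac1{p_1}+\frac1{p_2}$, and let $\omega,\nu,\eta\in\mathcal{D}$ be such that, for some constants $c,C>0$, $$c\,\widetilde\omega(r)^{1/p_1}\widetilde\nu(r)^{1/p_2}\le\widetilde\eta(r)^{1/q}\le C\,\widetilde\omega(r)^{1/p_1}\widetilde\nu(r)^{1/p_2},\qquad 0\le r<1.$$ Then $A^q_\eta=A^{p_1}_\omega\odot A^{p_2}_\nu$ as function spaces, with equivalent norms; that is, the identity map on finite sums $\sum_k\varphi_k\psi_k$ ($\varphi_k\in A^{p_1}_\omega$, $\psi_k\in A^{p_2}_\nu$) extends to a linear bijection $\Phi:A^{p_1}_\omega\odot A^{p_2}_\nu\to A^q_\eta$, and there exist constants $c',C'>0$ such that $c'\|x\|_{A^{p_1}_\omega\odot A^{p_2}_\nu}\le\|\Phi(x)\|_{A^q_\eta}\le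 C'\|x\|_{A^{p_1}_\omega\odot A^{p_2}_\nu}$ for all $x\in A^{p_1}_\omega\odot A^{p_2}_\nu$. -/

import Mathlib

open MeasureTheory

noncomputable section

namespace WeakFactorization

/-! ### Radial weights -/

/-- `𝔻` is the open unit disc of the complex plane. -/
abbrev 𝔻 : Type := ↥(Metric.ball (0 : ℂ) 1)

/-- The tail integral `ω̂(r) = ∫_r^1 ω(s) ds`. -/
def tail (ω : ℝ → ℝ) (r : ℝ) : ℝ := ∫ s in r..1, ω s

/-- `ω̃(r) = ω̂(r) / (1 - r)`. -/
def tailAvg (ω : ℝ → ℝ) (r : ℝ) : ℝ := tail ω r / (1 - r)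

/-- The weight `z ↦ ω(|z|)` on the disc is given by its profile `ω` (only the values on `[0,1)`
matter). It is non-negative, Lebesgue integrable over the disc, and its tail integrals are positive.
(Positivity of the tail at `r = 0` follows from positivity on `(0,1)` by monotonicity.) -/
structure IsRadialWeight (ω : ℝ → ℝ) : Prop where
  nonneg : ∀ r ∈ Set.Ico (0 : ℝ) 1, 0 ≤ ω r
  integrableOn_disc : IntegrableOn (fun z : ℂ => ω ‖z‖) (Metric.ball (0 : ℂ) 1)
  tail_pos : ∀ r ∈ Set.Ioo (0 : ℝ) 1, 0 < tail ω r

/-- The upper doubling class. The first clause says `ω̂(0) < ∞`; this is implicit in the doubling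
inequality at `r = 0`, since `ω̂(1/2) < ∞` for every radial weight. -/
def UpperDoubling (ω : ℝ → ℝ) : Prop :=
  IntegrableOn ω (Set.Ioo 0 1) ∧
    ∃ C : ℝ, 1 ≤ C ∧ ∀ r ∈ Set.Ico (0 : ℝ) 1, tail ω r ≤ C * tail ω ((1 + r) / 2)

/-- The lower (reverse) doubling class. -/
def LowerDoubling (ω : ℝ → ℝ) : Prop :=
  ∃ K C : ℝ, 1 < K ∧ 1 < C ∧
    ∀ r ∈ Set.Ico (0 : ℝ) 1, C * tail ω (1 - (1 - r) / K) ≤ tail ω r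

/-- The class `𝒟` of two-sided doubling radial weights. -/
structure IsDoubling (ω : ℝ → ℝ) : Prop where
  isRadialWeight : IsRadialWeight ω
  upper : UpperDoubling ω
  lower : LowerDoubling ω

/-! ### Weighted Bergman spaces -/

/-- The measure `ω(|z|) dA(z)` on the disc, where `dA = dx dy / π`. -/
def weightMeasure (ω : ℝ → ℝ) : Measure 𝔻 :=
  (ENNReal.ofReal (1 / Real.pi) •
      Measure.comap (Subtype.val : 𝔻 → ℂ) volume).withDensity
    (fun z => ENNReal.ofReal (ω ‖(z : ℂ)‖))

/-- Analytic functions on the disc. -/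
def IsAnalytic (f : 𝔻 → ℂ) : Prop :=
  ∃ F : ℂ → ℂ, DifferentiableOn ℂ F (Metric.ball (0 : ℂ) 1) ∧ ∀ z : 𝔻, f z = F z

/-- The weighted Bergman space `A^p_ω`: analytic functions on the disc that belong to `L^p_ω`. -/
def bergman (p : ℝ) (ω : ℝ → ℝ) : Submodule ℂ (𝔻 → ℂ) where
  carrier := {f | IsAnalytic f ∧ MemLp f (ENNReal.ofReal p) (weightMeasure ω)}
  zero_mem' := ⟨⟨0, differentiableOn_const 0, fun _ => rfl⟩, MemLp.zero⟩
  add_mem' := by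
    rintro f g ⟨⟨F, hF, hfF⟩, hf⟩ ⟨⟨G, hG, hgG⟩, hg⟩
    exact ⟨⟨F + G, hF.add hG, fun z => by simp [hfF, hgG]⟩, hf.add hg⟩
  smul_mem' := by
    rintro c f ⟨⟨F, hF, hfF⟩, hf⟩
    exact ⟨⟨c • F, hF.const_smul c, fun z => by simp [hfF]⟩, hf.const_smul c⟩

/-- `‖f‖ = (∫ |f|^p ω dA)^{1/p}`. -/
def bergmanNormFun (p : ℝ) (ω : ℝ → ℝ) (f : 𝔻 → ℂ) : ℝ :=
  (∫ z, ‖f z‖ ^ p ∂(weightMeasure ω)) ^ (1 / p)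

theorem bergmanNormFun_eq {p : ℝ} (hp : 1 ≤ p) {ω : ℝ → ℝ} {f : 𝔻 → ℂ}
    (hf : MemLp f (ENNReal.ofReal p) (weightMeasure ω)) :
    bergmanNormFun p ω f = (eLpNorm f (ENNReal.ofReal p) (weightMeasure ω)).toReal := by
  have h0 : (0 : ℝ) < p := by linarith
  rw [hf.eLpNorm_eq_integral_rpow_norm (by simpa using h0) ENNReal.ofReal_ne_top,
    ENNReal.toReal_ofReal h0.le, ENNReal.toReal_ofReal (by positivity), bergmanNormFun, one_div]

/-- The norm of `A^p_ω` for `1 ≤ p`, bundled with homogeneity and the triangle inequality. -/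
def bergmanNorm {p : ℝ} (hp : 1 ≤ p) (ω : ℝ → ℝ) : Seminorm ℂ (bergman p ω) :=
  Seminorm.of (fun f => bergmanNormFun p ω f)
    (by
      intro f g
      have h1 : (1 : ENNReal) ≤ ENNReal.ofReal p := by simpa using hp
      rw [bergmanNormFun_eq hp f.2.2, bergmanNormFun_eq hp g.2.2, bergmanNormFun_eq hp (f + g).2.2,
        ← ENNReal.toReal_add f.2.2.2.ne g.2.2.2.ne]
      exact ENNReal.toReal_mono (ENNReal.add_ne_top.2 ⟨f.2.2.2.ne, g.2.2.2.ne⟩)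
        (eLpNorm_add_le f.2.2.1 g.2.2.1 h1))
    (by
      intro c f
      rw [bergmanNormFun_eq hp f.2.2, bergmanNormFun_eq hp (c • f).2.2]
      have : ((c • f : bergman p ω) : 𝔻 → ℂ) = c • (f : 𝔻 → ℂ) := rfl
      rw [this, eLpNorm_const_smul, ENNReal.toReal_mul]
      simp)

/-! ### Weakly factored spaces -/

section WeakProduct

variable {X : Type*} {A B : Submodule ℂ (X → ℂ)}

/-- The values `∑ ‖φ_k‖ ‖ψ_k‖` over all representations of `f` as a finite sum `∑ φ_k ψ_k` with
`φ_k ∈ A` and `ψ_k ∈ B`. -/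
def representationCosts (NA : Seminorm ℂ A) (NB : Seminorm ℂ B) (f : X → ℂ) : Set ℝ :=
  {t | ∃ (n : ℕ) (φ : Fin n → A) (ψ : Fin n → B),
    f = ∑ k, (φ k : X → ℂ) * (ψ k : X → ℂ) ∧ t = ∑ k, NA (φ k) * NB (ψ k)}

/-- The infimum of `∑ ‖φ_k‖ ‖ψ_k‖` over all finite representations `f = ∑ φ_k ψ_k`. -/
def weakNormFun (NA : Seminorm ℂ A) (NB : Seminorm ℂ B) (f : X → ℂ) : ℝ :=
  sInf (representationCosts NA NB f)

theorem representationCosts_nonneg {NA : Seminorm ℂ A} {NB : Seminorm ℂ B} {f : X → ℂ} {t : ℝ}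
    (ht : t ∈ representationCosts NA NB f) : 0 ≤ t := by
  obtain ⟨n, φ, ψ, -, rfl⟩ := ht
  exact Finset.sum_nonneg fun k _ => mul_nonneg (apply_nonneg _ _) (apply_nonneg _ _)

theorem representationCosts_bddBelow (NA : Seminorm ℂ A) (NB : Seminorm ℂ B) (f : X → ℂ) :
    BddBelow (representationCosts NA NB f) :=
  ⟨0, fun _ ht => representationCosts_nonneg ht⟩

theorem representationCosts_zero (NA : Seminorm ℂ A) (NB : Seminorm ℂ B) :
    (0 : ℝ) ∈ representationCosts NA NB 0 :=
  ⟨0, Fin.elim0, Fin.elim0, by simp, by simp⟩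

theorem representationCosts_add {NA : Seminorm ℂ A} {NB : Seminorm ℂ B} {f g : X → ℂ} {s t : ℝ}
    (hs : s ∈ representationCosts NA NB f) (ht : t ∈ representationCosts NA NB g) :
    s + t ∈ representationCosts NA NB (f + g) := by
  obtain ⟨n, φ, ψ, rfl, rfl⟩ := hs
  obtain ⟨m, φ', ψ', rfl, rfl⟩ := ht
  exact ⟨n + m, Fin.append φ φ', Fin.append ψ ψ', by simp [Fin.sum_univ_add],
    by simp [Fin.sum_univ_add]⟩

theorem representationCosts_smul {NA : Seminorm ℂ A} {NB : Seminorm ℂ B} {f : X → ℂ} {t : ℝ}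
    (c : ℂ) (ht : t ∈ representationCosts NA NB f) :
    ‖c‖ * t ∈ representationCosts NA NB (c • f) := by
  obtain ⟨n, φ, ψ, rfl, rfl⟩ := ht
  exact ⟨n, fun k => c • φ k, ψ, by simp [Finset.smul_sum],
    by simp [Finset.mul_sum, map_smul_eq_mul, mul_assoc]⟩

/-- The submodule product `A * B` consists exactly of the finite sums of products. -/
theorem mem_mul_iff_representationCosts_nonempty (NA : Seminorm ℂ A) (NB : Seminorm ℂ B)
    (f : X → ℂ) : f ∈ A * B ↔ (representationCosts NA NB f).Nonempty := by
  constructor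
  · intro hf
    refine Submodule.mul_induction_on hf ?_ ?_
    · intro a ha b hb
      exact ⟨_, 1, fun _ => ⟨a, ha⟩, fun _ => ⟨b, hb⟩, by simp, rfl⟩
    · rintro f g ⟨s, hs⟩ ⟨t, ht⟩
      exact ⟨s + t, representationCosts_add hs ht⟩
  · rintro ⟨_, n, φ, ψ, rfl, -⟩
    exact Submodule.sum_mem _ fun k _ => Submodule.mul_mem_mul (φ k).2 (ψ k).2

/-- The infimum norm on the space `A * B` of finite sums. -/
def weakNorm (NA : Seminorm ℂ A) (NB : Seminorm ℂ B) : Seminorm ℂ ↥(A * B) :=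
  Seminorm.ofSMulLE (fun f => weakNormFun NA NB f)
    (le_antisymm (csInf_le (representationCosts_bddBelow NA NB _) (representationCosts_zero NA NB))
      (Real.sInf_nonneg fun _ ht => representationCosts_nonneg ht))
    (by
      intro f g
      have hf := (mem_mul_iff_representationCosts_nonempty NA NB _).1 f.2
      have hg := (mem_mul_iff_representationCosts_nonempty NA NB _).1 g.2
      have key : ∀ s ∈ representationCosts NA NB (f : X → ℂ),
          ∀ t ∈ representationCosts NA NB (g : X → ℂ),
          weakNormFun NA NB ((f + g : ↥(A * B)) : X → ℂ) ≤ s + t := fun s hs t ht =>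
        csInf_le (representationCosts_bddBelow NA NB _) (representationCosts_add hs ht)
      have h1 : ∀ s ∈ representationCosts NA NB (f : X → ℂ),
          weakNormFun NA NB ((f + g : ↥(A * B)) : X → ℂ) - s ≤ weakNormFun NA NB (g : X → ℂ) :=
        fun s hs => le_csInf hg fun t ht => by linarith [key s hs t ht]
      have h2 : weakNormFun NA NB ((f + g : ↥(A * B)) : X → ℂ) - weakNormFun NA NB (g : X → ℂ)
          ≤ weakNormFun NA NB (f : X → ℂ) :=
        le_csInf hf fun s hs => by linarith [h1 s hs]
      linarith)
    (by
      intro c f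
      have hf := (mem_mul_iff_representationCosts_nonempty NA NB _).1 f.2
      have key : ∀ s ∈ representationCosts NA NB (f : X → ℂ),
          weakNormFun NA NB ((c • f : ↥(A * B)) : X → ℂ) ≤ ‖c‖ * s := fun s hs =>
        csInf_le (representationCosts_bddBelow NA NB _) (representationCosts_smul c hs)
      rcases eq_or_lt_of_le (norm_nonneg c) with hc | hc
      · obtain ⟨s, hs⟩ := hf
        simpa [← hc] using key s hs
      · rw [← div_le_iff₀' hc]
        exact le_csInf hf fun s hs => (div_le_iff₀' hc).2 (key s hs))

/-- The space of finite sums `∑ φ_k ψ_k`, carrying the infimum norm. -/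
def FiniteSums (_NA : Seminorm ℂ A) (_NB : Seminorm ℂ B) : Type _ := ↥(A * B)

instance (NA : Seminorm ℂ A) (NB : Seminorm ℂ B) : AddCommGroup (FiniteSums NA NB) :=
  inferInstanceAs (AddCommGroup ↥(A * B))

instance (NA : Seminorm ℂ A) (NB : Seminorm ℂ B) : Module ℂ (FiniteSums NA NB) :=
  inferInstanceAs (Module ℂ ↥(A * B))

instance (NA : Seminorm ℂ A) (NB : Seminorm ℂ B) : SeminormedAddCommGroup (FiniteSums NA NB) :=
  AddGroupSeminorm.toSeminormedAddCommGroup (weakNorm NA NB).toAddGroupSeminorm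

instance (NA : Seminorm ℂ A) (NB : Seminorm ℂ B) : NormedSpace ℂ (FiniteSums NA NB) where
  norm_smul_le c f := (map_smul_eq_mul (weakNorm NA NB) c f).le

/-- The function underlying a finite sum. -/
def FiniteSums.toFun {NA : Seminorm ℂ A} {NB : Seminorm ℂ B} (f : FiniteSums NA NB) : X → ℂ :=
  Subtype.val (p := fun g => g ∈ A * B) f

theorem FiniteSums.norm_def {NA : Seminorm ℂ A} {NB : Seminorm ℂ B} (f : FiniteSums NA NB) :
    ‖f‖ = weakNormFun NA NB f.toFun := rfl

/-- The weakly factored space `A ⊙ B`: the completion of the space of finite sums. -/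
abbrev WeaklyFactored (NA : Seminorm ℂ A) (NB : Seminorm ℂ B) : Type _ :=
  UniformSpace.Completion (FiniteSums NA NB)

end WeakProduct

end WeakFactorization

end

open WeakFactorization

/-! Discretisation. For a weight in 𝒟 and a large integer K, the tails at the radii r_j = 1 - K^{-j}
decay geometrically from both sides. Since circle means of analytic functions increase with the
radius, ‖f‖^p in A^p_ω is comparable to ∑_j ω̂(r_{j+1}) M_p(r_{j+1}, f)^p, which is `discreteNorm`.
As 1/q = 1/p₁ + 1/p₂, the powers of 1 - r cancel in the hypothesis on the weights, which becomes
η̂^{1/q} ≍ ω̂^{1/p₁} ν̂^{1/p₂}.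

Upper bound. Hölder on each circle and then over j gives ‖φψ‖ ≤ B ‖φ‖ ‖ψ‖
(`exists_discNorm_mul_le`). By subadditivity the weak norm dominates the norm of A^q_η on finite
sums.

Lower bound. It suffices to factor polynomials weakly with a uniform constant
(`exists_weak_factorization_polynomial`). Differences of de la Vallée-Poussin means cut P into
blocks z^{2K^j} Q_j (without the monomial if j = 0) of degree at most 4K^{j+1}. At such degrees the
radii 1 and r_{j+1} are interchangeable up to a constant, so ‖Q_j‖_{L^q} on the unit circle is at
most a constant times M_q(r_{j+1}, P). Each Q_j splits in the disc algebra as g_j h_j with |g_j| =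
|Q_j|^{q/p₁} and |h_j| = |Q_j|^{q/p₂} on the circle. With ζ a primitive J-th root of unity, J the
number of blocks, put F_k = ∑_j ζ^{kj} s_j z^{K^j} g_j and G_k = ∑_j ζ^{-kj} s_j^{-1} z^{K^j} h_j.
Averaging F_k G_k over k removes the cross terms and leaves P. The powers z^{K^j} make the pieces
almost orthogonal between the radii r_i, so a Schur test (`schur_test`, `kernel_bound`) bounds each
discrete norm by the sum of the contributions of the pieces, and the scalars s_j turn ω̂ and ν̂ into
η̂. There are J products, each with coefficient 1/J, so the total cost does not depend on J.

Completion. Polynomials are dense in the finite sums for the weak norm, and both estimates hold on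
them. Point evaluations are continuous for the weak norm, so elements of the completion are
functions; Weierstrass and Fatou place them in A^q_η. The lower bound passes to the completion by
density and gives injectivity; density of polynomials in A^q_η gives surjectivity
(`exists_equiv_of_polynomial_bounds`). -/

noncomputable section

namespace WeakFactorization

open scoped ENNReal NNReal Real ComplexConjugate
open Filter Topology Metric

/-! ### Integral means over circles -/

/-- The circle as an additive group, with its Lebesgue measure of total mass `2π`. -/
abbrev 𝕋 : Type := AddCircle (2 * π)

instance fact_two_pi_pos : Fact (0 < 2 * π) := ⟨Real.two_pi_pos⟩

/-- The point of the unit circle with a given angle. -/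
def unitPt (u : 𝕋) : ℂ := (AddCircle.toCircle u : ℂ)

theorem continuous_unitPt : Continuous unitPt :=
  continuous_subtype_val.comp AddCircle.continuous_toCircle

@[simp] theorem norm_unitPt (u : 𝕋) : ‖unitPt u‖ = 1 := Circle.norm_coe _

theorem unitPt_add (u v : 𝕋) : unitPt (u + v) = unitPt u * unitPt v := by
  simp [unitPt, AddCircle.toCircle_add]

theorem unitPt_neg (u : 𝕋) : unitPt (-u) = (unitPt u)⁻¹ := by
  simp [unitPt, AddCircle.toCircle_neg]

theorem unitPt_coe (θ : ℝ) : unitPt (θ : 𝕋) = Complex.exp (θ * Complex.I) := by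
  simp [unitPt, AddCircle.toCircle]

theorem exists_unitPt_eq {ζ : ℂ} (hζ : ‖ζ‖ = 1) : ∃ v, unitPt v = ζ := by
  refine ⟨(Complex.arg ζ : ℝ), ?_⟩
  rw [unitPt_coe]
  simpa [hζ] using Complex.norm_mul_exp_arg_mul_I ζ

/-- The `L^p` mean of `F` over the circle of radius `r`. -/
def circMean (p : ℝ≥0∞) (r : ℝ) (F : ℂ → ℂ) : ℝ≥0∞ :=
  eLpNorm (fun u : 𝕋 => F (r * unitPt u)) p volume

theorem continuous_circle_comp {F : ℂ → ℂ} {r : ℝ} (hr : 0 ≤ r)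
    (hF : ContinuousOn F (closedBall 0 r)) : Continuous fun u : 𝕋 => F (r * unitPt u) :=
  hF.comp_continuous (continuous_const.mul continuous_unitPt) fun u => by simp [abs_of_nonneg hr]

theorem circMean_add_le {p : ℝ≥0∞} (hp : 1 ≤ p) {r : ℝ} (hr : 0 ≤ r) {F G : ℂ → ℂ}
    (hF : ContinuousOn F (closedBall 0 r)) (hG : ContinuousOn G (closedBall 0 r)) :
    circMean p r (fun z => F z + G z) ≤ circMean p r F + circMean p r G :=
  eLpNorm_add_le (continuous_circle_comp hr hF).aestronglyMeasurable
    (continuous_circle_comp hr hG).aestronglyMeasurable hp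

theorem circMean_sum_le {ι : Type*} {p : ℝ≥0∞} (hp : 1 ≤ p) {r : ℝ} (hr : 0 ≤ r) {F : ι → ℂ → ℂ}
    (s : Finset ι) (hF : ∀ i ∈ s, ContinuousOn (F i) (closedBall 0 r)) :
    circMean p r (fun z => ∑ i ∈ s, F i z) ≤ ∑ i ∈ s, circMean p r (F i) := by
  have := eLpNorm_sum_le (f := fun i (u : 𝕋) => F i (r * unitPt u)) (s := s) (μ := volume)
    (fun i hi => (continuous_circle_comp hr (hF i hi)).aestronglyMeasurable) hp
  refine le_trans (le_of_eq ?_) this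
  unfold circMean
  congr 1
  ext u
  simp

theorem circMean_const_mul (p : ℝ≥0∞) (r : ℝ) (c : ℂ) (F : ℂ → ℂ) :
    circMean p r (fun z => c * F z) = ‖c‖ₑ * circMean p r F := by
  simpa [circMean] using! eLpNorm_const_smul c (fun u : 𝕋 => F (r * unitPt u)) p volume

theorem circMean_congr_norm (p : ℝ≥0∞) {r : ℝ} {F G : ℂ → ℂ}
    (h : ∀ z, ‖z‖ = |r| → ‖F z‖ = ‖G z‖) : circMean p r F = circMean p r G :=
  eLpNorm_congr_norm_ae (.of_forall fun u => h _ (by simp))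

theorem circMean_rpow {p : ℝ} (hp : 0 < p) (r : ℝ) (F : ℂ → ℂ) :
    circMean (ENNReal.ofReal p) r F ^ p = ∫⁻ u : 𝕋, ‖F (r * unitPt u)‖ₑ ^ p := by
  have := eLpNorm_eq_lintegral_rpow_enorm_toReal (p := ENNReal.ofReal p)
    (by simpa using hp) ENNReal.ofReal_ne_top (f := fun u : 𝕋 => F (r * unitPt u)) (μ := volume)
  rw [ENNReal.toReal_ofReal hp.le] at this
  rw [circMean, this, ← ENNReal.rpow_mul, one_div_mul_cancel hp.ne', ENNReal.rpow_one]

theorem circMean_comp_rotate (p : ℝ≥0∞) {r : ℝ} (hr : 0 ≤ r) {F : ℂ → ℂ}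
    (hF : ContinuousOn F (closedBall 0 r)) {ζ : ℂ} (hζ : ‖ζ‖ = 1) :
    circMean p r (fun z => F (ζ * z)) = circMean p r F := by
  obtain ⟨v, rfl⟩ := exists_unitPt_eq hζ
  have := eLpNorm_comp_measurePreserving (p := p)
    (continuous_circle_comp hr hF).aestronglyMeasurable (measurePreserving_add_left volume v)
  rw [circMean, circMean, ← this]
  congr 1
  ext u
  simp only [Function.comp, unitPt_add]
  ring_nf

theorem circMean_comp_neg (p : ℝ≥0∞) {r : ℝ} (hr : 0 ≤ r) {F : ℂ → ℂ}
    (hF : ContinuousOn F (closedBall 0 r)) :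
    eLpNorm (fun u : 𝕋 => F (r * unitPt (-u))) p volume = circMean p r F :=
  eLpNorm_comp_measurePreserving (p := p)
    (continuous_circle_comp hr hF).aestronglyMeasurable (Measure.measurePreserving_neg volume)

theorem circMean_le_of_norm_le {p : ℝ} (hp : 0 < p) {r : ℝ} {F : ℂ → ℂ} {ε : ℝ}
    (h : ∀ z, ‖z‖ = |r| → ‖F z‖ ≤ ε) :
    circMean (ENNReal.ofReal p) r F ≤ ENNReal.ofReal (2 * π) ^ (1 / p) * ENNReal.ofReal ε := by
  have := eLpNorm_le_of_ae_bound (p := ENNReal.ofReal p) (μ := (volume : Measure 𝕋))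
    (f := fun u : 𝕋 => F (r * unitPt u)) (C := ε) (.of_forall fun u => h _ (by simp))
  simpa [circMean, AddCircle.measure_univ, ENNReal.toReal_ofReal hp.le] using this

/-! ### Monotonicity of the means -/

/-- The trigonometric polynomial `u ↦ P(z e^{iu})`. -/
def circPoly (P : Polynomial ℂ) (z : ℂ) : C(𝕋, ℂ) :=
  ∑ n ∈ P.support, (P.coeff n * z ^ n) • fourier (n : ℤ)

theorem circPoly_apply (P : Polynomial ℂ) (z : ℂ) (u : 𝕋) :
    circPoly P z u = P.eval (z * unitPt u) := by
  rw [Polynomial.eval_eq_sum, Polynomial.sum, circPoly, ContinuousMap.sum_apply]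
  refine Finset.sum_congr rfl fun n _ => ?_
  have : (fourier (n : ℤ) u : ℂ) = unitPt u ^ n := by
    rw [fourier_apply, unitPt, AddCircle.toCircle_zsmul]; simp
  simp [this, mul_pow, mul_assoc]

/-- The argument of z only rotates the circle, so the norm of this L^p-valued function of z depends
on |z| alone. -/
theorem norm_toLp_circPoly {p : ℝ≥0∞} [Fact (1 ≤ p)] (P : Polynomial ℂ) (z : ℂ) :
    ‖ContinuousMap.toLp p (volume : Measure 𝕋) ℂ (circPoly P z)‖
      = (circMean p ‖z‖ fun w => P.eval w).toReal := by
  rw [Lp.norm_def, eLpNorm_congr_ae (ContinuousMap.coeFn_toLp _ _)]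
  congr 1
  have hz : ∃ v : 𝕋, z = ‖z‖ * unitPt v :=
    ⟨(Complex.arg z : ℝ), by rw [unitPt_coe, Complex.norm_mul_exp_arg_mul_I]⟩
  obtain ⟨v, hv⟩ := hz
  rw [← circMean_comp_rotate p (norm_nonneg z) P.continuous.continuousOn (norm_unitPt v)]
  unfold circMean
  congr 1
  ext u
  rw [circPoly_apply]
  nth_rewrite 1 [hv]
  ring_nf

theorem circMean_polynomial_ne_top (p : ℝ≥0∞) (r : ℝ) (P : Polynomial ℂ) :
    circMean p r (fun z => P.eval z) ≠ ⊤ := by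
  have hc : Continuous fun u : 𝕋 => P.eval (r * unitPt u) :=
    P.continuous.comp (continuous_const.mul continuous_unitPt)
  exact (MemLp.of_bound (p := p) hc.aestronglyMeasurable _ (.of_forall fun u =>
    ContinuousMap.norm_coe_le_norm (⟨_, hc⟩ : C(𝕋, ℂ)) u)).2.ne

/-- The maximum principle for the Banach-valued entire function z ↦ P(z ·) ∈ L^p(𝕋), whose norm is
constant on circles about 0. No subharmonicity is needed. -/
theorem circMean_polynomial_mono {p : ℝ≥0∞} (hp : 1 ≤ p) {r R : ℝ} (hr : 0 ≤ r) (hrR : r ≤ R)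
    (P : Polynomial ℂ) :
    circMean p r (fun z => P.eval z) ≤ circMean p R (fun z => P.eval z) := by
  have : Fact (1 ≤ p) := ⟨hp⟩
  rcases hr.trans hrR |>.eq_or_lt with hR | hR
  · have : r = R := by linarith
    rw [this]
  let V : ℂ → Lp ℂ p (volume : Measure 𝕋) := fun z => ContinuousMap.toLp p volume ℂ (circPoly P z)
  have hV : Differentiable ℂ V := by
    simp only [V, circPoly, map_sum, map_smul]
    fun_prop
  have hn : ∀ z, ‖V z‖ = (circMean p ‖z‖ fun w => P.eval w).toReal := norm_toLp_circPoly P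
  have key : ‖V r‖ ≤ (circMean p R fun w => P.eval w).toReal := by
    refine Complex.norm_le_of_forall_mem_frontier_norm_le (U := ball 0 R) isBounded_ball
      hV.diffContOnCl (fun z hz => ?_) ?_
    · rw [frontier_ball _ hR.ne', mem_sphere_zero_iff_norm] at hz
      rw [hn, hz]
    · rw [closure_ball _ hR.ne']
      simpa [abs_of_nonneg hr] using hrR
  rw [hn, Complex.norm_of_nonneg hr] at key
  exact (ENNReal.toReal_le_toReal (circMean_polynomial_ne_top _ _ _)
    (circMean_polynomial_ne_top _ _ _)).1 key

/-- Polynomials are uniformly dense among functions analytic on a neighbourhood of a closed disc. -/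
theorem exists_polynomial_near_of_lt {F : ℂ → ℂ} {R R' : ℝ} (hR : 0 ≤ R) (hRR' : R < R')
    (hF : DifferentiableOn ℂ F (ball 0 R')) {ε : ℝ} (hε : 0 < ε) :
    ∃ P : Polynomial ℂ, ∀ z ∈ closedBall (0 : ℂ) R, ‖F z - P.eval z‖ ≤ ε := by
  obtain ⟨S, hRS, hSR⟩ := exists_between hRR'
  obtain ⟨T, hRT, hTS⟩ := exists_between hRS
  have hS : 0 < S := hR.trans_lt hRS
  lift S to ℝ≥0 using hS.le
  lift T to ℝ≥0 using (hR.trans hRT.le)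
  have h1 := (hF.mono (closedBall_subset_ball hSR)).hasFPowerSeriesOnBall (NNReal.coe_pos.1 hS)
  have h2 := h1.tendstoUniformlyOn' (r' := T) (by exact_mod_cast hTS)
  rw [Metric.tendstoUniformlyOn_iff] at h2
  obtain ⟨n, hn⟩ := (h2 ε hε).exists
  let q := cauchyPowerSeries F 0 S
  refine ⟨∑ k ∈ Finset.range n, Polynomial.C (q.coeff k) * Polynomial.X ^ k, fun z hz => ?_⟩
  have := hn z (closedBall_subset_ball hRT hz)
  rw [dist_eq_norm] at this
  refine le_of_eq_of_le ?_ this.le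
  congr 2
  simp only [FormalMultilinearSeries.partialSum, Polynomial.eval_finsetSum, Polynomial.eval_mul,
    Polynomial.eval_C, Polynomial.eval_pow, Polynomial.eval_X, sub_zero,
    FormalMultilinearSeries.apply_eq_pow_smul_coeff, smul_eq_mul, q]
  exact Finset.sum_congr rfl fun k _ => mul_comm _ _

/-- A slight dilation F(s z) is analytic past the closed disc and, by uniform continuity, close to F
there; its Taylor polynomials then approximate F. -/
theorem exists_polynomial_near {F : ℂ → ℂ} {R : ℝ} (hR : 0 < R)
    (hF : DiffContOnCl ℂ F (ball 0 R)) {ε : ℝ} (hε : 0 < ε) :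
    ∃ P : Polynomial ℂ, ∀ z ∈ closedBall (0 : ℂ) R, ‖F z - P.eval z‖ ≤ ε := by
  have hc : ContinuousOn F (closedBall 0 R) := hF.continuousOn_ball
  have hu := (isCompact_closedBall (0 : ℂ) R).uniformContinuousOn_of_continuous hc
  rw [Metric.uniformContinuousOn_iff] at hu
  obtain ⟨δ, hδ, h⟩ := hu (ε / 2) (by positivity)
  obtain ⟨s, hs0, hs1, hs⟩ : ∃ s : ℝ, 0 < s ∧ s < 1 ∧ (1 - s) * R < δ := by
    refine ⟨max (1 / 2) (1 - δ / (2 * R)), by positivity, max_lt (by norm_num) ?_, ?_⟩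
    · have : 0 < δ / (2 * R) := by positivity
      linarith
    · have h1 : 1 - max (1 / 2) (1 - δ / (2 * R)) ≤ δ / (2 * R) := by
        linarith [le_max_right (1 / 2) (1 - δ / (2 * R))]
      calc _ ≤ δ / (2 * R) * R := by gcongr
        _ = δ / 2 := by field_simp
        _ < δ := by linarith
  have hlt : R < R / s := by rw [lt_div_iff₀ hs0]; nlinarith
  obtain ⟨P, hP⟩ := exists_polynomial_near_of_lt (F := fun z => F (s * z)) hR.le hlt
    (by
      refine hF.differentiableOn.comp (by fun_prop) fun z hz => ?_
      rw [mem_ball_zero_iff] at hz ⊢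
      rw [norm_mul, Complex.norm_of_nonneg hs0.le]
      calc s * ‖z‖ < s * (R / s) := by gcongr
        _ = R := by field_simp) (ε := ε / 2) (by positivity)
  refine ⟨P, fun z hz => ?_⟩
  have hz' := mem_closedBall_zero_iff.1 hz
  have hsz : (s * z : ℂ) ∈ closedBall (0 : ℂ) R := by
    rw [mem_closedBall_zero_iff, norm_mul, Complex.norm_of_nonneg hs0.le]
    nlinarith [norm_nonneg z]
  have h3 : ‖F z - F (s * z)‖ < ε / 2 := by
    rw [← dist_eq_norm]
    refine h z hz _ hsz ?_
    have : z - s * z = ((1 - s : ℝ) : ℂ) * z := by push_cast; ring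
    rw [dist_eq_norm, this, norm_mul, Complex.norm_of_nonneg (by linarith)]
    refine lt_of_le_of_lt ?_ hs
    gcongr
  calc ‖F z - P.eval z‖ = ‖(F z - F (s * z)) + (F (s * z) - P.eval z)‖ := by ring_nf
    _ ≤ _ := norm_add_le _ _
    _ ≤ ε / 2 + ε / 2 := add_le_add h3.le (hP z hz)
    _ = ε := by ring

/-- Transfer from polynomials by uniform approximation on the closed disc. Only continuity up to the
outer circle is assumed, because the factors g_j, h_j are merely in the disc algebra and are
compared with their means at radius 1. -/
theorem circMean_mono {p : ℝ} (hp : 1 ≤ p) {r R : ℝ} (hr : 0 ≤ r) (hrR : r ≤ R)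
    {F : ℂ → ℂ} (hF : DiffContOnCl ℂ F (ball 0 R)) :
    circMean (ENNReal.ofReal p) r F ≤ circMean (ENNReal.ofReal p) R F := by
  rcases hr.trans hrR |>.eq_or_lt with hR | hR
  · have : r = R := by linarith
    rw [this]
  have hp0 : 0 < p := by linarith
  have hp1 : 1 ≤ ENNReal.ofReal p := by simpa using hp
  have hc : ContinuousOn F (closedBall 0 R) := hF.continuousOn_ball
  set A : ℝ≥0∞ := ENNReal.ofReal (2 * π) ^ (1 / p) with hA
  have key : ∀ ε : ℝ, 0 < ε → circMean (ENNReal.ofReal p) r F ≤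
      circMean (ENNReal.ofReal p) R F + 2 * (A * ENNReal.ofReal ε) := by
    intro ε hε
    obtain ⟨P, hP⟩ := exists_polynomial_near hR hF hε
    have hPc : ∀ ρ, ContinuousOn (fun z => P.eval z) (closedBall (0 : ℂ) ρ) :=
      fun ρ => P.continuous.continuousOn
    have e1 : circMean (ENNReal.ofReal p) r F ≤
        circMean (ENNReal.ofReal p) r (fun z => P.eval z) + A * ENNReal.ofReal ε := by
      have hcr := hc.mono (closedBall_subset_closedBall hrR)
      calc _ = circMean (ENNReal.ofReal p) r (fun z => P.eval z + (F z - P.eval z)) := by simp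
        _ ≤ _ := circMean_add_le hp1 hr (hPc r) (hcr.sub (hPc r))
        _ ≤ _ := by
          gcongr
          exact circMean_le_of_norm_le hp0 fun z hz => hP z (by simpa [hz, abs_of_nonneg hr])
    have e2 : circMean (ENNReal.ofReal p) R (fun z => P.eval z) ≤
        circMean (ENNReal.ofReal p) R F + A * ENNReal.ofReal ε := by
      calc _ = circMean (ENNReal.ofReal p) R (fun z => F z + (P.eval z - F z)) := by simp
        _ ≤ _ := circMean_add_le hp1 hR.le hc ((hPc R).sub hc)
        _ ≤ _ := by
          gcongr
          refine circMean_le_of_norm_le hp0 fun z hz => ?_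
          rw [norm_sub_rev]
          exact hP z (by simp [hz, abs_of_nonneg hR.le])
    calc _ ≤ _ := e1
      _ ≤ circMean (ENNReal.ofReal p) R (fun z => P.eval z) + A * ENNReal.ofReal ε := by
        gcongr; exact circMean_polynomial_mono hp1 hr hrR P
      _ ≤ _ := by rw [two_mul, ← add_assoc]; gcongr
  refine ENNReal.le_of_forall_pos_le_add fun δ hδ _ => ?_
  have hAt : A ≠ ⊤ := 
    ENNReal.rpow_ne_top_of_nonneg (by positivity) ENNReal.ofReal_ne_top
  -- This accuracy makes the total error 2Aε at most δ; the added 1 keeps the denominator positive.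
  refine (key (δ / (2 * (A.toReal + 1))) (by positivity)).trans ?_
  gcongr
  rw [← ENNReal.ofReal_toReal hAt, ← ENNReal.ofReal_mul (by positivity),
    show (2 : ℝ≥0∞) = ENNReal.ofReal 2 by simp, ← ENNReal.ofReal_mul (by positivity)]
  refine (ENNReal.ofReal_le_ofReal (q := δ) ?_).trans (by simp)
  have : 0 ≤ A.toReal := ENNReal.toReal_nonneg
  rw [ENNReal.toReal_ofReal this, mul_div, mul_div, div_le_iff₀ (by positivity)]
  nlinarith [δ.2]

theorem circMean_mono_of_lt {p : ℝ} (hp : 1 ≤ p) {r R S : ℝ} (hr : 0 ≤ r) (hrR : r ≤ R)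
    (hRS : R < S) {F : ℂ → ℂ} (hF : DifferentiableOn ℂ F (ball 0 S)) :
    circMean (ENNReal.ofReal p) r F ≤ circMean (ENNReal.ofReal p) R F :=
  circMean_mono hp hr hrR
    (hF.mono (closure_ball_subset_closedBall.trans (closedBall_subset_ball hRS))).diffContOnCl

/-! ### Orthogonality of the powers of a root of unity -/

/-- The primitive `M`-th root of unity `e^{2πi/M}`. -/
def rootU (M : ℕ) : ℂ := Complex.exp (2 * π * Complex.I / M)

theorem isPrimitiveRoot_rootU {M : ℕ} (hM : M ≠ 0) : IsPrimitiveRoot (rootU M) M :=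
  Complex.isPrimitiveRoot_exp M hM

@[simp] theorem norm_rootU (M : ℕ) : ‖rootU M‖ = 1 := by
  rw [rootU, show 2 * (π : ℂ) * Complex.I / M = ((2 * π / M : ℝ) : ℂ) * Complex.I by push_cast; ring,
    Complex.norm_exp_ofReal_mul_I]

/-- A geometric sum with ratio ζ^{s-t}; since s and t are below M, the ratio is 1 only for s = t. -/
theorem sum_rootU_pow_mul_conj {M s t : ℕ} (hs : s < M) (ht : t < M) :
    ∑ k ∈ Finset.range M, (rootU M ^ k) ^ s * (conj (rootU M ^ k)) ^ t
      = if s = t then (M : ℂ) else 0 := by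
  have hM : M ≠ 0 := by omega
  set ζ := rootU M with hζ
  have hprim : IsPrimitiveRoot ζ M := isPrimitiveRoot_rootU hM
  have hne : ζ ≠ 0 := norm_ne_zero_iff.1 (by simp [hζ])
  have hconj : conj ζ = ζ⁻¹ := by
    rw [Complex.inv_def, Complex.normSq_eq_norm_sq]; simp [hζ]
  have hterm : ∀ k, (ζ ^ k) ^ s * (conj (ζ ^ k)) ^ t = (ζ ^ s * ζ⁻¹ ^ t) ^ k := fun k => by
    rw [map_pow, hconj, mul_pow, ← pow_mul, ← pow_mul, ← pow_mul, ← pow_mul, mul_comm k, mul_comm k]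
  simp_rw [hterm]
  split_ifs with h
  · subst h
    simp [hne]
  · have hx : ζ ^ s * ζ⁻¹ ^ t ≠ 1 := fun h1 => h <| hprim.pow_inj hs ht <| by
      rw [inv_pow] at h1
      exact (mul_inv_eq_one₀ (pow_ne_zero _ hne)).1 h1
    have hx1 : (ζ ^ s * ζ⁻¹ ^ t) ^ M = 1 := by
      rw [mul_pow, ← pow_mul, ← pow_mul, mul_comm s, mul_comm t, pow_mul, pow_mul, inv_pow,
        hprim.pow_eq_one]
      simp
    have := mul_geom_sum (ζ ^ s * ζ⁻¹ ^ t) M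
    rw [hx1, sub_self] at this
    exact (mul_eq_zero.1 this).resolve_left (sub_ne_zero.2 hx)

/-- The average over a root of unity of a product of two twisted sums is the diagonal sum. -/
theorem sum_mul_eq_average {M : ℕ} (x y : ℕ → ℂ) :
    (M : ℂ) * ∑ j ∈ Finset.range M, x j * y j = ∑ k ∈ Finset.range M,
      (∑ i ∈ Finset.range M, (rootU M ^ k) ^ i * x i) *
        ∑ j ∈ Finset.range M, (conj (rootU M ^ k)) ^ j * y j := by
  simp_rw [Finset.sum_mul_sum]
  rw [Finset.sum_comm, Finset.mul_sum]
  refine Finset.sum_congr rfl fun i hi => ?_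
  rw [Finset.sum_comm]
  have : ∀ j ∈ Finset.range M, ∑ k ∈ Finset.range M,
      (rootU M ^ k) ^ i * x i * ((conj (rootU M ^ k)) ^ j * y j) =
      (if i = j then (M : ℂ) else 0) * (x i * y j) := fun j hj => by
    rw [← sum_rootU_pow_mul_conj (Finset.mem_range.1 hi) (Finset.mem_range.1 hj), Finset.sum_mul]
    exact Finset.sum_congr rfl fun k _ => by ring
  rw [Finset.sum_congr rfl this]
  simp [Finset.mem_range.1 hi]

/-- The Dirichlet-type kernel `∑_{a<A} x^a`. -/
def dirichletSum (A : ℕ) (x : ℂ) : ℂ := ∑ a ∈ Finset.range A, x ^ a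

/-- Parseval on the M-th roots of unity; A ≤ M keeps the A exponents distinct modulo M. -/
theorem sum_norm_dirichletSum_sq {M A : ℕ} (hA : A ≤ M) :
    ∑ k ∈ Finset.range M, ‖dirichletSum A (rootU M ^ k)‖ ^ 2 = M * A := by
  have : ((∑ k ∈ Finset.range M, ‖dirichletSum A (rootU M ^ k)‖ ^ 2 : ℝ) : ℂ) = (M * A : ℝ) := by
    push_cast
    have h1 : ∀ k, ((‖dirichletSum A (rootU M ^ k)‖ : ℂ)) ^ 2 =
        ∑ a ∈ Finset.range A, ∑ b ∈ Finset.range A,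
          (rootU M ^ k) ^ a * (conj (rootU M ^ k)) ^ b := fun k => by
      rw [← Complex.mul_conj', dirichletSum, map_sum, Finset.sum_mul_sum]
      simp only [map_pow]
    simp_rw [h1]
    rw [Finset.sum_comm]
    have h2 : ∀ a ∈ Finset.range A, ∑ k ∈ Finset.range M, ∑ b ∈ Finset.range A,
        (rootU M ^ k) ^ a * (conj (rootU M ^ k)) ^ b = M := fun a ha => by
      have ha' := Finset.mem_range.1 ha
      rw [Finset.sum_comm, Finset.sum_congr rfl fun b hb => sum_rootU_pow_mul_conj
        (ha'.trans_le hA) ((Finset.mem_range.1 hb).trans_le hA)]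
      simp [ha']
    rw [Finset.sum_congr rfl h2]
    simp [mul_comm]
  exact_mod_cast this

/-! ### De la Vallée-Poussin means -/

/-- The multiplier `#{a < N : a + n < 2N} / N`, equal to `1` for `n ≤ N` and `0` for `n ≥ 2N`. -/
def vdpCoeff (N n : ℕ) : ℂ :=
  ((Finset.range N).filter fun a => a + n < 2 * N).card / (N : ℂ)

theorem vdpCoeff_of_le {N n : ℕ} (hN : N ≠ 0) (h : n ≤ N) : vdpCoeff N n = 1 := by
  have : (Finset.range N).filter (fun a => a + n < 2 * N) = Finset.range N :=
    Finset.filter_true_of_mem fun a ha => by rw [Finset.mem_range] at ha; omega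
  rw [vdpCoeff, this, Finset.card_range, div_self (by exact_mod_cast hN)]

theorem vdpCoeff_of_ge {N n : ℕ} (h : 2 * N ≤ n) : vdpCoeff N n = 0 := by
  have : (Finset.range N).filter (fun a => a + n < 2 * N) = ∅ :=
    Finset.filter_false_of_mem fun a _ => by omega
  rw [vdpCoeff, this]; simp

/-- The de la Vallée-Poussin mean of a polynomial. -/
def vdp (N : ℕ) (P : Polynomial ℂ) : Polynomial ℂ :=
  ∑ n ∈ Finset.range (P.natDegree + 1), Polynomial.monomial n (vdpCoeff N n * P.coeff n)

theorem coeff_vdp (N : ℕ) (P : Polynomial ℂ) (n : ℕ) :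
    (vdp N P).coeff n = vdpCoeff N n * P.coeff n := by
  rw [vdp, Polynomial.finsetSum_coeff]
  simp only [Polynomial.coeff_monomial, Finset.sum_ite_eq', Finset.mem_range]
  split_ifs with h
  · rfl
  · rw [Polynomial.coeff_eq_zero_of_natDegree_lt (by omega), mul_zero]

theorem vdp_eq_self {N : ℕ} (hN : N ≠ 0) {P : Polynomial ℂ} (h : P.natDegree ≤ N) :
    vdp N P = P := by
  ext n
  rw [coeff_vdp]
  rcases le_or_gt n N with hn | hn
  · rw [vdpCoeff_of_le hN hn, one_mul]
  · rw [Polynomial.coeff_eq_zero_of_natDegree_lt (by omega), mul_zero]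

/-- The values on the `M`-th roots of unity of the kernel of the de la Vallée-Poussin mean. -/
def vdpKernel (N M k : ℕ) : ℂ :=
  dirichletSum N (rootU M ^ k) * conj (dirichletSum (2 * N) (rootU M ^ k)) / (M * N)

/-- Expanding the kernel against the monomial of degree n pairs a + n, a < N, with b < 2N.
Orthogonality retains the a with a + n < 2N, and their number over N is the multiplier. The bound N
+ deg P ≤ M keeps a + n below M. -/
theorem eval_vdp {N M : ℕ} (hM : M ≠ 0) (h2N : 2 * N ≤ M) (P : Polynomial ℂ)
    (hP : N + P.natDegree ≤ M) (z : ℂ) :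
    (vdp N P).eval z =
      ∑ k ∈ Finset.range M, vdpKernel N M k * P.eval (rootU M ^ k * z) := by
  have hM' : (M : ℂ) ≠ 0 := by exact_mod_cast hM
  have h1 : ∀ k, vdpKernel N M k * P.eval (rootU M ^ k * z) =
      ∑ n ∈ Finset.range (P.natDegree + 1), ∑ a ∈ Finset.range N, ∑ b ∈ Finset.range (2 * N),
        ((rootU M ^ k) ^ (a + n) * (conj (rootU M ^ k)) ^ b) *
          (P.coeff n * z ^ n / (M * N)) := fun k => by
    rw [Polynomial.eval_eq_sum_range, vdpKernel, dirichletSum, dirichletSum, map_sum,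
      Finset.mul_sum]
    refine Finset.sum_congr rfl fun n _ => ?_
    rw [Finset.sum_mul_sum, Finset.sum_div, Finset.sum_mul]
    refine Finset.sum_congr rfl fun a _ => ?_
    rw [Finset.sum_div, Finset.sum_mul]
    refine Finset.sum_congr rfl fun b _ => ?_
    rw [map_pow]
    ring
  simp_rw [h1]
  rw [Finset.sum_comm, vdp, Polynomial.eval_finsetSum]
  refine Finset.sum_congr rfl fun n hn => ?_
  have hn' := Finset.mem_range.1 hn
  rw [Polynomial.eval_monomial, Finset.sum_comm]
  have h2 : ∀ a ∈ Finset.range N, ∑ k ∈ Finset.range M, ∑ b ∈ Finset.range (2 * N),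
      ((rootU M ^ k) ^ (a + n) * (conj (rootU M ^ k)) ^ b) * (P.coeff n * z ^ n / (M * N)) =
      if a + n < 2 * N then P.coeff n * z ^ n / N else 0 := fun a ha => by
    have ha' := Finset.mem_range.1 ha
    rw [Finset.sum_comm]
    simp_rw [← Finset.sum_mul]
    rw [Finset.sum_congr rfl fun b hb => sum_rootU_pow_mul_conj (M := M) (s := a + n) (t := b)
      (by omega) ((Finset.mem_range.1 hb).trans_le h2N)]
    rw [Finset.sum_ite_eq]
    simp only [Finset.mem_range]
    split_ifs
    · field_simp
    · simp
  rw [Finset.sum_congr rfl h2, ← Finset.sum_filter, Finset.sum_const, nsmul_eq_mul, vdpCoeff]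
  ring

/-- By 2xy ≤ x² + y² and Parseval the sum is at most (MN + 2MN)/(2MN) = 3/2. -/
theorem sum_norm_vdpKernel_le {N M : ℕ} (hN : N ≠ 0) (h2N : 2 * N ≤ M) :
    ∑ k ∈ Finset.range M, ‖vdpKernel N M k‖ ≤ 2 := by
  have hN' : (0 : ℝ) < N := by exact_mod_cast Nat.pos_of_ne_zero hN
  have hM' : (0 : ℝ) < M := by exact_mod_cast (by omega : 0 < M)
  have h1 : ∀ k, ‖vdpKernel N M k‖ ≤
      (‖dirichletSum N (rootU M ^ k)‖ ^ 2 + ‖dirichletSum (2 * N) (rootU M ^ k)‖ ^ 2)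
        / (2 * (M * N)) := fun k => by
    rw [vdpKernel, norm_div, norm_mul, RCLike.norm_conj, norm_mul, Complex.norm_natCast,
      Complex.norm_natCast, div_le_div_iff₀ (by positivity) (by positivity)]
    have := two_mul_le_add_sq ‖dirichletSum N (rootU M ^ k)‖ ‖dirichletSum (2 * N) (rootU M ^ k)‖
    have h3 : (0 : ℝ) ≤ M * N := by positivity
    nlinarith [mul_le_mul_of_nonneg_right this h3]
  refine (Finset.sum_le_sum fun k _ => h1 k).trans ?_
  rw [← Finset.sum_div, Finset.sum_add_distrib, sum_norm_dirichletSum_sq (by omega),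
    sum_norm_dirichletSum_sq h2N, div_le_iff₀ (by positivity)]
  push_cast
  nlinarith [mul_pos hM' hN']

/-- The mean is a combination of rotations of P with total weight at most 2, and rotations preserve
circle means. This is uniform in N, P and p ≥ 1. -/
theorem circMean_vdp_le {p : ℝ≥0∞} (hp : 1 ≤ p) {r : ℝ} (hr : 0 ≤ r) {N : ℕ} (hN : N ≠ 0)
    (P : Polynomial ℂ) :
    circMean p r (fun z => (vdp N P).eval z) ≤ 2 * circMean p r fun z => P.eval z := by
  let M := 2 * N + P.natDegree
  have hM : M ≠ 0 := by omega
  have hcont : ∀ k, ContinuousOn (fun z => vdpKernel N M k * P.eval (rootU M ^ k * z))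
      (closedBall (0 : ℂ) r) := fun k => by
    refine Continuous.continuousOn ?_
    exact continuous_const.mul (P.continuous.comp (continuous_const.mul continuous_id))
  have : (fun z => (vdp N P).eval z) = fun z => ∑ k ∈ Finset.range M,
      vdpKernel N M k * P.eval (rootU M ^ k * z) :=
    funext fun z => eval_vdp hM (by omega) P (by omega) z
  rw [this]
  calc _ ≤ ∑ k ∈ Finset.range M,
        circMean p r (fun z => vdpKernel N M k * P.eval (rootU M ^ k * z)) :=
      circMean_sum_le hp hr _ fun k _ => hcont k
    _ = ∑ k ∈ Finset.range M, ‖vdpKernel N M k‖ₑ * circMean p r (fun z => P.eval z) := by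
      refine Finset.sum_congr rfl fun k _ => ?_
      rw [circMean_const_mul p r _ (fun z => P.eval (rootU M ^ k * z)),
        circMean_comp_rotate p hr (F := fun z => P.eval z) P.continuous.continuousOn (by simp)]
    _ = ENNReal.ofReal (∑ k ∈ Finset.range M, ‖vdpKernel N M k‖) *
        circMean p r (fun z => P.eval z) := by
      rw [← Finset.sum_mul, ENNReal.ofReal_sum_of_nonneg fun _ _ => norm_nonneg _]
      simp
    _ ≤ _ := by
      gcongr
      exact (ENNReal.ofReal_le_ofReal (sum_norm_vdpKernel_le hN (by omega))).trans (by simp)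

/-! ### A reverse inequality for polynomials -/

/-- On |z| = r the moduli of P(z) and of z^D times the reflected polynomial at 1/z coincide. -/
theorem circMean_reflect (p : ℝ≥0∞) {r : ℝ} (hr : 0 < r) {P : Polynomial ℂ} {D : ℕ}
    (hD : P.natDegree ≤ D) :
    circMean p r (fun z => P.eval z) =
      ENNReal.ofReal (r ^ D) * circMean p r⁻¹ (fun z => (P.reflect D).eval z) := by
  rw [← circMean_comp_neg p (inv_nonneg.2 hr.le)
    (F := fun z => (P.reflect D).eval z) (Polynomial.continuous _).continuousOn]
  have h := eLpNorm_const_smul (((r ^ D : ℝ) : ℂ))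
    (fun u : 𝕋 => (P.reflect D).eval (((r⁻¹ : ℝ) : ℂ) * unitPt (-u))) p volume
  have h2 : ‖((r ^ D : ℝ) : ℂ)‖ₑ = ENNReal.ofReal (r ^ D) := by
    rw [← ofReal_norm, Complex.norm_of_nonneg (by positivity)]
  rw [h2] at h
  rw [← h, circMean]
  refine eLpNorm_congr_norm_ae (.of_forall fun u => ?_)
  have hne : (r * unitPt u : ℂ) ≠ 0 := by
    rw [← norm_ne_zero_iff]; simp [hr.ne']
  let _ := invertibleOfNonzero hne
  have h3 := Polynomial.eval₂_reflect_mul_pow (RingHom.id ℂ) (r * unitPt u : ℂ) D P hD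
  rw [invOf_eq_inv, Polynomial.eval₂_id, Polynomial.eval₂_id] at h3
  rw [← h3, mul_inv]
  simp [unitPt_neg, abs_of_pos hr, mul_comm]

/-- Monotonicity of the means applied to the reflected polynomial at the radii 1 ≤ 1/r, which
reverses the usual inequality at the price r^D. -/
theorem circMean_one_le {p : ℝ≥0∞} (hp : 1 ≤ p) {r : ℝ} (hr : 0 < r) (hr1 : r ≤ 1)
    {P : Polynomial ℂ} {D : ℕ} (hD : P.natDegree ≤ D) :
    ENNReal.ofReal (r ^ D) * circMean p 1 (fun z => P.eval z) ≤
      circMean p r fun z => P.eval z := by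
  rw [circMean_reflect p hr hD, circMean_reflect p one_pos hD]
  simp only [one_pow, ENNReal.ofReal_one, one_mul, inv_one]
  gcongr
  exact circMean_polynomial_mono hp zero_le_one ((one_le_inv₀ hr).2 hr1) _

/-! ### Factorization of polynomials on the disc -/

/-- `F` is a product of two functions of the disc algebra whose moduli on the unit circle are
`|F| ^ s` and `|F| ^ t`. -/
def HasPowerFactorization (s t : ℝ) (F : ℂ → ℂ) : Prop :=
  ∃ g h : ℂ → ℂ, DiffContOnCl ℂ g (ball 0 1) ∧ DiffContOnCl ℂ h (ball 0 1) ∧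
    (∀ z ∈ closedBall (0 : ℂ) 1, g z * h z = F z) ∧
    ∀ z : ℂ, ‖z‖ = 1 → ‖g z‖ = ‖F z‖ ^ s ∧ ‖h z‖ = ‖F z‖ ^ t

theorem HasPowerFactorization.mul {s t : ℝ} {F G : ℂ → ℂ} (hF : HasPowerFactorization s t F)
    (hG : HasPowerFactorization s t G) : HasPowerFactorization s t (fun z => F z * G z) := by
  obtain ⟨g, h, hg, hh, hgh, hn⟩ := hF
  obtain ⟨g', h', hg', hh', hgh', hn'⟩ := hG
  refine ⟨fun z => g z * g' z, fun z => h z * h' z, hg.smul hg', hh.smul hh', fun z hz => ?_,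
    fun z hz => ?_⟩
  · simp only [← hgh z hz, ← hgh' z hz]; ring
  · simp only [norm_mul]
    rw [(hn z hz).1, (hn z hz).2, (hn' z hz).1, (hn' z hz).2,
      Real.mul_rpow (norm_nonneg _) (norm_nonneg _), Real.mul_rpow (norm_nonneg _) (norm_nonneg _)]
    exact ⟨rfl, rfl⟩

theorem HasPowerFactorization.congr {s t : ℝ} {F G : ℂ → ℂ} (hF : HasPowerFactorization s t F)
    (h : ∀ z, F z = G z) : HasPowerFactorization s t G := by
  rwa [← funext h]

theorem hasPowerFactorization_const {s t : ℝ} (hs : 0 < s) (ht : 0 < t) (hst : s + t = 1) (c : ℂ) :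
    HasPowerFactorization s t fun _ => c := by
  rcases eq_or_ne c 0 with rfl | hc
  · exact ⟨fun _ => 0, fun _ => 0, diffContOnCl_const, diffContOnCl_const, by simp,
      fun z _ => by simp [Real.zero_rpow hs.ne', Real.zero_rpow ht.ne']⟩
  have hc' : 0 < ‖c‖ := norm_pos_iff.2 hc
  refine ⟨fun _ => ((‖c‖ ^ s : ℝ) : ℂ), fun _ => c / ‖c‖ * ((‖c‖ ^ t : ℝ) : ℂ),
    diffContOnCl_const, diffContOnCl_const, fun z _ => ?_, fun z _ => ⟨?_, ?_⟩⟩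
  · have : ((‖c‖ ^ s : ℝ) : ℂ) * ((‖c‖ ^ t : ℝ) : ℂ) = ‖c‖ := by
      rw [← Complex.ofReal_mul, ← Real.rpow_add hc', hst, Real.rpow_one]
    have hcc : (‖c‖ : ℂ) ≠ 0 := by exact_mod_cast hc'.ne'
    calc _ = c / ‖c‖ * (((‖c‖ ^ s : ℝ) : ℂ) * ((‖c‖ ^ t : ℝ) : ℂ)) := by ring
      _ = c := by rw [this]; field_simp
  · rw [Complex.norm_of_nonneg (by positivity)]
  · rw [norm_mul, Complex.norm_of_nonneg (by positivity), norm_div, Complex.norm_real, norm_norm,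
      div_self hc'.ne', one_mul]

theorem one_sub_mul_re_pos {b z : ℂ} (h : ‖b * z‖ < 1) : 0 < (1 - b * z).re := by
  have := (Complex.re_le_norm (b * z)).trans_lt h
  simp only [Complex.sub_re, Complex.one_re]
  linarith

/-- The closed disc of centre 1 and radius 1 meets the half-plane Re ≤ 0 only at 0, so the principal
branch of a power of 1 - bz can fail to be continuous only at a zero. -/
theorem one_sub_mul_re_pos_or {b z : ℂ} (h : ‖b * z‖ ≤ 1) :
    0 < (1 - b * z).re ∨ 1 - b * z = 0 := by
  rcases ((Complex.re_le_norm (b * z)).trans h).lt_or_eq with h1 | h1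
  · left
    simp only [Complex.sub_re, Complex.one_re]
    linarith
  · right
    have h2 : ‖b * z‖ ^ 2 ≤ 1 := pow_le_one₀ (norm_nonneg _) h
    rw [← Complex.normSq_eq_norm_sq, Complex.normSq_apply, h1] at h2
    have h3 : (b * z).im = 0 := by nlinarith
    apply Complex.ext <;> simp only [Complex.sub_re, Complex.one_re, Complex.sub_im,
      Complex.one_im, Complex.zero_re, Complex.zero_im] <;> linarith

/-- A zero on the unit circle is harmless for a positive exponent; if |b| < 1 there is no zero on
the closed disc and the exponent may have any sign. -/
theorem diffContOnCl_one_sub_mul_cpow {b : ℂ} {s : ℝ} (h : ‖b‖ ≤ 1 ∧ 0 < s ∨ ‖b‖ < 1) :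
    DiffContOnCl ℂ (fun z => (1 - b * z) ^ (s : ℂ)) (ball 0 1) := by
  have hb : ‖b‖ ≤ 1 := h.elim And.left le_of_lt
  refine ⟨fun z hz => ?_, ?_⟩
  · have hz' := mem_ball_zero_iff.1 hz
    have : 0 < (1 - b * z).re := one_sub_mul_re_pos <| by
      rw [norm_mul]; nlinarith [norm_nonneg z, norm_nonneg b]
    have hlin : DifferentiableAt ℂ (fun z => 1 - b * z) z := by fun_prop
    exact (hlin.cpow_const (Or.inl this)).differentiableWithinAt
  · rw [closure_ball _ one_ne_zero]
    intro z hz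
    have hz' := mem_closedBall_zero_iff.1 hz
    have hlin : ContinuousAt (fun z => 1 - b * z) z := by fun_prop
    refine ContinuousAt.continuousWithinAt ?_
    rcases h with ⟨-, hs⟩ | hb'
    · rcases one_sub_mul_re_pos_or (b := b) (z := z)
        (by rw [norm_mul]; nlinarith [norm_nonneg z, norm_nonneg b]) with h1 | h1
      · exact hlin.cpow continuousAt_const (Or.inl h1)
      · have h2 : ContinuousAt (fun x : ℂ × ℂ => x.1 ^ x.2) (1 - b * z, (s : ℂ)) := by
          rw [h1]; exact Complex.continuousAt_cpow_zero_of_re_pos (by simpa using hs)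
        exact ContinuousAt.comp (f := fun z => (1 - b * z, (s : ℂ))) h2
          (hlin.prodMk continuousAt_const)
    · exact hlin.cpow continuousAt_const (Or.inl (one_sub_mul_re_pos (by
        rw [norm_mul]; nlinarith [norm_nonneg z, norm_nonneg b])))

/-- The case of a linear factor without zeros in the open disc: its powers s and t are analytic
there. -/
theorem hasPowerFactorization_one_sub_mul {s t : ℝ} (hs : 0 < s) (ht : 0 < t) (hst : s + t = 1)
    {b : ℂ} (hb : ‖b‖ ≤ 1) : HasPowerFactorization s t fun z => 1 - b * z := by
  refine ⟨_, _, diffContOnCl_one_sub_mul_cpow (Or.inl ⟨hb, hs⟩),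
    diffContOnCl_one_sub_mul_cpow (Or.inl ⟨hb, ht⟩), fun z _ => ?_, fun z _ => ?_⟩
  · rcases eq_or_ne (1 - b * z) 0 with h | h
    · rw [h, Complex.zero_cpow (by exact_mod_cast hs.ne'), zero_mul]
      exact h.symm
    · rw [← Complex.cpow_add _ _ h, ← Complex.ofReal_add, hst, Complex.ofReal_one, Complex.cpow_one]
  · exact ⟨Complex.norm_cpow_real _ _, Complex.norm_cpow_real _ _⟩

/-- A zero in the disc cannot be split, so it goes entirely to the first factor. As |z - a| = |1 -
āz| on the circle, multiplying by (1 - āz)^{s-1} corrects the modulus and the second factor is (1 -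
āz)^t. -/
theorem hasPowerFactorization_sub_of_norm_lt {s t : ℝ} (hst : s + t = 1)
    {a : ℂ} (ha : ‖a‖ < 1) : HasPowerFactorization s t fun z => z - a := by
  have hb : ‖conj a‖ < 1 := by rwa [RCLike.norm_conj]
  have hne : ∀ z ∈ closedBall (0 : ℂ) 1, 1 - conj a * z ≠ 0 := fun z hz h0 => by
    have := one_sub_mul_re_pos (b := conj a) (z := z) (by
      rw [norm_mul]; nlinarith [norm_nonneg z, norm_nonneg (conj a), mem_closedBall_zero_iff.1 hz])
    rw [h0] at this
    simp at this
  refine ⟨fun z => (z - a) * (1 - conj a * z) ^ ((s - 1 : ℝ) : ℂ),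
    fun z => (1 - conj a * z) ^ (t : ℂ),
    (Differentiable.diffContOnCl (f := fun z => z - a) (by fun_prop)).smul (diffContOnCl_one_sub_mul_cpow (Or.inr hb)),
    diffContOnCl_one_sub_mul_cpow (Or.inr hb), fun z hz => ?_, fun z hz => ?_⟩
  · rw [mul_assoc, ← Complex.cpow_add _ _ (hne z hz), ← Complex.ofReal_add,
      show s - 1 + t = 0 by linarith]
    simp
  · have hz1 : z * conj z = 1 := by rw [Complex.mul_conj']; simp [hz]
    have hnorm : ‖1 - conj a * z‖ = ‖z - a‖ := by
      have : 1 - conj a * z = z * conj (z - a) := by rw [map_sub, mul_sub, hz1]; ring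
      rw [this, norm_mul, hz, one_mul, RCLike.norm_conj]
    have h0 : ‖z - a‖ ≠ 0 := by
      rw [← hnorm, norm_ne_zero_iff]; exact hne z (by simp [hz])
    rw [norm_mul, Complex.norm_cpow_real, Complex.norm_cpow_real, hnorm]
    refine ⟨?_, rfl⟩
    rw [Real.rpow_sub_one h0]
    field_simp

theorem hasPowerFactorization_polynomial {s t : ℝ} (hs : 0 < s) (ht : 0 < t) (hst : s + t = 1)
    (P : Polynomial ℂ) : HasPowerFactorization s t fun z => P.eval z := by
  have hlin : ∀ a : ℂ, HasPowerFactorization s t fun z => z - a := fun a => by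
    rcases lt_or_ge ‖a‖ 1 with ha | ha
    · exact hasPowerFactorization_sub_of_norm_lt hst ha
    -- For a root outside the open disc, z - a = -a (1 - a⁻¹ z) with |a⁻¹| ≤ 1.
    · have ha0 : a ≠ 0 := norm_pos_iff.1 (by linarith)
      refine ((hasPowerFactorization_const hs ht hst (-a)).mul
        (hasPowerFactorization_one_sub_mul hs ht hst (b := a⁻¹) ?_)).congr fun z => ?_
      · rw [norm_inv]; exact inv_le_one_of_one_le₀ ha
      · field_simp; ring
  have hprod : ∀ m : Multiset ℂ, HasPowerFactorization s t fun z =>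
      ((m.map fun a => Polynomial.X - Polynomial.C a).prod).eval z := fun m => by
    induction m using Multiset.induction_on with
    | empty => simpa using hasPowerFactorization_const hs ht hst 1
    | cons a m ih => exact ((hlin a).mul ih).congr fun z => by simp
  refine ((hasPowerFactorization_const hs ht hst P.leadingCoeff).mul (hprod P.roots)).congr
    fun z => ?_
  conv_rhs => rw [(IsAlgClosed.splits P).eq_prod_roots]
  rw [Polynomial.eval_mul, Polynomial.eval_C]

/-! ### Tails of radial weights -/

/-- The points `1 - K^{-j}`. -/
def node (K j : ℕ) : ℝ := 1 - ((K : ℝ)⁻¹) ^ j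

theorem node_zero (K : ℕ) : node K 0 = 0 := by simp [node]

theorem node_succ (K j : ℕ) : node K (j + 1) = 1 - (1 - node K j) / K := by
  simp only [node, pow_succ]; ring

theorem node_lt_one {K : ℕ} (hK : 2 ≤ K) (j : ℕ) : node K j < 1 := by
  have : (0 : ℝ) < K := by exact_mod_cast (by omega : 0 < K)
  have : (0 : ℝ) < ((K : ℝ)⁻¹) ^ j := by positivity
  unfold node
  linarith

theorem node_mono {K : ℕ} (hK : 2 ≤ K) : Monotone (node K) := fun i j hij => by
  have h1 : (2 : ℝ) ≤ K := by exact_mod_cast hK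
  have : ((K : ℝ)⁻¹) ^ j ≤ ((K : ℝ)⁻¹) ^ i :=
    pow_le_pow_of_le_one (by positivity) (inv_le_one_of_one_le₀ (by linarith)) hij
  unfold node
  linarith

theorem node_nonneg {K : ℕ} (hK : 2 ≤ K) (j : ℕ) : 0 ≤ node K j :=
  node_zero K ▸ node_mono hK (Nat.zero_le j)

/-- Makes the Jacobian factor r of polar coordinates harmless from the first node after 0 on. -/
theorem half_le_node_succ {K : ℕ} (hK : 2 ≤ K) (j : ℕ) : 1 / 2 ≤ node K (j + 1) := by
  refine le_trans ?_ (node_mono hK (Nat.le_add_left 1 j))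
  have h1 : (2 : ℝ) ≤ K := by exact_mod_cast hK
  have : (K : ℝ)⁻¹ ≤ 2⁻¹ := inv_anti₀ (by norm_num) h1
  simp only [node, pow_one]
  linarith

theorem exists_mem_Ico_node {K : ℕ} (hK : 2 ≤ K) {r : ℝ} (h0 : 0 ≤ r) (h1 : r < 1) :
    ∃ j, r ∈ Set.Ico (node K j) (node K (j + 1)) := by
  have hex : ∃ j, r < node K j := by
    have hK1 : (2 : ℝ) ≤ K := by exact_mod_cast hK
    obtain ⟨n, hn⟩ := exists_pow_lt_of_lt_one (sub_pos.2 h1)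
      (inv_lt_one_of_one_lt₀ (by linarith : (1 : ℝ) < K))
    exact ⟨n, by unfold node; linarith⟩
  classical
  have hpos : Nat.find hex ≠ 0 := fun h => by
    have := Nat.find_spec hex
    rw [h, node_zero] at this
    linarith
  obtain ⟨j, hj⟩ := Nat.exists_eq_succ_of_ne_zero hpos
  refine ⟨j, not_lt.1 (Nat.find_min hex (by omega)), ?_⟩
  have := Nat.find_spec hex
  rwa [hj] at this

theorem iUnion_Ico_node {K : ℕ} (hK : 2 ≤ K) :
    ⋃ j, Set.Ico (node K j) (node K (j + 1)) = Set.Ico 0 1 := by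
  ext r
  simp only [Set.mem_iUnion]
  refine ⟨fun ⟨j, hj⟩ => ⟨(node_nonneg hK j).trans hj.1, hj.2.trans (node_lt_one hK _)⟩, fun h =>
    exists_mem_Ico_node hK h.1 h.2⟩

section Tail

variable {ω : ℝ → ℝ}

theorem IsDoubling.intervalIntegrable (hω : IsDoubling ω) {a b : ℝ} (ha : 0 ≤ a) (hab : a ≤ b)
    (hb : b ≤ 1) : IntervalIntegrable ω volume a b := by
  rw [intervalIntegrable_iff_integrableOn_Ioo_of_le hab]
  exact hω.upper.1.mono_set (Set.Ioo_subset_Ioo ha hb)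

theorem IsDoubling.ofReal_tail_sub (hω : IsDoubling ω) {a b : ℝ} (ha : 0 ≤ a) (hab : a ≤ b)
    (hb : b ≤ 1) :
    ENNReal.ofReal (tail ω a - tail ω b) = ∫⁻ r in Set.Ico a b, ENNReal.ofReal (ω r) := by
  have h1 : tail ω a - tail ω b = ∫ r in a..b, ω r := by
    have := intervalIntegral.integral_add_adjacent_intervals
      (hω.intervalIntegrable ha hab hb) (hω.intervalIntegrable (ha.trans hab) hb le_rfl)
    unfold tail
    linarith
  -- Half-open intervals [a, b) are used because b may be 1 and the sign of ω is known only on [0,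
  -- 1).
  rw [h1, intervalIntegral.integral_of_le hab, ← integral_Icc_eq_integral_Ioc,
    integral_Icc_eq_integral_Ico, ofReal_integral_eq_lintegral_ofReal]
  · exact (integrableOn_Ico_iff_integrableOn_Ioo).2
      (hω.upper.1.mono_set (Set.Ioo_subset_Ioo ha hb))
  · rw [EventuallyLE, ae_restrict_iff' measurableSet_Ico]
    exact .of_forall fun r hr => hω.isRadialWeight.nonneg r ⟨ha.trans hr.1, hr.2.trans_le hb⟩

theorem IsDoubling.tail_anti (hω : IsDoubling ω) {a b : ℝ} (ha : 0 ≤ a) (hab : a ≤ b)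
    (hb : b ≤ 1) : tail ω b ≤ tail ω a := by
  have := intervalIntegral.integral_add_adjacent_intervals
    (hω.intervalIntegrable ha hab hb) (hω.intervalIntegrable (ha.trans hab) hb le_rfl)
  have h2 : 0 ≤ ∫ r in a..b, ω r := by
    rw [intervalIntegral.integral_of_le hab, ← integral_Icc_eq_integral_Ioc,
      integral_Icc_eq_integral_Ico]
    exact setIntegral_nonneg measurableSet_Ico
      fun r hr => hω.isRadialWeight.nonneg r ⟨ha.trans hr.1, hr.2.trans_le hb⟩
  unfold tail
  linarith

theorem IsDoubling.tail_pos (hω : IsDoubling ω) {r : ℝ} (h0 : 0 ≤ r) (h1 : r < 1) :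
    0 < tail ω r :=
  (hω.isRadialWeight.tail_pos ((1 + r) / 2) ⟨by linarith, by linarith⟩).trans_le
    (hω.tail_anti h0 (by linarith) (by linarith))

/-- The tails decay geometrically, at a two-sided rate, along the points `1 - K^{-j}`. -/
structure IsGeometricAlong (K : ℕ) (θ C : ℝ) (ω : ℝ → ℝ) : Prop where
  le_theta_mul : ∀ j, tail ω (node K (j + 1)) ≤ θ * tail ω (node K j)
  le_const_mul : ∀ j, tail ω (node K j) ≤ C * tail ω (node K (j + 1))

/-- Lower doubling with ratio K₁ gives the same θ for every K ≥ K₁, since tails decrease. Iterating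
upper doubling K times reaches beyond the next node, as 2^K ≥ K, and gives C = C₁^K. All large K are
allowed so that one K can serve three weights. -/
theorem IsDoubling.exists_isGeometricAlong (hω : IsDoubling ω) :
    ∃ K₀ : ℕ, ∃ θ : ℝ, 0 < θ ∧ θ < 1 ∧ ∀ K : ℕ, K₀ ≤ K → 2 ≤ K →
      ∃ C : ℝ, 1 ≤ C ∧ IsGeometricAlong K θ C ω := by
  obtain ⟨K₁, C₂, hK₁, hC₂, hlow⟩ := hω.lower
  obtain ⟨-, C₁, hC₁, hup⟩ := hω.upper
  obtain ⟨K₀, hK₀⟩ := exists_nat_ge K₁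
  refine ⟨K₀, C₂⁻¹, by positivity, inv_lt_one_of_one_lt₀ hC₂, fun K hK h2K => ?_⟩
  have hK1 : K₁ ≤ K := hK₀.trans (by exact_mod_cast hK)
  have hKpos : (0 : ℝ) < K := by linarith
  refine ⟨C₁ ^ K, one_le_pow₀ hC₁, fun j => ?_, fun j => ?_⟩
  · have hj := node_lt_one h2K j
    have h0 := node_nonneg h2K j
    have h1 := hlow (node K j) ⟨h0, hj⟩
    rw [inv_mul_eq_div, le_div_iff₀ (by linarith), mul_comm]
    refine le_trans ?_ h1
    gcongr
    rw [node_succ]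
    have h3 : (1 - node K j) / K ≤ (1 - node K j) / K₁ := by gcongr
    have h4 : (1 - node K j) / K₁ ≤ 1 := by
      rw [div_le_one (by linarith)]; linarith
    exact hω.tail_anti (by linarith) (by linarith) (by
      have : 0 ≤ (1 - node K j) / K := div_nonneg (by linarith) hKpos.le
      linarith)
  · have hj := node_lt_one h2K j
    have h0 := node_nonneg h2K j
    have hiter : ∀ m : ℕ, tail ω (node K j) ≤ C₁ ^ m * tail ω (1 - (1 - node K j) / 2 ^ m) := by
      intro m
      induction m with
      | zero => simp
      | succ m ih =>
        have h5 : (1 - node K j) / 2 ^ m ≤ 1 - node K j :=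
          div_le_self (by linarith) (one_le_pow₀ (by norm_num))
        have h6 : 0 < (1 - node K j) / 2 ^ m := div_pos (by linarith) (by positivity)
        have h7 := hup (1 - (1 - node K j) / 2 ^ m) ⟨by linarith, by linarith⟩
        have h8 : (1 + (1 - (1 - node K j) / 2 ^ m)) / 2 = 1 - (1 - node K j) / 2 ^ (m + 1) := by
          rw [pow_succ]; field_simp; ring
        rw [h8] at h7
        calc _ ≤ _ := ih
          _ ≤ C₁ ^ m * (C₁ * tail ω (1 - (1 - node K j) / 2 ^ (m + 1))) := by gcongr
          _ = _ := by ring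
    refine (hiter K).trans ?_
    have h9 : (1 - node K j) / 2 ^ K ≤ (1 - node K j) / K := by
      gcongr
      exact_mod_cast Nat.lt_two_pow_self.le
    gcongr
    rw [node_succ]
    refine hω.tail_anti (by
      have : (1 - node K j) / K ≤ 1 := by
        rw [div_le_one hKpos]
        have : (2 : ℝ) ≤ K := by exact_mod_cast h2K
        linarith
      linarith) (by linarith) (by
      have : 0 ≤ (1 - node K j) / 2 ^ K := div_nonneg (by linarith) (by positivity)
      linarith)

/-- On [r_j, r_{j+1}) the mean is at most its value at r_{j+1}, and the mass is at most the tail at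
r_j, hence at most C times the tail at r_{j+1}. -/
theorem lintegral_le_tsum_tail (hω : IsDoubling ω) {K : ℕ} (hK : 2 ≤ K) {θ C : ℝ} (hC : 0 ≤ C)
    (hg : IsGeometricAlong K θ C ω) {I : ℝ → ℝ≥0∞} (hI : MonotoneOn I (Set.Ico 0 1)) :
    ∫⁻ r in Set.Ioo 0 1, ENNReal.ofReal (r * ω r) * I r ≤
      ENNReal.ofReal C * ∑' j, ENNReal.ofReal (tail ω (node K (j + 1))) * I (node K (j + 1)) := by
  have hmem : ∀ j, node K j ∈ Set.Ico (0 : ℝ) 1 := fun j => ⟨node_nonneg hK j, node_lt_one hK j⟩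
  calc _ ≤ ∫⁻ r in ⋃ j, Set.Ico (node K j) (node K (j + 1)), ENNReal.ofReal (r * ω r) * I r := by
        rw [iUnion_Ico_node hK]
        exact lintegral_mono_set Set.Ioo_subset_Ico_self
    _ ≤ ∑' j, ∫⁻ r in Set.Ico (node K j) (node K (j + 1)), ENNReal.ofReal (r * ω r) * I r :=
        lintegral_iUnion_le _ _
    _ ≤ ∑' j, ENNReal.ofReal C *
          (ENNReal.ofReal (tail ω (node K (j + 1))) * I (node K (j + 1))) := by
        refine ENNReal.tsum_le_tsum fun j => ?_
        have h1 : ∀ r ∈ Set.Ico (node K j) (node K (j + 1)), ENNReal.ofReal (r * ω r) * I r ≤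
            ENNReal.ofReal (ω r) * I (node K (j + 1)) := fun r hr => by
          have hr' : r ∈ Set.Ico (0 : ℝ) 1 := ⟨(hmem j).1.trans hr.1, hr.2.trans (hmem _).2⟩
          gcongr
          · exact mul_le_of_le_one_left (hω.isRadialWeight.nonneg r hr') hr'.2.le
          · exact hI hr' (hmem _) hr.2.le
        refine (setLIntegral_mono' measurableSet_Ico h1).trans ?_
        have hmeas : AEMeasurable (fun r => ENNReal.ofReal (ω r))
            (volume.restrict (Set.Ico (node K j) (node K (j + 1)))) :=
          (((integrableOn_Ico_iff_integrableOn_Ioo).2 (hω.upper.1.mono_set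
            (Set.Ioo_subset_Ioo (hmem j).1 (hmem _).2.le))).aestronglyMeasurable).aemeasurable.ennreal_ofReal
        rw [lintegral_mul_const'' _ hmeas, ← hω.ofReal_tail_sub (hmem j).1
          (node_mono hK (Nat.le_succ j)) (hmem _).2.le, ← mul_assoc, ← ENNReal.ofReal_mul hC]
        gcongr
        have := hg.le_const_mul j
        linarith [hω.tail_pos (hmem (j + 1)).1 (hmem (j + 1)).2]
    _ = _ := ENNReal.tsum_mul_left

/-- On [r_{j+1}, r_{j+2}) the mean is at least its value at r_{j+1}, r ≥ 1/2, and the mass is at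
least 1 - θ times the tail at r_{j+1}; hence the constant 2/(1 - θ). -/
theorem tsum_tail_le_lintegral (hω : IsDoubling ω) {K : ℕ} (hK : 2 ≤ K) {θ C : ℝ} (hθ : θ < 1)
    (hg : IsGeometricAlong K θ C ω) {I : ℝ → ℝ≥0∞} (hI : MonotoneOn I (Set.Ico 0 1)) :
    ∑' j, ENNReal.ofReal (tail ω (node K (j + 1))) * I (node K (j + 1)) ≤
      ENNReal.ofReal (2 / (1 - θ)) * ∫⁻ r in Set.Ioo 0 1, ENNReal.ofReal (r * ω r) * I r := by
  have hmem : ∀ j, node K j ∈ Set.Ico (0 : ℝ) 1 := fun j => ⟨node_nonneg hK j, node_lt_one hK j⟩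
  have hθ' : 0 < 1 - θ := by linarith
  have hsub : ⋃ j, Set.Ico (node K (j + 1)) (node K (j + 1 + 1)) ⊆ Set.Ioo 0 1 := by
    refine Set.iUnion_subset fun j r hr => ⟨?_, hr.2.trans (hmem _).2⟩
    have := half_le_node_succ hK j
    linarith [hr.1]
  have hdisj : Pairwise (Function.onFun Disjoint
      fun j => Set.Ico (node K (j + 1)) (node K (j + 1 + 1))) :=
    Monotone.pairwise_disjoint_on_Ico_succ (f := fun j => node K (j + 1))
      fun i j hij => node_mono hK (by omega)
  calc _ ≤ ∑' j, ENNReal.ofReal (2 / (1 - θ)) * ∫⁻ r in Set.Ico (node K (j + 1))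
          (node K (j + 1 + 1)), ENNReal.ofReal (r * ω r) * I r := by
        refine ENNReal.tsum_le_tsum fun j => ?_
        have h1 : ∀ r ∈ Set.Ico (node K (j + 1)) (node K (j + 1 + 1)),
            ENNReal.ofReal (1 / 2) * (ENNReal.ofReal (ω r) * I (node K (j + 1))) ≤
            ENNReal.ofReal (r * ω r) * I r := fun r hr => by
          have hr' : r ∈ Set.Ico (0 : ℝ) 1 := ⟨(hmem _).1.trans hr.1, hr.2.trans (hmem _).2⟩
          rw [← mul_assoc, ← ENNReal.ofReal_mul (by norm_num)]
          gcongr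
          · exact hω.isRadialWeight.nonneg r hr'
          · exact (half_le_node_succ hK j).trans hr.1
          · exact hI (hmem _) hr' hr.1
        refine le_trans ?_ (mul_le_mul_right (setLIntegral_mono' measurableSet_Ico h1) _)
        have hmeas : AEMeasurable (fun r => ENNReal.ofReal (ω r))
            (volume.restrict (Set.Ico (node K (j + 1)) (node K (j + 1 + 1)))) :=
          (((integrableOn_Ico_iff_integrableOn_Ioo).2 (hω.upper.1.mono_set
            (Set.Ioo_subset_Ioo (hmem _).1 (hmem _).2.le))).aestronglyMeasurable).aemeasurable.ennreal_ofReal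
        rw [lintegral_const_mul'' _ (hmeas.mul_const _), lintegral_mul_const'' _ hmeas,
          ← hω.ofReal_tail_sub (hmem _).1
          (node_mono hK (Nat.le_succ _)) (hmem _).2.le, ← mul_assoc, ← mul_assoc,
          ← ENNReal.ofReal_mul (by positivity), ← ENNReal.ofReal_mul (by positivity)]
        gcongr
        have := hg.le_theta_mul (j + 1)
        have h3 : (1 - θ) * tail ω (node K (j + 1)) ≤
          tail ω (node K (j + 1)) - tail ω (node K (j + 1 + 1)) := by linarith
        calc tail ω (node K (j + 1)) = 2 / (1 - θ) * (1 / 2) *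
              ((1 - θ) * tail ω (node K (j + 1))) := by field_simp
          _ ≤ _ := by gcongr
    _ = ENNReal.ofReal (2 / (1 - θ)) * ∫⁻ r in ⋃ j, Set.Ico (node K (j + 1)) (node K (j + 1 + 1)),
          ENNReal.ofReal (r * ω r) * I r := by
        rw [ENNReal.tsum_mul_left, lintegral_iUnion (fun _ => measurableSet_Ico) hdisj]
    _ ≤ _ := by
        gcongr

end Tail

/-! ### Polar coordinates -/

theorem lintegral_circle {p : ℝ} (hp : 0 < p) (r : ℝ) (F : ℂ → ℂ) :
    ∫⁻ θ in Set.Ioo (-π) π, ‖F (r * (Real.cos θ + Real.sin θ * Complex.I))‖ₑ ^ p =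
      circMean (ENNReal.ofReal p) r F ^ p := by
  rw [circMean_rpow hp, ← AddCircle.lintegral_preimage (2 * π) (-π),
    show -π + 2 * π = π by ring, restrict_Ioo_eq_restrict_Ioc]
  refine lintegral_congr fun θ => ?_
  rw [unitPt_coe, Complex.exp_mul_I, Complex.ofReal_cos, Complex.ofReal_sin]

theorem lintegral_weightMeasure {ω : ℝ → ℝ} (hω : IsDoubling ω) {p : ℝ} (hp : 0 < p) {F : ℂ → ℂ}
    (hF : ContinuousOn F (ball 0 1)) :
    ∫⁻ z : 𝔻, ‖F z‖ₑ ^ p ∂(weightMeasure ω) = ENNReal.ofReal (1 / π) *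
      ∫⁻ r in Set.Ioo 0 1, ENNReal.ofReal (r * ω r) * circMean (ENNReal.ofReal p) r F ^ p := by
  have hball : MeasurableSet (ball (0 : ℂ) 1) := measurableSet_ball
  have hd : AEMeasurable (fun z : 𝔻 => ENNReal.ofReal (ω ‖(z : ℂ)‖))
      (Measure.comap (Subtype.val : 𝔻 → ℂ) volume) := by
    have := hω.isRadialWeight.integrableOn_disc.aestronglyMeasurable.aemeasurable.ennreal_ofReal
    rw [← map_comap_subtype_coe hball, (MeasurableEmbedding.subtype_coe hball).aemeasurable_map_iff]
      at this
    exact this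
  have hFm : Measurable fun z : 𝔻 => ‖F z‖ₑ ^ p := by
    have : Continuous fun z : 𝔻 => F z := hF.comp_continuous continuous_subtype_val fun z => z.2
    exact this.measurable.enorm.pow_const p
  rw [weightMeasure, lintegral_withDensity_eq_lintegral_mul₀ (hd.smul_measure _)
    hFm.aemeasurable, lintegral_smul_measure, smul_eq_mul]
  congr 1
  have h1 := lintegral_subtype_comap (μ := volume) hball
    (fun z : ℂ => ENNReal.ofReal (ω ‖z‖) * ‖F z‖ₑ ^ p)
  simp only [Pi.mul_apply]
  rw [h1, ← lintegral_indicator hball, ← Complex.lintegral_comp_polarCoord_symm]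
  set S : Set (ℝ × ℝ) := Set.Ioo (0 : ℝ) 1 ×ˢ Set.Ioo (-π) π with hS
  have hSm : MeasurableSet S := measurableSet_Ioo.prod measurableSet_Ioo
  have hpt : ∀ x : ℝ × ℝ, Complex.polarCoord.symm x =
      x.1 * (Real.cos x.2 + Real.sin x.2 * Complex.I) := fun x => by
    rw [Complex.polarCoord_symm_apply]
  have hnorm : ∀ x : ℝ × ℝ, ‖Complex.polarCoord.symm x‖ = |x.1| := fun x =>
    Complex.norm_polarCoord_symm x
  set H : ℝ × ℝ → ℝ≥0∞ := fun x => ENNReal.ofReal (x.1 * ω x.1) *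
    ‖F (x.1 * (Real.cos x.2 + Real.sin x.2 * Complex.I))‖ₑ ^ p with hH
  have h2 : ∫⁻ x in polarCoord.target, ENNReal.ofReal x.1 • (ball (0 : ℂ) 1).indicator
      (fun z => ENNReal.ofReal (ω ‖z‖) * ‖F z‖ₑ ^ p) (Complex.polarCoord.symm x) =
      ∫⁻ x in S, H x := by
    rw [← lintegral_indicator polarCoord.open_target.measurableSet, ← lintegral_indicator hSm]
    refine lintegral_congr fun x => ?_
    by_cases hx : x ∈ S
    · have hxt : x ∈ polarCoord.target := by
        rw [polarCoord_target]; exact ⟨hx.1.1, hx.2⟩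
      have hxb : Complex.polarCoord.symm x ∈ ball (0 : ℂ) 1 := by
        rw [mem_ball_zero_iff, hnorm, abs_of_pos hx.1.1]; exact hx.1.2
      rw [Set.indicator_of_mem hx, Set.indicator_of_mem hxt, Set.indicator_of_mem hxb, hnorm,
        abs_of_pos hx.1.1, hpt, smul_eq_mul, ← mul_assoc, ← ENNReal.ofReal_mul hx.1.1.le]
    · rw [Set.indicator_of_notMem hx]
      by_cases hxt : x ∈ polarCoord.target
      · rw [Set.indicator_of_mem hxt, Set.indicator_of_notMem, smul_zero]
        rw [polarCoord_target] at hxt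
        intro hxb
        rw [mem_ball_zero_iff, hnorm, abs_of_pos hxt.1] at hxb
        exact hx ⟨⟨hxt.1, hxb⟩, hxt.2⟩
      · rw [Set.indicator_of_notMem hxt]
  rw [h2, hS, Measure.volume_eq_prod, ← Measure.prod_restrict, lintegral_prod]
  · refine setLIntegral_congr_fun measurableSet_Ioo fun r hr => ?_
    simp only [hH]
    rw [lintegral_const_mul' _ _ ENNReal.ofReal_ne_top, lintegral_circle hp]
  -- The profile ω is measurable only almost everywhere, through its integrability on (0, 1).
  · have hω1 : AEMeasurable (fun r => ENNReal.ofReal (r * ω r)) (volume.restrict (Set.Ioo 0 1)) :=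
      (aemeasurable_id.mul hω.upper.1.aestronglyMeasurable.aemeasurable).ennreal_ofReal
    refine hω1.comp_fst.mul ?_
    rw [Measure.prod_restrict, ← Measure.volume_eq_prod]
    have hc : ContinuousOn (fun x : ℝ × ℝ =>
        F (x.1 * (Real.cos x.2 + Real.sin x.2 * Complex.I))) S := by
      refine hF.comp (Continuous.continuousOn (by fun_prop)) fun x hx => ?_
      rw [← hpt, mem_ball_zero_iff, hnorm, abs_of_pos hx.1.1]
      exact hx.1.2
    exact ((hc.aemeasurable hSm).enorm).pow_const p

/-! ### The discrete norm -/

/-- The `p`-th power of the discretized norm of the weighted Bergman space. -/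
def discreteNorm (K : ℕ) (p : ℝ) (ω : ℝ → ℝ) (F : ℂ → ℂ) : ℝ≥0∞ :=
  ∑' j, ENNReal.ofReal (tail ω (node K (j + 1))) *
    circMean (ENNReal.ofReal p) (node K (j + 1)) F ^ p

theorem monotoneOn_circMean {p : ℝ} (hp : 1 ≤ p) {F : ℂ → ℂ} (hF : DifferentiableOn ℂ F (ball 0 1)) :
    MonotoneOn (fun r => circMean (ENNReal.ofReal p) r F ^ p) (Set.Ico 0 1) := by
  intro r hr s hs hrs
  exact ENNReal.rpow_le_rpow (circMean_mono_of_lt hp hr.1 hrs hs.2 hF) (by linarith)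

theorem lintegral_le_discreteNorm {ω : ℝ → ℝ} (hω : IsDoubling ω) {K : ℕ} (hK : 2 ≤ K) {θ C : ℝ}
    (hC : 0 ≤ C) (hg : IsGeometricAlong K θ C ω) {p : ℝ} (hp : 1 ≤ p) {F : ℂ → ℂ}
    (hF : DifferentiableOn ℂ F (ball 0 1)) :
    ∫⁻ z : 𝔻, ‖F z‖ₑ ^ p ∂(weightMeasure ω) ≤
      ENNReal.ofReal (C / π) * discreteNorm K p ω F := by
  rw [lintegral_weightMeasure hω (by linarith) hF.continuousOn, div_eq_mul_one_div C, mul_comm C,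
    ENNReal.ofReal_mul (by positivity), mul_assoc]
  gcongr
  exact lintegral_le_tsum_tail hω hK hC hg (monotoneOn_circMean hp hF)

theorem discreteNorm_le_lintegral {ω : ℝ → ℝ} (hω : IsDoubling ω) {K : ℕ} (hK : 2 ≤ K) {θ C : ℝ}
    (hθ : θ < 1) (hg : IsGeometricAlong K θ C ω) {p : ℝ} (hp : 1 ≤ p) {F : ℂ → ℂ}
    (hF : DifferentiableOn ℂ F (ball 0 1)) :
    discreteNorm K p ω F ≤
      ENNReal.ofReal (2 / (1 - θ) * π) * ∫⁻ z : 𝔻, ‖F z‖ₑ ^ p ∂(weightMeasure ω) := by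
  rw [lintegral_weightMeasure hω (by linarith) hF.continuousOn, ← mul_assoc,
    ← ENNReal.ofReal_mul (by have : 0 < 1 - θ := by linarith
                             positivity)]
  rw [mul_assoc (2 / (1 - θ)), mul_one_div_cancel Real.pi_ne_zero, mul_one]
  exact tsum_tail_le_lintegral hω hK hθ hg (monotoneOn_circMean hp hF)

/-! ### A Schur test -/

/-- In truncated subtraction the exponent is |i - j|; each distance occurs at most twice, whence two
geometric series. -/
theorem tsum_pow_dist_le (σ : ℝ≥0∞) (i : ℕ) :
    ∑' j, σ ^ ((i - j) + (j - i)) ≤ 2 * (1 - σ)⁻¹ := by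
  rw [← Summable.sum_add_tsum_nat_add' (f := fun j => σ ^ ((i - j) + (j - i))) (k := i)
    ENNReal.summable, two_mul]
  gcongr
  · calc ∑ j ∈ Finset.range i, σ ^ ((i - j) + (j - i))
        = ∑ j ∈ Finset.range i, σ ^ (j + 1) := by
          rw [← Finset.sum_range_reflect]
          refine Finset.sum_congr rfl fun j hj => ?_
          have := Finset.mem_range.1 hj
          congr 1
          omega
      _ ≤ ∑' j, σ ^ (j + 1) := ENNReal.sum_le_tsum _
      _ ≤ ∑' j, σ ^ j := by
          rw [tsum_eq_zero_add' (f := fun j => σ ^ j) ENNReal.summable]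
          exact le_add_self
      _ = _ := ENNReal.tsum_geometric σ
  · refine le_of_eq ?_
    rw [← ENNReal.tsum_geometric]
    congr 1
    ext j
    congr 1
    omega

/-- Taking p-th roots moves the weight inside the sum and leaves the kernel σ^{|i-j|} with σ =
τ^{1/p}. Hölder with these weights costs S^{p-1} and the summation over i costs one more S. -/
theorem schur_test {p : ℝ} (hp : 1 ≤ p) (J : ℕ) {W : ℕ → ℝ≥0∞} {κ : ℕ → ℕ → ℝ≥0∞} {A τ : ℝ≥0∞}
    (h : ∀ i j, W i * κ i j ^ p ≤ A * τ ^ ((i - j) + (j - i)) * W j) (y : ℕ → ℝ≥0∞) :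
    ∑' i, W i * (∑ j ∈ Finset.range J, κ i j * y j) ^ p ≤
      A * (2 * (1 - τ ^ (1 / p))⁻¹) ^ p * ∑ j ∈ Finset.range J, W j * y j ^ p := by
  have hp0 : 0 < p := by linarith
  set σ := τ ^ (1 / p) with hσ
  set S := 2 * (1 - σ)⁻¹ with hS
  have hroot : ∀ x : ℝ≥0∞, (x ^ (1 / p)) ^ p = x := fun x => by
    rw [← ENNReal.rpow_mul, one_div_mul_cancel hp0.ne', ENNReal.rpow_one]
  have hroot' : ∀ x : ℝ≥0∞, (x ^ p) ^ (1 / p) = x := fun x => by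
    rw [← ENNReal.rpow_mul, mul_one_div_cancel hp0.ne', ENNReal.rpow_one]
  have h1 : ∀ i j, W i ^ (1 / p) * κ i j ≤
      A ^ (1 / p) * (σ ^ ((i - j) + (j - i)) * W j ^ (1 / p)) := fun i j => by
    have := ENNReal.rpow_le_rpow (h i j) (by positivity : 0 ≤ 1 / p)
    rw [ENNReal.mul_rpow_of_nonneg _ _ (by positivity), hroot',
      ENNReal.mul_rpow_of_nonneg _ _ (by positivity),
      ENNReal.mul_rpow_of_nonneg _ _ (by positivity), mul_assoc, ← ENNReal.rpow_natCast,
      ← ENNReal.rpow_mul, mul_comm ((_ : ℕ) : ℝ), ENNReal.rpow_mul, ENNReal.rpow_natCast] at this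
    exact this
  have h2 : ∀ i, W i * (∑ j ∈ Finset.range J, κ i j * y j) ^ p ≤
      A * S ^ (p - 1) * ∑ j ∈ Finset.range J, σ ^ ((i - j) + (j - i)) * (W j * y j ^ p) := fun i => by
    calc _ = (∑ j ∈ Finset.range J, W i ^ (1 / p) * κ i j * y j) ^ p := by
          simp_rw [mul_assoc]
          rw [← Finset.mul_sum, ENNReal.mul_rpow_of_nonneg _ _ hp0.le, hroot]
      _ ≤ (∑ j ∈ Finset.range J, A ^ (1 / p) *
            (σ ^ ((i - j) + (j - i)) * (W j ^ (1 / p) * y j))) ^ p := by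
          refine ENNReal.rpow_le_rpow (Finset.sum_le_sum fun j _ => ?_) hp0.le
          rw [← mul_assoc (σ ^ _), ← mul_assoc (A ^ _)]
          exact mul_le_mul_left ((h1 i j).trans_eq (by ring)) _
      _ = A * (∑ j ∈ Finset.range J, σ ^ ((i - j) + (j - i)) * (W j ^ (1 / p) * y j)) ^ p := by
          rw [← Finset.mul_sum, ENNReal.mul_rpow_of_nonneg _ _ hp0.le, hroot]
      _ ≤ A * ((∑ j ∈ Finset.range J, σ ^ ((i - j) + (j - i))) ^ (1 - p⁻¹) *
            (∑ j ∈ Finset.range J, σ ^ ((i - j) + (j - i)) * (W j ^ (1 / p) * y j) ^ p) ^ p⁻¹) ^ p := by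
          gcongr
          exact ENNReal.inner_le_weight_mul_Lp_of_nonneg _ hp _ _
      _ = A * ((∑ j ∈ Finset.range J, σ ^ ((i - j) + (j - i))) ^ (p - 1) *
            ∑ j ∈ Finset.range J, σ ^ ((i - j) + (j - i)) * (W j * y j ^ p)) := by
          rw [ENNReal.mul_rpow_of_nonneg _ _ hp0.le, ← ENNReal.rpow_mul, ← one_div, hroot]
          congr 3
          · field_simp
          · ext j
            rw [ENNReal.mul_rpow_of_nonneg _ _ hp0.le, hroot]
      _ ≤ _ := by
          rw [mul_assoc]
          have : 0 ≤ p - 1 := by linarith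
          gcongr
          exact (ENNReal.sum_le_tsum _).trans (tsum_pow_dist_le σ i)
  calc _ ≤ ∑' i, A * S ^ (p - 1) *
        ∑ j ∈ Finset.range J, σ ^ ((i - j) + (j - i)) * (W j * y j ^ p) := ENNReal.tsum_le_tsum h2
    _ = A * S ^ (p - 1) * ∑ j ∈ Finset.range J,
        (∑' i, σ ^ ((i - j) + (j - i))) * (W j * y j ^ p) := by
      rw [ENNReal.tsum_mul_left, Summable.tsum_finsetSum fun _ _ => ENNReal.summable]
      simp_rw [ENNReal.tsum_mul_right]
    _ ≤ A * S ^ (p - 1) * ∑ j ∈ Finset.range J, S * (W j * y j ^ p) := by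
      gcongr with j
      refine le_trans (le_of_eq ?_) (tsum_pow_dist_le σ j)
      simp_rw [add_comm]
    _ = _ := by
      rw [← Finset.mul_sum, ← mul_assoc, mul_assoc A]
      congr 2
      have hS0 : S ≠ 0 := by simp [hS]
      -- S is infinite when τ ≥ 1; then S^{p-1} is nonzero and both sides are infinite.
      rcases eq_or_ne S ⊤ with hSt | hSt
      · rw [hSt, ENNReal.top_rpow_of_pos hp0, ENNReal.mul_top]
        exact (ENNReal.rpow_pos_of_nonneg (by simp) (by linarith)).ne'
      · nth_rewrite 2 [← ENNReal.rpow_one S]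
        rw [← ENNReal.rpow_add _ _ hS0 hSt]
        simp

/-- The exponents of the frequency blocks. -/
def blockExp (K j : ℕ) : ℕ := if j = 0 then 0 else K ^ j

/-- Double exponential decay beats any geometric growth: choose n with 2C < 2^n and use e^{-x} ≤
n!/x^n at x = 2^d. -/
theorem exists_const_mul_exp_le (C : ℝ) (hC : 1 ≤ C) :
    ∃ A : ℝ, 1 ≤ A ∧ ∀ d : ℕ, C ^ (d + 1) * Real.exp (-2 ^ d) ≤ A * (1 / 2) ^ (d + 1) := by
  obtain ⟨n, hn⟩ := pow_unbounded_of_one_lt (2 * C) (one_lt_two : (1 : ℝ) < 2)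
  have hfac : (1 : ℝ) ≤ n.factorial := by exact_mod_cast Nat.factorial_pos n
  refine ⟨2 ^ n * n.factorial, one_le_mul_of_one_le_of_one_le (one_le_pow₀ one_le_two) hfac,
    fun d => ?_⟩
  have h1 : Real.exp (-2 ^ d) ≤ n.factorial / (2 ^ d) ^ n := by
    have := Real.pow_div_factorial_le_exp ((2 : ℝ) ^ d) (by positivity) n
    rw [Real.exp_neg, ← inv_div]
    exact inv_anti₀ (by positivity) this
  have h2 : C ^ (d + 1) ≤ (2 ^ n) ^ (d + 1) * (1 / 2) ^ (d + 1) := by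
    rw [← mul_pow]
    gcongr
    linarith
  calc C ^ (d + 1) * Real.exp (-2 ^ d)
      ≤ ((2 : ℝ) ^ n) ^ (d + 1) * (1 / 2) ^ (d + 1) * (n.factorial / (2 ^ d) ^ n) := by gcongr
    _ = _ := by
      rw [pow_succ (2 ^ n : ℝ) d, ← pow_mul, ← pow_mul, mul_comm d n]
      field_simp

/-- From 1 - x ≤ e^{-x}, the left side is at most exp(-K^d). -/
theorem node_pow_blockExp_le {K : ℕ} (hK : 2 ≤ K) (i d : ℕ) :
    node K (i + 1) ^ blockExp K (i + d + 1) ≤ Real.exp (-2 ^ d) := by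
  have hK0 : (0 : ℝ) < K := by exact_mod_cast (by omega : 0 < K)
  have h1 : node K (i + 1) ≤ Real.exp (-((K : ℝ)⁻¹) ^ (i + 1)) := by
    have := Real.add_one_le_exp (-((K : ℝ)⁻¹) ^ (i + 1))
    unfold node
    linarith
  have h2 : blockExp K (i + d + 1) = K ^ (i + d + 1) := by simp [blockExp]
  rw [h2]
  calc _ ≤ Real.exp (-((K : ℝ)⁻¹) ^ (i + 1)) ^ (K ^ (i + d + 1)) :=
        pow_le_pow_left₀ (node_nonneg hK _) h1 _
    _ = Real.exp (-(K : ℝ) ^ d) := by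
        rw [← Real.exp_nat_mul]
        congr 1
        push_cast
        rw [inv_pow, show i + d + 1 = (i + 1) + d by ring, pow_add]
        field_simp
    _ ≤ _ := by
        have : (2 : ℝ) ≤ K := by exact_mod_cast hK
        gcongr

/-- The Schur hypothesis for the kernel r_{i+1}^{K^j}. For j ≤ i the power is at most 1 and the
tails decay like θ^{i-j}. For j > i the tails can drop by a factor as small as C^{-(j-i)}, but the
power is double exponentially small. One constant serves all p ≥ 1 because the power lies in [0, 1].
-/
theorem kernel_bound {K : ℕ} (hK : 2 ≤ K) {θ C : ℝ} (hθ0 : 0 < θ) (hC : 1 ≤ C) :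
    ∃ A : ℝ, ∀ ω : ℝ → ℝ, IsDoubling ω → IsGeometricAlong K θ C ω → ∀ p : ℝ, 1 ≤ p → ∀ i j,
      ENNReal.ofReal (tail ω (node K (i + 1))) *
          ENNReal.ofReal (node K (i + 1) ^ blockExp K j) ^ p ≤
        ENNReal.ofReal A * ENNReal.ofReal (max θ (1 / 2)) ^ ((i - j) + (j - i)) *
          ENNReal.ofReal (tail ω (node K (j + 1))) := by
  obtain ⟨A, hA1, hA⟩ := exists_const_mul_exp_le C hC
  refine ⟨A, fun ω hω hg p hp i j => ?_⟩
  have hmem : ∀ j, 0 ≤ node K j ∧ node K j < 1 := fun j => ⟨node_nonneg hK j, node_lt_one hK j⟩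
  have htail : ∀ j, 0 < tail ω (node K j) := fun j => hω.tail_pos (hmem j).1 (hmem j).2
  have hk0 : 0 ≤ node K (i + 1) ^ blockExp K j := pow_nonneg (hmem _).1 _
  have hk1 : node K (i + 1) ^ blockExp K j ≤ 1 := pow_le_one₀ (hmem _).1 (hmem _).2.le
  have hkp : (node K (i + 1) ^ blockExp K j) ^ p ≤ node K (i + 1) ^ blockExp K j :=
    Real.rpow_le_self_of_le_one hk0 hk1 hp
  rw [ENNReal.ofReal_rpow_of_nonneg hk0 (by linarith), ← ENNReal.ofReal_mul (htail _).le,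
    ← ENNReal.ofReal_pow (by positivity), ← ENNReal.ofReal_mul (by positivity),
    ← ENNReal.ofReal_mul (by positivity)]
  refine ENNReal.ofReal_le_ofReal ?_
  rcases le_or_gt j i with hij | hij
  · obtain ⟨d, rfl⟩ := Nat.exists_eq_add_of_le hij
    have h1 : tail ω (node K (j + d + 1)) ≤ θ ^ d * tail ω (node K (j + 1)) := by
      clear hk0 hk1 hkp hij
      induction d with
      | zero => simp
      | succ d ih =>
        calc _ ≤ θ * tail ω (node K (j + d + 1)) := hg.le_theta_mul (j + d + 1)
          _ ≤ θ * (θ ^ d * tail ω (node K (j + 1))) := by gcongr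
          _ = _ := by ring
    rw [show j + d - j + (j - (j + d)) = d by omega]
    calc _ ≤ tail ω (node K (j + d + 1)) * 1 := by
          have := (htail (j + d + 1)).le
          gcongr
          exact hkp.trans hk1
      _ ≤ θ ^ d * tail ω (node K (j + 1)) := by rw [mul_one]; exact h1
      _ ≤ 1 * max θ (1 / 2) ^ d * tail ω (node K (j + 1)) := by
          have := (htail (j + 1)).le
          rw [one_mul]
          gcongr
          exact le_max_left _ _
      _ ≤ _ := by
          have := (htail (j + 1)).le
          gcongr
  · obtain ⟨d, rfl⟩ := Nat.exists_eq_add_of_lt hij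
    have h1 : ∀ e : ℕ, tail ω (node K (i + 1)) ≤ C ^ e * tail ω (node K (i + e + 1)) := fun e => by
      induction e with
      | zero => simp
      | succ e ih =>
        calc _ ≤ C ^ e * tail ω (node K (i + e + 1)) := ih
          _ ≤ C ^ e * (C * tail ω (node K (i + e + 1 + 1))) := by
            gcongr; exact hg.le_const_mul _
          _ = _ := by ring_nf
    rw [show i - (i + d + 1) + (i + d + 1 - i) = d + 1 by omega]
    have ht := (htail (i + d + 1 + 1)).le
    calc _ ≤ (C ^ (d + 1) * tail ω (node K (i + d + 1 + 1))) * Real.exp (-2 ^ d) := by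
          gcongr
          · exact h1 (d + 1)
          · exact hkp.trans (node_pow_blockExp_le hK i d)
      _ = C ^ (d + 1) * Real.exp (-2 ^ d) * tail ω (node K (i + d + 1 + 1)) := by ring
      _ ≤ A * (1 / 2) ^ (d + 1) * tail ω (node K (i + d + 1 + 1)) := by
          exact mul_le_mul_of_nonneg_right (hA d) ht
      _ ≤ _ := by
          gcongr
          exact le_max_right _ _

/-- Sums of functions in the disc algebra, multiplied by lacunary powers of `z`. -/
theorem exists_discreteNorm_sum_le {ω : ℝ → ℝ} (hω : IsDoubling ω) {K : ℕ} (hK : 2 ≤ K) {θ C : ℝ}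
    (hθ0 : 0 < θ) (hθ1 : θ < 1) (hC : 1 ≤ C) (hg : IsGeometricAlong K θ C ω) {p : ℝ} (hp : 1 ≤ p) :
    ∃ B : ℝ≥0∞, B ≠ ⊤ ∧ ∀ (J : ℕ) (g : ℕ → ℂ → ℂ) (s : ℕ → ℂ),
      (∀ j, DiffContOnCl ℂ (g j) (ball 0 1)) →
      discreteNorm K p ω (fun z => ∑ j ∈ Finset.range J, s j * (z ^ blockExp K j * g j z)) ≤
        B * ∑ j ∈ Finset.range J, ENNReal.ofReal (tail ω (node K (j + 1))) *
          (‖s j‖ₑ * circMean (ENNReal.ofReal p) 1 (g j)) ^ p := by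
  obtain ⟨A, hA⟩ := kernel_bound hK hθ0 hC
  have hp0 : 0 < p := by linarith
  refine ⟨ENNReal.ofReal A * (2 * (1 - ENNReal.ofReal (max θ (1 / 2)) ^ (1 / p))⁻¹) ^ p, ?_,
    fun J g s hgd => ?_⟩
  · have h1 : ENNReal.ofReal (max θ (1 / 2)) ^ (1 / p) < 1 :=
      ENNReal.rpow_lt_one (by
        rw [ENNReal.ofReal_lt_one]; exact max_lt hθ1 (by norm_num)) (by positivity)
    refine ENNReal.mul_ne_top ENNReal.ofReal_ne_top (ENNReal.rpow_ne_top_of_nonneg hp0.le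
      (ENNReal.mul_ne_top (by simp) (ENNReal.inv_ne_top.2 (tsub_pos_of_lt h1).ne')))
  -- The kernel is the modulus of the j-th lacunary power at r_{i+1}, and the entries are the means
  -- of s_j g_j at radius 1, which dominate those at every node. The resulting constant does not
  -- involve J.
  · refine le_trans ?_ (schur_test hp J (hA ω hω hg p hp) _)
    refine ENNReal.tsum_le_tsum fun i => ?_
    have hn0 := node_nonneg hK (i + 1)
    have hn1 := node_lt_one hK (i + 1)
    gcongr
    refine (circMean_sum_le (by simpa using hp) hn0 _ fun j _ => ?_).trans
      (Finset.sum_le_sum fun j _ => ?_)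
    · exact continuousOn_const.mul ((continuousOn_id.pow _).mul
        ((hgd j).continuousOn_ball.mono (closedBall_subset_closedBall hn1.le)))
    · rw [circMean_const_mul _ _ (s j) (fun z => z ^ blockExp K j * g j z)]
      have h2 : circMean (ENNReal.ofReal p) (node K (i + 1)) (fun z => z ^ blockExp K j * g j z) =
          ENNReal.ofReal (node K (i + 1) ^ blockExp K j) *
            circMean (ENNReal.ofReal p) (node K (i + 1)) (g j) := by
        rw [show ENNReal.ofReal (node K (i + 1) ^ blockExp K j) =
          ‖((node K (i + 1) ^ blockExp K j : ℝ) : ℂ)‖ₑ by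
            rw [← ofReal_norm, Complex.norm_of_nonneg (by positivity)], ← circMean_const_mul]
        refine circMean_congr_norm _ fun z hz => ?_
        rw [norm_mul, norm_mul, norm_pow, hz, abs_of_nonneg hn0,
          Complex.norm_of_nonneg (by positivity)]
      rw [h2, mul_left_comm]
      gcongr
      exact circMean_mono hp hn0 hn1.le (hgd j)

/-! ### Frequency blocks of a polynomial -/

/-- The partial sums of the decomposition of `P` into frequency blocks. -/
def blockSum (K : ℕ) (P : Polynomial ℂ) : ℕ → Polynomial ℂ
  | 0 => 0
  | j + 1 => vdp (2 * K ^ (j + 1)) P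

/-- The frequency blocks of `P`. -/
def block (K : ℕ) (P : Polynomial ℂ) (j : ℕ) : Polynomial ℂ := blockSum K P (j + 1) - blockSum K P j

/-- The sum telescopes to the last mean, which reproduces polynomials of degree at most 2K^J. -/
theorem sum_block {K : ℕ} (hK : 2 ≤ K) (P : Polynomial ℂ) {J : ℕ} (hJ : J ≠ 0)
    (hP : P.natDegree ≤ 2 * K ^ J) : ∑ j ∈ Finset.range J, block K P j = P := by
  unfold block
  rw [Finset.sum_range_sub]
  obtain ⟨J, rfl⟩ := Nat.exists_eq_succ_of_ne_zero hJ
  rw [blockSum, blockSum, sub_zero]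
  exact vdp_eq_self (by positivity) hP

/-- For j > 0 both means defining the block reproduce all coefficients up to degree 2K^j, which
cancel. The zeroth block keeps its constant term, hence the exponent 0 there. The factor 2 lets each
of the two factors of the block take half of the monomial. -/
theorem X_pow_dvd_block {K : ℕ} (hK : 2 ≤ K) (P : Polynomial ℂ) (j : ℕ) :
    Polynomial.X ^ (2 * blockExp K j) ∣ block K P j := by
  rw [Polynomial.X_pow_dvd_iff]
  rcases j with _ | j
  · simp [blockExp]
  · intro d hd
    have hd' : d < 2 * K ^ (j + 1) := by simpa [blockExp] using hd
    have h1 : 2 * K ^ (j + 1) ≤ 2 * K ^ (j + 1 + 1) := by gcongr <;> omega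
    rw [block, blockSum, blockSum, Polynomial.coeff_sub, coeff_vdp, coeff_vdp,
      vdpCoeff_of_le (by positivity) hd'.le, vdpCoeff_of_le (by positivity) (hd'.le.trans h1),
      sub_self]

theorem natDegree_block_le {K : ℕ} (hK : 2 ≤ K) (P : Polynomial ℂ) (j : ℕ) :
    (block K P j).natDegree ≤ 4 * K ^ (j + 1) := by
  have h : ∀ N, (vdp N P).natDegree ≤ 2 * N := fun N => by
    rw [Polynomial.natDegree_le_iff_coeff_eq_zero]
    intro n hn
    rw [coeff_vdp, vdpCoeff_of_ge hn.le, zero_mul]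
  refine (Polynomial.natDegree_sub_le _ _).trans (max_le ?_ ?_)
  · exact (h _).trans (by omega)
  · rcases j with _ | j
    · simp [blockSum]
    · refine (h _).trans ?_
      have h1 : K ^ (j + 1) ≤ K ^ (j + 1 + 1) := by gcongr <;> omega
      omega

theorem circMean_block_le {q : ℝ≥0∞} (hq : 1 ≤ q) {r : ℝ} (hr : 0 ≤ r) {K : ℕ} (hK : 2 ≤ K)
    (P : Polynomial ℂ) (j : ℕ) :
    circMean q r (fun z => (block K P j).eval z) ≤ 4 * circMean q r fun z => P.eval z := by
  have h1 : ∀ j, circMean q r (fun z => (blockSum K P j).eval z) ≤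
      2 * circMean q r fun z => P.eval z := fun j => by
    rcases j with _ | j
    · simp [blockSum, circMean]
    · exact circMean_vdp_le hq hr (by positivity) P
  calc _ = circMean q r (fun z => (blockSum K P (j + 1)).eval z + -1 * (blockSum K P j).eval z) := by
        congr 1; ext z; simp [block]; ring
    _ ≤ circMean q r (fun z => (blockSum K P (j + 1)).eval z) +
        circMean q r (fun z => -1 * (blockSum K P j).eval z) :=
      circMean_add_le hq hr (Polynomial.continuous _).continuousOn
        (continuous_const.mul (Polynomial.continuous _)).continuousOn
    _ ≤ 2 * circMean q r (fun z => P.eval z) + 2 * circMean q r (fun z => P.eval z) := by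
      rw [circMean_const_mul _ _ (-1) (fun z => (blockSum K P j).eval z)]
      exact add_le_add (h1 _) (by simpa using h1 j)
    _ = _ := by ring

/-- With N = K^{j+1} ≥ 2 one has log(1 - 1/N) ≥ -2/N, and the degree of the block is at most 4N. -/
theorem exp_neg_le_node_pow {K : ℕ} (hK : 2 ≤ K) (j : ℕ) :
    Real.exp (-8) ≤ node K (j + 1) ^ (4 * K ^ (j + 1)) := by
  have hK1 : (2 : ℝ) ≤ (K : ℝ) ^ (j + 1) := by
    have : 2 ≤ K ^ (j + 1) := hK.trans (Nat.le_self_pow (by omega) K)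
    exact_mod_cast this
  set N : ℝ := (K : ℝ) ^ (j + 1) with hN
  have hn : node K (j + 1) = 1 - N⁻¹ := by rw [node, inv_pow]
  have hNinv : N⁻¹ ≤ 1 / 2 := by rw [one_div]; exact inv_anti₀ (by norm_num) hK1
  have hpos : 0 < 1 - N⁻¹ := by linarith
  have h1 : -2 * N⁻¹ ≤ Real.log (1 - N⁻¹) := by
    refine le_trans ?_ (Real.one_sub_inv_le_log_of_pos hpos)
    have : (1 - N⁻¹)⁻¹ ≤ 1 + 2 * N⁻¹ := by
      rw [inv_le_iff_one_le_mul₀ hpos]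
      have : 0 < N⁻¹ := by positivity
      nlinarith
    linarith
  have h2 : Real.exp (-2 * N⁻¹) ≤ node K (j + 1) := by
    rw [hn, ← Real.le_log_iff_exp_le hpos]; exact h1
  calc Real.exp (-8) = Real.exp (-2 * N⁻¹) ^ (4 * K ^ (j + 1)) := by
        rw [← Real.exp_nat_mul]
        congr 1
        push_cast
        rw [← hN]
        field_simp
        norm_num
    _ ≤ _ := pow_le_pow_left₀ (by positivity) h2 _

/-- The block has degree comparable to 1/(1 - r_{j+1}), so the reverse inequality costs only e^8;
the 4 comes from two de la Vallée-Poussin means of norm at most 2. -/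
theorem circMean_one_block_le {q : ℝ≥0∞} (hq : 1 ≤ q) {K : ℕ} (hK : 2 ≤ K)
    (P : Polynomial ℂ) (j : ℕ) :
    circMean q 1 (fun z => (block K P j).eval z) ≤
      ENNReal.ofReal (4 * Real.exp 8) * circMean q (node K (j + 1)) fun z => P.eval z := by
  have h0 : 0 < node K (j + 1) := by linarith [half_le_node_succ hK j]
  have h1 := (circMean_one_le hq h0 (node_lt_one hK _).le (natDegree_block_le hK P j)).trans
    (circMean_block_le hq h0.le hK P j)
  calc _ = ENNReal.ofReal (Real.exp 8) * (ENNReal.ofReal (Real.exp (-8)) *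
        circMean q 1 (fun z => (block K P j).eval z)) := by
        rw [← mul_assoc, ← ENNReal.ofReal_mul (by positivity), ← Real.exp_add]
        simp
    _ ≤ ENNReal.ofReal (Real.exp 8) * (4 * circMean q (node K (j + 1)) fun z => P.eval z) := by
        refine mul_le_mul_right (le_trans ?_ h1) _
        gcongr
        exact exp_neg_le_node_pow hK j
    _ = _ := by
        rw [ENNReal.ofReal_mul (by norm_num), ← mul_assoc, mul_comm (ENNReal.ofReal (Real.exp 8))]
        simp

/-! ### Weak factorization of polynomials -/

/-- The exponent relation makes both sides carry the same power of 1 - r, so the hypothesis on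
averages is one on tails. -/
theorem tailAvg_compare {p₁ p₂ q : ℝ}
    (hpq : 1 / q = 1 / p₁ + 1 / p₂) {ω ν η : ℝ → ℝ} (hω : IsDoubling ω) (hν : IsDoubling ν)
    (hη : IsDoubling η) {r : ℝ} (h0 : 0 ≤ r) (h1 : r < 1) :
    tailAvg η r ^ (1 / q) = tail η r ^ (1 / q) / (1 - r) ^ (1 / q) ∧
    tailAvg ω r ^ (1 / p₁) * tailAvg ν r ^ (1 / p₂) =
      tail ω r ^ (1 / p₁) * tail ν r ^ (1 / p₂) / (1 - r) ^ (1 / q) := by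
  have hr : 0 < 1 - r := by linarith
  unfold tailAvg
  rw [Real.div_rpow (hη.tail_pos h0 h1).le hr.le, Real.div_rpow (hω.tail_pos h0 h1).le hr.le,
    Real.div_rpow (hν.tail_pos h0 h1).le hr.le, hpq, Real.rpow_add hr]
  exact ⟨rfl, by field_simp⟩

/-- Here a, b, e stand for the tails of ω, ν, η at one node. The scalar s = (e/a)^{1/p₁} gives a
s^{p₁} = e exactly, and the comparison of weights controls b s^{-p₂}. -/
theorem weight_balance {p₁ p₂ q a b e c : ℝ} (hp₂ : 0 < p₂)
    (hpq : 1 / q = 1 / p₁ + 1 / p₂) (ha : 0 < a) (hb : 0 < b) (he : 0 < e) (hc : 0 < c)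
    (h : c * (a ^ (1 / p₁) * b ^ (1 / p₂)) ≤ e ^ (1 / q)) :
    b * ((e / a) ^ (1 / p₁))⁻¹ ^ p₂ ≤ c⁻¹ ^ p₂ * e := by
  have h1 : b ^ (1 / p₂) * ((e / a) ^ (1 / p₁))⁻¹ ≤ c⁻¹ * e ^ (1 / p₂) := by
    rw [hpq, Real.rpow_add he] at h
    rw [Real.div_rpow he.le ha.le, inv_div, mul_div_assoc', div_le_iff₀ (by positivity),
      inv_mul_eq_div, div_mul_eq_mul_div, le_div_iff₀ hc]
    linarith
  calc b * ((e / a) ^ (1 / p₁))⁻¹ ^ p₂ = (b ^ (1 / p₂) * ((e / a) ^ (1 / p₁))⁻¹) ^ p₂ := by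
        rw [Real.mul_rpow (by positivity) (by positivity), ← Real.rpow_mul hb.le,
          one_div_mul_cancel hp₂.ne', Real.rpow_one]
    _ ≤ (c⁻¹ * e ^ (1 / p₂)) ^ p₂ := by gcongr
    _ = _ := by
        rw [Real.mul_rpow (by positivity) (by positivity), ← Real.rpow_mul he.le,
          one_div_mul_cancel hp₂.ne', Real.rpow_one]

theorem circMean_rpow_eq_of_norm_eq {p q : ℝ} (hp : 0 < p) (hq : 0 < q) {F g : ℂ → ℂ}
    (h : ∀ z : ℂ, ‖z‖ = 1 → ‖g z‖ = ‖F z‖ ^ (q / p)) :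
    circMean (ENNReal.ofReal p) 1 g ^ p = circMean (ENNReal.ofReal q) 1 F ^ q := by
  rw [circMean_rpow hp, circMean_rpow hq]
  refine lintegral_congr fun u => ?_
  have h1 := h ((1 : ℝ) * unitPt u) (by simp)
  have hqp : 0 ≤ q / p := by positivity
  rw [← ofReal_norm, h1, ← ENNReal.ofReal_rpow_of_nonneg (norm_nonneg _) hqp,
    ← ENNReal.rpow_mul, div_mul_cancel₀ _ hp.ne', ofReal_norm]

/-- The core construction: twist the block factors by roots of unity so that averaging leaves the
diagonal products, and let the Schur test bound each twisted sum. J depends on P, but B does not. -/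
theorem exists_weak_factorization_polynomial {p₁ p₂ q : ℝ} (hp₁ : 1 < p₁) (hp₂ : 1 < p₂)
    (hq : 1 < q) (hpq : 1 / q = 1 / p₁ + 1 / p₂) {ω ν η : ℝ → ℝ} (hω : IsDoubling ω)
    (hν : IsDoubling ν) (hη : IsDoubling η) {c : ℝ} (hc : 0 < c)
    (hcomp : ∀ r ∈ Set.Ico (0 : ℝ) 1,
      c * (tail ω r ^ (1 / p₁) * tail ν r ^ (1 / p₂)) ≤ tail η r ^ (1 / q))
    {K : ℕ} (hK : 2 ≤ K) {θ₁ C₁ θ₂ C₂ : ℝ} (hθ₁ : 0 < θ₁) (hθ₁' : θ₁ < 1) (hC₁ : 1 ≤ C₁)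
    (hg₁ : IsGeometricAlong K θ₁ C₁ ω) (hθ₂ : 0 < θ₂) (hθ₂' : θ₂ < 1) (hC₂ : 1 ≤ C₂)
    (hg₂ : IsGeometricAlong K θ₂ C₂ ν) :
    ∃ B : ℝ≥0∞, B ≠ ⊤ ∧ ∀ P : Polynomial ℂ, ∃ (J : ℕ) (F G : ℕ → ℂ → ℂ), J ≠ 0 ∧
      (∀ k, DifferentiableOn ℂ (F k) (ball 0 1)) ∧ (∀ k, DifferentiableOn ℂ (G k) (ball 0 1)) ∧
      (∀ z ∈ ball (0 : ℂ) 1, (J : ℂ) * P.eval z = ∑ k ∈ Finset.range J, F k z * G k z) ∧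
      (∀ k, discreteNorm K p₁ ω (F k) ≤ B * discreteNorm K q η fun z => P.eval z) ∧
      (∀ k, discreteNorm K p₂ ν (G k) ≤ B * discreteNorm K q η fun z => P.eval z) := by
  have hp₁0 : 0 < p₁ := by linarith
  have hp₂0 : 0 < p₂ := by linarith
  have hq0 : 0 < q := by linarith
  have hq1 : 1 ≤ ENNReal.ofReal q := by simpa using hq.le
  obtain ⟨B₁, hB₁, hsum₁⟩ := exists_discreteNorm_sum_le hω hK hθ₁ hθ₁' hC₁ hg₁ hp₁.le
  obtain ⟨B₂, hB₂, hsum₂⟩ := exists_discreteNorm_sum_le hν hK hθ₂ hθ₂' hC₂ hg₂ hp₂.le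
  have hst : q / p₁ + q / p₂ = 1 := by
    rw [div_eq_mul_one_div, div_eq_mul_one_div q p₂, ← mul_add, ← hpq, mul_one_div_cancel hq0.ne']
  set E : ℝ≥0∞ := ENNReal.ofReal (4 * Real.exp 8) ^ q with hE
  have hEt : E ≠ ⊤ := ENNReal.rpow_ne_top_of_nonneg hq0.le ENNReal.ofReal_ne_top
  refine ⟨B₁ * E + B₂ * (ENNReal.ofReal (c⁻¹ ^ p₂) * E),
    ENNReal.add_ne_top.2 ⟨ENNReal.mul_ne_top hB₁ hEt, ENNReal.mul_ne_top hB₂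
      (ENNReal.mul_ne_top ENNReal.ofReal_ne_top hEt)⟩, fun P => ?_⟩
  obtain ⟨J, hJ, hJP⟩ : ∃ J : ℕ, J ≠ 0 ∧ P.natDegree ≤ 2 * K ^ J := by
    refine ⟨P.natDegree + 1, by omega, ?_⟩
    have := (Nat.lt_pow_self (n := P.natDegree + 1) (a := K) (by omega))
    omega
  choose Q hQ using fun j => X_pow_dvd_block hK P j
  choose g h hgd hhd hgh hnorm using fun j =>
    hasPowerFactorization_polynomial (s := q / p₁) (t := q / p₂) (by positivity) (by positivity)
      hst (Q j)
  have hQc : ∀ j, circMean (ENNReal.ofReal q) 1 (fun z => (Q j).eval z) =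
      circMean (ENNReal.ofReal q) 1 (fun z => (block K P j).eval z) := fun j =>
    circMean_congr_norm _ fun z hz => by
      rw [abs_one] at hz
      rw [hQ j]; simp [hz]
  -- Both factors have the same p-th power means as Q_j, so this is the only place where the norm of
  -- P enters.
  have hX : ∑ j ∈ Finset.range J, ENNReal.ofReal (tail η (node K (j + 1))) *
      circMean (ENNReal.ofReal q) 1 (fun z => (Q j).eval z) ^ q ≤
      E * discreteNorm K q η fun z => P.eval z := by
    rw [discreteNorm, ← ENNReal.tsum_mul_left]
    refine le_trans (Finset.sum_le_sum fun j _ => ?_) (ENNReal.sum_le_tsum (Finset.range J))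
    rw [mul_left_comm, hE, ← ENNReal.mul_rpow_of_nonneg _ _ hq0.le, hQc]
    gcongr
    exact circMean_one_block_le hq1 hK P j
  let w : (ℝ → ℝ) → ℕ → ℝ := fun ω j => tail ω (node K (j + 1))
  have hw : ∀ {ω}, IsDoubling ω → ∀ j, 0 < w ω j := fun hω j =>
    hω.tail_pos (node_nonneg hK _) (node_lt_one hK _)
  -- Scalars transferring weight between the two factors; they cancel in the products.
  let s : ℕ → ℝ := fun j => (w η j / w ω j) ^ (1 / p₁)
  have hs : ∀ j, 0 < s j := fun j => Real.rpow_pos_of_pos (div_pos (hw hη j) (hw hω j)) _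
  have hg1 : ∀ j, circMean (ENNReal.ofReal p₁) 1 (g j) ^ p₁ =
      circMean (ENNReal.ofReal q) 1 (fun z => (Q j).eval z) ^ q := fun j =>
    circMean_rpow_eq_of_norm_eq hp₁0 hq0 fun z hz => (hnorm j z hz).1
  have hh1 : ∀ j, circMean (ENNReal.ofReal p₂) 1 (h j) ^ p₂ =
      circMean (ENNReal.ofReal q) 1 (fun z => (Q j).eval z) ^ q := fun j =>
    circMean_rpow_eq_of_norm_eq hp₂0 hq0 fun z hz => (hnorm j z hz).2
  have hdiff : ∀ (g : ℕ → ℂ → ℂ) (s : ℕ → ℂ), (∀ j, DiffContOnCl ℂ (g j) (ball 0 1)) →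
      DifferentiableOn ℂ (fun z => ∑ j ∈ Finset.range J, s j * (z ^ blockExp K j * g j z))
        (ball 0 1) := fun g s hg => by
    refine DifferentiableOn.fun_sum fun j _ => ?_
    exact (differentiableOn_const _).mul ((differentiableOn_id.pow _).mul (hg j).differentiableOn)
  -- J-th roots of unity suffice to separate the J blocks, and the unimodular twists do not change
  -- the bounds on the pieces.
  refine ⟨J, fun k z => ∑ j ∈ Finset.range J, (rootU J ^ k) ^ j * s j * (z ^ blockExp K j * g j z),
    fun k z => ∑ j ∈ Finset.range J,
      (conj (rootU J ^ k)) ^ j * (s j : ℂ)⁻¹ * (z ^ blockExp K j * h j z), hJ,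
    fun k => hdiff g _ hgd, fun k => hdiff h _ hhd, fun z hz => ?_, fun k => ?_, fun k => ?_⟩
  · simp_rw [mul_assoc]
    rw [← sum_mul_eq_average]
    congr 1
    conv_lhs => rw [← sum_block hK P hJ hJP]
    rw [Polynomial.eval_finsetSum]
    refine Finset.sum_congr rfl fun j _ => ?_
    have hsj : (s j : ℂ) ≠ 0 := by exact_mod_cast (hs j).ne'
    rw [hQ j, Polynomial.eval_mul, Polynomial.eval_pow, Polynomial.eval_X,
      show (Q j).eval z = g j z * h j z from (hgh j z (ball_subset_closedBall hz)).symm, two_mul, pow_add]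
    field_simp
  · refine (hsum₁ J g (fun j => (rootU J ^ k) ^ j * s j) hgd).trans ?_
    refine le_trans ?_ (mul_le_mul_left (le_self_add : B₁ * E ≤ _) _)
    rw [mul_assoc]
    refine mul_le_mul_right (le_trans (le_of_eq ?_) hX) _
    refine Finset.sum_congr rfl fun j _ => ?_
    have h1 : ‖(rootU J ^ k) ^ j * (s j : ℂ)‖ₑ = ENNReal.ofReal (s j) := by
      rw [← ofReal_norm]; simp [abs_of_pos (hs j)]
    rw [h1, ENNReal.mul_rpow_of_nonneg _ _ hp₁0.le, hg1, ← mul_assoc,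
      ENNReal.ofReal_rpow_of_nonneg (hs j).le hp₁0.le, ← ENNReal.ofReal_mul (hw hω j).le]
    congr 2
    have h2 := hw hω j
    have h3 := hw hη j
    simp only [s]
    rw [← Real.rpow_mul (by positivity), one_div_mul_cancel hp₁0.ne', Real.rpow_one]
    simp only [w] at *
    field_simp
  · refine (hsum₂ J h (fun j => (conj (rootU J ^ k)) ^ j * (s j : ℂ)⁻¹) hhd).trans ?_
    refine le_trans ?_ (mul_le_mul_left (le_add_self : B₂ * (ENNReal.ofReal (c⁻¹ ^ p₂) * E) ≤ _) _)
    rw [mul_assoc, mul_assoc]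
    refine mul_le_mul_right (le_trans ?_ (mul_le_mul_right hX _)) _
    rw [Finset.mul_sum]
    refine Finset.sum_le_sum fun j _ => ?_
    have h1 : ‖(conj (rootU J ^ k)) ^ j * (s j : ℂ)⁻¹‖ₑ = ENNReal.ofReal (s j)⁻¹ := by
      rw [← ofReal_norm]; simp [abs_of_pos (hs j)]
    have hsi : 0 ≤ (s j)⁻¹ := (inv_pos.2 (hs j)).le
    rw [h1, ENNReal.mul_rpow_of_nonneg _ _ hp₂0.le, hh1, ← mul_assoc, ← mul_assoc,
      ENNReal.ofReal_rpow_of_nonneg hsi hp₂0.le,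
      ← ENNReal.ofReal_mul (hw hν j).le, ← ENNReal.ofReal_mul (by positivity)]
    refine mul_le_mul_left (ENNReal.ofReal_le_ofReal ?_) _
    exact weight_balance hp₂0 hpq (hw hω j) (hw hν j) (hw hη j) hc
      (hcomp _ ⟨node_nonneg hK _, node_lt_one hK _⟩)

/-! ### Weighted Bergman norms -/

theorem eLpNorm_ofReal_rpow {α : Type*} [MeasurableSpace α] {μ : Measure α} {p : ℝ} (hp : 0 < p)
    (f : α → ℂ) : eLpNorm f (ENNReal.ofReal p) μ ^ p = ∫⁻ x, ‖f x‖ₑ ^ p ∂μ := by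
  have := eLpNorm_eq_lintegral_rpow_enorm_toReal (p := ENNReal.ofReal p)
    (by simpa using hp) ENNReal.ofReal_ne_top (f := f) (μ := μ)
  rw [ENNReal.toReal_ofReal hp.le] at this
  rw [this, ← ENNReal.rpow_mul, one_div_mul_cancel hp.ne', ENNReal.rpow_one]

/-- The extended norm of the restriction of `F` to the disc. -/
def discNorm (p : ℝ) (ω : ℝ → ℝ) (F : ℂ → ℂ) : ℝ≥0∞ :=
  eLpNorm (fun z : 𝔻 => F z) (ENNReal.ofReal p) (weightMeasure ω)

theorem continuous_restrict_disc {F : ℂ → ℂ} (hF : DifferentiableOn ℂ F (ball 0 1)) :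
    Continuous fun z : 𝔻 => F z :=
  hF.continuousOn.comp_continuous continuous_subtype_val fun z => z.2

theorem discNorm_rpow_le {ω : ℝ → ℝ} (hω : IsDoubling ω) {K : ℕ} (hK : 2 ≤ K) {θ C : ℝ}
    (hC : 0 ≤ C) (hg : IsGeometricAlong K θ C ω) {p : ℝ} (hp : 1 ≤ p) {F : ℂ → ℂ}
    (hF : DifferentiableOn ℂ F (ball 0 1)) :
    discNorm p ω F ^ p ≤ ENNReal.ofReal (C / π) * discreteNorm K p ω F := by
  rw [discNorm, eLpNorm_ofReal_rpow (by linarith)]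
  exact lintegral_le_discreteNorm hω hK hC hg hp hF

theorem discreteNorm_le_rpow {ω : ℝ → ℝ} (hω : IsDoubling ω) {K : ℕ} (hK : 2 ≤ K) {θ C : ℝ}
    (hθ : θ < 1) (hg : IsGeometricAlong K θ C ω) {p : ℝ} (hp : 1 ≤ p) {F : ℂ → ℂ}
    (hF : DifferentiableOn ℂ F (ball 0 1)) :
    discreteNorm K p ω F ≤ ENNReal.ofReal (2 / (1 - θ) * π) * discNorm p ω F ^ p := by
  rw [discNorm, eLpNorm_ofReal_rpow (by linarith)]
  exact discreteNorm_le_lintegral hω hK hθ hg hp hF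

theorem discNorm_add_le {p : ℝ} (hp : 1 ≤ p) (ω : ℝ → ℝ) {F G : ℂ → ℂ}
    (hF : DifferentiableOn ℂ F (ball 0 1)) (hG : DifferentiableOn ℂ G (ball 0 1)) :
    discNorm p ω (fun z => F z + G z) ≤ discNorm p ω F + discNorm p ω G :=
  eLpNorm_add_le (continuous_restrict_disc hF).aestronglyMeasurable
    (continuous_restrict_disc hG).aestronglyMeasurable (by simpa using hp)

theorem lintegral_weightMeasure_one_ne_top {ω : ℝ → ℝ} (hω : IsDoubling ω) :
    weightMeasure ω Set.univ ≠ ⊤ := by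
  have h := lintegral_weightMeasure hω (p := 1) one_pos (F := fun _ => 1) continuousOn_const
  simp only [enorm_one, ENNReal.one_rpow, lintegral_const, one_mul] at h
  rw [h]
  refine ENNReal.mul_ne_top ENNReal.ofReal_ne_top ?_
  have hM : ∀ r, circMean (ENNReal.ofReal 1) r (fun _ => 1) ^ (1 : ℝ) = ENNReal.ofReal (2 * π) :=
    fun r => by
      rw [circMean_rpow one_pos]; simp [AddCircle.measure_univ]
  simp_rw [hM]
  rw [lintegral_mul_const' _ _ ENNReal.ofReal_ne_top]
  refine ENNReal.mul_ne_top (ne_top_of_le_ne_top ?_ (setLIntegral_mono' measurableSet_Ioo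
    fun r (hr : r ∈ Set.Ioo (0 : ℝ) 1) => ENNReal.ofReal_le_ofReal (mul_le_of_le_one_left
      (hω.isRadialWeight.nonneg r ⟨hr.1.le, hr.2⟩) hr.2.le))) ENNReal.ofReal_ne_top
  exact hω.upper.1.lintegral_lt_top.ne

theorem IsDoubling.isFiniteMeasure {ω : ℝ → ℝ} (hω : IsDoubling ω) :
    IsFiniteMeasure (weightMeasure ω) :=
  ⟨(lintegral_weightMeasure_one_ne_top hω).lt_top⟩

theorem IsDoubling.exists_geometric {ω : ℝ → ℝ} (hω : IsDoubling ω) :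
    ∃ (K : ℕ) (θ C : ℝ), 2 ≤ K ∧ 0 < θ ∧ θ < 1 ∧ 1 ≤ C ∧ IsGeometricAlong K θ C ω := by
  obtain ⟨K₀, θ, hθ, hθ1, h⟩ := hω.exists_isGeometricAlong
  obtain ⟨C, hC, hg⟩ := h (max K₀ 2) (le_max_left _ _) (le_max_right _ _)
  exact ⟨_, θ, C, le_max_right _ _, hθ, hθ1, hC, hg⟩

/-! ### Point evaluations -/

/-- Cauchy's formula as the circle average of z/(z - w) · F(z), with |z/(z - w)| ≤ R/(R - ρ). -/
theorem enorm_le_circMean_one {F : ℂ → ℂ} {ρ R : ℝ} (hρR : ρ < R)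
    (hF : DiffContOnCl ℂ F (ball 0 R)) {w : ℂ} (hw : ‖w‖ ≤ ρ) :
    ‖F w‖ₑ ≤ ENNReal.ofReal (R / (R - ρ)) * circMean 1 R F := by
  have hR : 0 < R := (norm_nonneg w).trans_lt (hw.trans_lt hρR)
  have h1 := DiffContOnCl.circleAverage_smul_div (f := F) (c := 0) (R := R) (w := w)
    (by rwa [abs_of_pos hR]) (by rw [abs_of_pos hR]; simpa using hw.trans_lt hρR)
  have hint : ∫⁻ θ in Set.Ioc (0 : ℝ) (2 * π), ‖F (circleMap 0 R θ)‖ₑ = circMean 1 R F := by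
    rw [circMean, eLpNorm_one_eq_lintegral_enorm, ← AddCircle.lintegral_preimage (2 * π) 0, zero_add]
    refine lintegral_congr fun θ => ?_
    rw [unitPt_coe, circleMap, zero_add]
  rw [← h1, Real.circleAverage_def, enorm_smul, intervalIntegral.integral_of_le Real.two_pi_pos.le]
  have h2 : ‖(2 * π)⁻¹‖ₑ ≤ 1 := by
    rw [← ofReal_norm, ENNReal.ofReal_le_one, Real.norm_of_nonneg (by positivity)]
    exact inv_le_one_of_one_le₀ (by linarith [Real.pi_gt_three])
  refine (mul_le_of_le_one_left zero_le h2).trans ((enorm_integral_le_lintegral_enorm _).trans ?_)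
  rw [← hint, ← lintegral_const_mul' _ _ ENNReal.ofReal_ne_top]
  refine lintegral_mono fun θ => ?_
  rw [enorm_smul]
  gcongr
  rw [← ofReal_norm]
  refine ENNReal.ofReal_le_ofReal ?_
  have hz : ‖circleMap 0 R θ‖ = R := by simp [abs_of_pos hR]
  rw [sub_zero, norm_div, hz]
  have : R - ρ ≤ ‖circleMap 0 R θ - w‖ := by
    have := norm_sub_norm_le (circleMap 0 R θ) w
    rw [hz] at this
    linarith
  have hpos : 0 < R - ρ := by linarith
  gcongr

/-- A single term of the discrete norm, at a node beyond ρ, controls the L^p mean there, hence the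
L^1 mean and the values on |z| ≤ ρ. -/
theorem exists_enorm_le_discNorm {ω : ℝ → ℝ} (hω : IsDoubling ω) {p : ℝ} (hp : 1 ≤ p) {ρ : ℝ}
    (hρ0 : 0 ≤ ρ) (hρ : ρ < 1) :
    ∃ B : ℝ≥0∞, B ≠ ⊤ ∧ ∀ F : ℂ → ℂ, DifferentiableOn ℂ F (ball 0 1) → ∀ z : ℂ, ‖z‖ ≤ ρ →
      ‖F z‖ₑ ≤ B * discNorm p ω F := by
  obtain ⟨K, θ, C, hK, hθ, hθ1, hC, hg⟩ := hω.exists_geometric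
  have hp0 : 0 < p := by linarith
  obtain ⟨j, hj⟩ := exists_mem_Ico_node hK hρ0 hρ
  set R := node K (j + 1) with hR
  have hR1 : R < 1 := node_lt_one hK _
  have hR0 : 0 ≤ R := node_nonneg hK _
  set t : ℝ≥0∞ := ENNReal.ofReal (tail ω R) with ht
  have ht0 : t ≠ 0 := by simpa [ht] using hω.tail_pos hR0 hR1
  set D : ℝ≥0∞ := ENNReal.ofReal (2 / (1 - θ) * π)
  set V : ℝ≥0∞ := ENNReal.ofReal (2 * π) ^ (1 / (1 : ℝ≥0∞).toReal - 1 / (ENNReal.ofReal p).toReal)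
  have hVt : V ≠ ⊤ := by
    refine ENNReal.rpow_ne_top_of_nonneg ?_ ENNReal.ofReal_ne_top
    rw [ENNReal.toReal_ofReal hp0.le, ENNReal.toReal_one, div_one, sub_nonneg, div_le_one hp0]
    exact hp
  refine ⟨ENNReal.ofReal (R / (R - ρ)) * ((t⁻¹ * D) ^ (1 / p) * V), ?_, fun F hF z hz => ?_⟩
  · refine ENNReal.mul_ne_top ENNReal.ofReal_ne_top (ENNReal.mul_ne_top ?_ hVt)
    exact ENNReal.rpow_ne_top_of_nonneg (by positivity)
      (ENNReal.mul_ne_top (ENNReal.inv_ne_top.2 ht0) ENNReal.ofReal_ne_top)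
  have hFR : DiffContOnCl ℂ F (ball 0 R) :=
    (hF.mono (closure_ball_subset_closedBall.trans (closedBall_subset_ball hR1))).diffContOnCl
  have h1 : circMean 1 R F ≤ circMean (ENNReal.ofReal p) R F * V := by
    have := eLpNorm_le_eLpNorm_mul_rpow_measure_univ (μ := (volume : Measure 𝕋)) (p := 1)
      (q := ENNReal.ofReal p) (by simpa using hp) (continuous_circle_comp hR0
        (hF.continuousOn.mono (closedBall_subset_ball hR1))).aestronglyMeasurable
    rwa [AddCircle.measure_univ] at this
  have h2 : t * circMean (ENNReal.ofReal p) R F ^ p ≤ D * discNorm p ω F ^ p :=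
    (ENNReal.le_tsum (f := fun j => ENNReal.ofReal (tail ω (node K (j + 1))) *
      circMean (ENNReal.ofReal p) (node K (j + 1)) F ^ p) j).trans
      (discreteNorm_le_rpow hω hK hθ1 hg hp hF)
  have h3 : circMean (ENNReal.ofReal p) R F ≤ (t⁻¹ * D) ^ (1 / p) * discNorm p ω F := by
    have h4 : circMean (ENNReal.ofReal p) R F ^ p ≤ t⁻¹ * D * discNorm p ω F ^ p := by
      rw [mul_assoc, ← ENNReal.div_eq_inv_mul, ENNReal.le_div_iff_mul_le (Or.inl ht0)
        (Or.inl ENNReal.ofReal_ne_top), mul_comm]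
      exact h2
    have h5 := ENNReal.rpow_le_rpow h4 (by positivity : 0 ≤ 1 / p)
    rwa [ENNReal.mul_rpow_of_nonneg _ _ (by positivity), ← ENNReal.rpow_mul, ← ENNReal.rpow_mul,
      mul_one_div_cancel hp0.ne', ENNReal.rpow_one, ENNReal.rpow_one] at h5
  calc ‖F z‖ₑ ≤ ENNReal.ofReal (R / (R - ρ)) * circMean 1 R F :=
        enorm_le_circMean_one hj.2 hFR hz
    _ ≤ ENNReal.ofReal (R / (R - ρ)) * ((t⁻¹ * D) ^ (1 / p) * discNorm p ω F * V) := by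
        gcongr
        exact h1.trans (by gcongr)
    _ = _ := by ring

/-! ### Products -/

theorem tsum_mul_le_Lp_mul_Lq {a b : ℝ} (hab : a.HolderConjugate b) (f g : ℕ → ℝ≥0∞) :
    ∑' i, f i * g i ≤ (∑' i, f i ^ a) ^ (1 / a) * (∑' i, g i ^ b) ^ (1 / b) := by
  rw [ENNReal.tsum_eq_iSup_sum]
  refine iSup_le fun s => (ENNReal.inner_le_Lp_mul_Lq s f g hab).trans ?_
  have := hab.pos
  have := hab.symm.pos
  gcongr <;> exact ENNReal.sum_le_tsum _

theorem circMean_mul_le {p₁ p₂ q : ℝ} (hp₁ : 0 < p₁) (hp₂ : 0 < p₂) (hq : 0 < q)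
    (hpq : 1 / q = 1 / p₁ + 1 / p₂) {r : ℝ} (hr : 0 ≤ r) {F G : ℂ → ℂ}
    (hF : ContinuousOn F (closedBall 0 r)) (hG : ContinuousOn G (closedBall 0 r)) :
    circMean (ENNReal.ofReal q) r (fun z => F z * G z) ≤
      circMean (ENNReal.ofReal p₁) r F * circMean (ENNReal.ofReal p₂) r G := by
  have : ENNReal.HolderTriple (ENNReal.ofReal p₁) (ENNReal.ofReal p₂) (ENNReal.ofReal q) := ⟨by
    rw [← ENNReal.ofReal_inv_of_pos hp₁, ← ENNReal.ofReal_inv_of_pos hp₂,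
      ← ENNReal.ofReal_inv_of_pos hq, ← ENNReal.ofReal_add (by positivity) (by positivity)]
    simp only [one_div] at hpq
    rw [hpq]⟩
  have h := eLpNorm_smul_le_mul_eLpNorm (μ := (volume : Measure 𝕋)) (p := ENNReal.ofReal p₁)
    (q := ENNReal.ofReal p₂) (r := ENNReal.ofReal q)
    (continuous_circle_comp hr hG).aestronglyMeasurable
    (continuous_circle_comp hr hF).aestronglyMeasurable
  exact h

/-- Hölder twice: on each circle, then over j with the conjugate exponents p₁/q and p₂/q, after the
weight comparison has split the tail of η. -/
theorem discreteNorm_mul_le {p₁ p₂ q : ℝ} (hp₁ : 0 < p₁) (hp₂ : 0 < p₂) (hq : 0 < q)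
    (hpq : 1 / q = 1 / p₁ + 1 / p₂) {ω ν η : ℝ → ℝ} (hω : IsDoubling ω)
    (hν : IsDoubling ν) (hη : IsDoubling η) {C : ℝ} (hC : 0 < C)
    (hcomp : ∀ r ∈ Set.Ico (0 : ℝ) 1,
      tail η r ^ (1 / q) ≤ C * (tail ω r ^ (1 / p₁) * tail ν r ^ (1 / p₂)))
    {K : ℕ} (hK : 2 ≤ K) {F G : ℂ → ℂ} (hF : ContinuousOn F (ball 0 1))
    (hG : ContinuousOn G (ball 0 1)) :
    discreteNorm K q η (fun z => F z * G z) ≤ ENNReal.ofReal (C ^ q) *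
      (discreteNorm K p₁ ω F ^ (q / p₁) * discreteNorm K p₂ ν G ^ (q / p₂)) := by
  have hab : (p₁ / q).HolderConjugate (p₂ / q) := by
    refine Real.holderConjugate_iff.2 ⟨?_, ?_⟩
    · rw [one_lt_div hq]
      have h : 1 / p₁ < 1 / q := by rw [hpq]; linarith [one_div_pos.2 hp₂]
      exact (one_div_lt_one_div hp₁ hq).1 h
    · rw [inv_div, inv_div, div_eq_mul_one_div, div_eq_mul_one_div q p₂, ← mul_add, ← hpq,
        mul_one_div_cancel hq.ne']
  have hfac : ∀ (j : ℕ), ENNReal.ofReal (tail η (node K (j + 1))) *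
      circMean (ENNReal.ofReal q) (node K (j + 1)) (fun z => F z * G z) ^ q ≤
      ENNReal.ofReal (C ^ q) *
        ((ENNReal.ofReal (tail ω (node K (j + 1))) ^ (q / p₁) *
          circMean (ENNReal.ofReal p₁) (node K (j + 1)) F ^ q) *
        (ENNReal.ofReal (tail ν (node K (j + 1))) ^ (q / p₂) *
          circMean (ENNReal.ofReal p₂) (node K (j + 1)) G ^ q)) := fun j => by
    set r := node K (j + 1)
    have h0 : 0 ≤ r := node_nonneg hK _
    have h1 : r < 1 := node_lt_one hK _
    have ha := hω.tail_pos h0 h1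
    have hb := hν.tail_pos h0 h1
    have he := hη.tail_pos h0 h1
    have h2 : tail η r ≤ C ^ q * (tail ω r ^ (q / p₁) * tail ν r ^ (q / p₂)) := by
      calc tail η r = (tail η r ^ (1 / q)) ^ q := by
            rw [← Real.rpow_mul he.le, one_div_mul_cancel hq.ne', Real.rpow_one]
        _ ≤ (C * (tail ω r ^ (1 / p₁) * tail ν r ^ (1 / p₂))) ^ q := by
            gcongr
            exact hcomp r ⟨h0, h1⟩
        _ = _ := by
            rw [Real.mul_rpow hC.le (by positivity), Real.mul_rpow (by positivity) (by positivity),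
              ← Real.rpow_mul ha.le, ← Real.rpow_mul hb.le, one_div_mul_eq_div, one_div_mul_eq_div]
    have h3 := circMean_mul_le hp₁ hp₂ hq hpq h0 (hF.mono (closedBall_subset_ball h1))
      (hG.mono (closedBall_subset_ball h1))
    calc _ ≤ ENNReal.ofReal (C ^ q * (tail ω r ^ (q / p₁) * tail ν r ^ (q / p₂))) *
          (circMean (ENNReal.ofReal p₁) r F * circMean (ENNReal.ofReal p₂) r G) ^ q := by gcongr
      _ = _ := by
          rw [ENNReal.ofReal_mul (by positivity), ENNReal.ofReal_mul (by positivity),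
            ← ENNReal.ofReal_rpow_of_nonneg ha.le (by positivity : 0 ≤ q / p₁),
            ← ENNReal.ofReal_rpow_of_nonneg hb.le (by positivity : 0 ≤ q / p₂),
            ENNReal.mul_rpow_of_nonneg _ _ hq.le]
          ring
  have hroot : ∀ {p : ℝ}, 0 < p → ∀ x y : ℝ≥0∞, (x ^ (q / p) * y ^ q) ^ (p / q) = x * y ^ p :=
    fun hp x y => by
      rw [ENNReal.mul_rpow_of_nonneg _ _ (by positivity), ← ENNReal.rpow_mul, ← ENNReal.rpow_mul,
        div_mul_div_cancel₀ hp.ne', div_self hq.ne', ENNReal.rpow_one, mul_div_cancel₀ _ hq.ne']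
  refine (ENNReal.tsum_le_tsum hfac).trans ?_
  rw [ENNReal.tsum_mul_left]
  refine mul_le_mul_right ((tsum_mul_le_Lp_mul_Lq hab _ _).trans (le_of_eq ?_)) _
  simp only [hroot hp₁, hroot hp₂, one_div_div, discreteNorm]

/-! ### Density of the polynomials -/

theorem exists_pos_mul_ofReal_le {A ε : ℝ≥0∞} (hA : A ≠ ⊤) (hε : ε ≠ 0) :
    ∃ δ : ℝ, 0 < δ ∧ A * ENNReal.ofReal δ ≤ ε := by
  have h1 : Tendsto (fun x : ℝ => A * ENNReal.ofReal x) (𝓝[>] 0) (𝓝 0) := by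
    have h2 : Tendsto (fun x : ℝ => ENNReal.ofReal x) (𝓝[>] 0) (𝓝 (ENNReal.ofReal 0)) :=
      ENNReal.tendsto_ofReal (tendsto_id.mono_left nhdsWithin_le_nhds)
    have h3 := ENNReal.Tendsto.const_mul h2 (Or.inr hA : ENNReal.ofReal 0 ≠ 0 ∨ A ≠ ⊤)
    simpa using h3
  obtain ⟨δ, h, hδ⟩ := ((ENNReal.tendsto_nhds_zero.1 h1 ε (pos_iff_ne_zero.2 hε)).and
    self_mem_nhdsWithin).exists
  exact ⟨δ, hδ, h⟩

/-- The radii of the dilations used to approximate a function. -/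
def dilRadius (n : ℕ) : ℝ := 1 - 1 / ((n : ℝ) + 2)

theorem dilRadius_pos (n : ℕ) : 0 < dilRadius n := by
  have : 1 / ((n : ℝ) + 2) ≤ 1 / 2 := by
    apply one_div_le_one_div_of_le <;> linarith [(Nat.cast_nonneg n : (0 : ℝ) ≤ n)]
  unfold dilRadius
  linarith

theorem dilRadius_lt_one (n : ℕ) : dilRadius n < 1 := by
  have : 0 < 1 / ((n : ℝ) + 2) := by positivity
  unfold dilRadius
  linarith

theorem tendsto_dilRadius : Tendsto dilRadius atTop (𝓝 1) := by
  have h1 : Tendsto (fun n : ℕ => 1 / ((n : ℝ) + 2)) atTop (𝓝 0) :=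
    tendsto_const_nhds.div_atTop (tendsto_atTop_add_const_right _ _ tendsto_natCast_atTop_atTop)
  have h2 : Tendsto (fun n : ℕ => 1 - 1 / ((n : ℝ) + 2)) atTop (𝓝 (1 - 0)) :=
    tendsto_const_nhds.sub h1
  rwa [sub_zero] at h2

theorem differentiableOn_dilation {F : ℂ → ℂ} (hF : DifferentiableOn ℂ F (ball 0 1)) {s : ℝ}
    (hs : 0 < s) : DifferentiableOn ℂ (fun z => F (s * z)) (ball 0 (1 / s)) := by
  refine hF.comp (by fun_prop) fun z hz => ?_
  rw [mem_ball_zero_iff] at hz ⊢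
  rw [norm_mul, Complex.norm_of_nonneg hs.le]
  rwa [lt_div_iff₀ hs, mul_comm] at hz

theorem circMean_dilation_le {p : ℝ} (hp : 1 ≤ p) {F : ℂ → ℂ}
    (hF : DifferentiableOn ℂ F (ball 0 1)) {r s : ℝ} (hr0 : 0 ≤ r) (hr1 : r < 1) (hs0 : 0 < s)
    (hs1 : s ≤ 1) :
    circMean (ENNReal.ofReal p) r (fun z => F (s * z)) ≤ circMean (ENNReal.ofReal p) r F := by
  have : circMean (ENNReal.ofReal p) r (fun z => F (s * z)) =
      circMean (ENNReal.ofReal p) (s * r) F := by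
    simp [circMean, mul_assoc]
  rw [this]
  exact circMean_mono_of_lt hp (by positivity) (mul_le_of_le_one_left hr0 hs1) hr1 hF

theorem tendsto_circMean_sub_dilation {p : ℝ} (hp : 0 < p) {F : ℂ → ℂ}
    (hF : DifferentiableOn ℂ F (ball 0 1)) {r : ℝ} (hr0 : 0 ≤ r) (hr1 : r < 1) :
    Tendsto (fun n => circMean (ENNReal.ofReal p) r fun z => F z - F (dilRadius n * z))
      atTop (𝓝 0) := by
  rw [ENNReal.tendsto_nhds_zero]
  intro ε hε
  have hA : ENNReal.ofReal (2 * π) ^ (1 / p) ≠ ⊤ :=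
    ENNReal.rpow_ne_top_of_nonneg (by positivity) ENNReal.ofReal_ne_top
  obtain ⟨δ, hδ, hδε⟩ := exists_pos_mul_ofReal_le hA hε.ne'
  have hc : ContinuousOn F (closedBall 0 r) := hF.continuousOn.mono (closedBall_subset_ball hr1)
  have hu := (isCompact_closedBall (0 : ℂ) r).uniformContinuousOn_of_continuous hc
  rw [Metric.uniformContinuousOn_iff] at hu
  obtain ⟨κ, hκ, h⟩ := hu δ hδ
  filter_upwards [tendsto_dilRadius.eventually (lt_mem_nhds (show 1 - κ < 1 by linarith))] with n hn
  refine (circMean_le_of_norm_le hp fun z hz => ?_).trans hδε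
  have h0 := dilRadius_pos n
  have h1 := dilRadius_lt_one n
  rw [abs_of_nonneg hr0] at hz
  have hsz : ‖(dilRadius n : ℂ) * z‖ ≤ r := by
    rw [norm_mul, Complex.norm_of_nonneg h0.le, hz]
    exact mul_le_of_le_one_left hr0 h1.le
  have h2 := h z (by simp [hz]) (dilRadius n * z) (mem_closedBall_zero_iff.2 hsz) (by
    have : z - dilRadius n * z = ((1 - dilRadius n : ℝ) : ℂ) * z := by push_cast; ring
    rw [dist_eq_norm, this, norm_mul, Complex.norm_of_nonneg (by linarith), hz]
    nlinarith)
  rw [dist_eq_norm] at h2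
  exact h2.le

/-- Dominated convergence over j: each mean tends to 0 by uniform continuity, and since dilations do
not increase means each term is at most 2^p times that of F. -/
theorem tendsto_discreteNorm_sub_dilation {ω : ℝ → ℝ} {K : ℕ} (hK : 2 ≤ K)
    {p : ℝ} (hp : 1 ≤ p) {F : ℂ → ℂ}
    (hF : DifferentiableOn ℂ F (ball 0 1)) (hfin : discreteNorm K p ω F ≠ ⊤) :
    Tendsto (fun n => discreteNorm K p ω fun z => F z - F (dilRadius n * z)) atTop (𝓝 0) := by
  have hp0 : 0 < p := by linarith
  let a : ℕ → ℕ → ℝ≥0∞ := fun n j => ENNReal.ofReal (tail ω (node K (j + 1))) *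
    (circMean (ENNReal.ofReal p) (node K (j + 1)) fun z => F z - F (dilRadius n * z)) ^ p
  let b : ℕ → ℝ≥0∞ := fun j => 2 ^ p * (ENNReal.ofReal (tail ω (node K (j + 1))) *
    circMean (ENNReal.ofReal p) (node K (j + 1)) F ^ p)
  have hab : ∀ n j, a n j ≤ b j := fun n j => by
    have hr0 := node_nonneg hK (j + 1)
    have hr1 := node_lt_one hK (j + 1)
    have hs0 := dilRadius_pos n
    have hs1 := dilRadius_lt_one n
    have hd : ContinuousOn (fun z => F (dilRadius n * z)) (closedBall 0 (node K (j + 1))) :=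
      (differentiableOn_dilation hF hs0).continuousOn.mono
        (closedBall_subset_ball (hr1.trans_le (by rw [le_div_iff₀ hs0]; linarith)))
    have h1 : (circMean (ENNReal.ofReal p) (node K (j + 1)) fun z => F z - F (dilRadius n * z)) ≤
        2 * circMean (ENNReal.ofReal p) (node K (j + 1)) F := by
      refine (eLpNorm_sub_le (continuous_circle_comp hr0 (hF.continuousOn.mono
        (closedBall_subset_ball hr1))).aestronglyMeasurable
        (continuous_circle_comp hr0 hd).aestronglyMeasurable (by simpa using hp)).trans ?_
      refine le_trans ?_ (two_mul (circMean _ _ F)).ge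
      exact add_le_add le_rfl (circMean_dilation_le hp hF hr0 hr1 hs0 hs1.le)
    calc a n j ≤ ENNReal.ofReal (tail ω (node K (j + 1))) *
          (2 * circMean (ENNReal.ofReal p) (node K (j + 1)) F) ^ p := by
          simp only [a]
          gcongr
      _ = b j := by
          rw [ENNReal.mul_rpow_of_nonneg _ _ hp0.le, mul_left_comm]
  have hlim : ∀ j, Tendsto (fun n => a n j) atTop (𝓝 0) := fun j => by
    have h1 := tendsto_circMean_sub_dilation hp0 hF (node_nonneg hK (j + 1)) (node_lt_one hK (j + 1))
    have h2 := (ENNReal.continuous_rpow_const (y := p)).tendsto 0 |>.comp h1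
    rw [ENNReal.zero_rpow_of_pos hp0] at h2
    have h3 := ENNReal.Tendsto.const_mul h2
      (Or.inr (ENNReal.ofReal_ne_top : ENNReal.ofReal (tail ω (node K (j + 1))) ≠ ⊤))
    simpa [a] using h3
  have hb : ∫⁻ j, b j ∂Measure.count ≠ ⊤ := by
    rw [lintegral_count, ENNReal.tsum_mul_left]
    exact ENNReal.mul_ne_top (ENNReal.rpow_ne_top_of_nonneg hp0.le (by simp)) hfin
  have := tendsto_lintegral_of_dominated_convergence (μ := Measure.count) (F := a)
    (f := fun _ => 0) b (fun n => measurable_of_countable _) (fun n => .of_forall (hab n)) hb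
    (.of_forall hlim)
  simp only [lintegral_count, lintegral_zero] at this
  exact this

/-- Approximate F by a dilation, which is analytic past the closed disc, and the dilation uniformly
by a polynomial; the weight has finite mass. -/
theorem exists_polynomial_discNorm_sub_le {ω : ℝ → ℝ} (hω : IsDoubling ω) {p : ℝ} (hp : 1 ≤ p)
    {F : ℂ → ℂ} (hF : DifferentiableOn ℂ F (ball 0 1)) (hfin : discNorm p ω F ≠ ⊤) {ε : ℝ≥0∞}
    (hε : ε ≠ 0) : ∃ P : Polynomial ℂ, discNorm p ω (fun z => F z - P.eval z) ≤ ε := by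
  obtain ⟨K, θ, C, hK, hθ, hθ1, hC, hg⟩ := hω.exists_geometric
  have hp0 : 0 < p := by linarith
  have hε2 : ε / 2 ≠ 0 := ENNReal.div_ne_zero.2 ⟨hε, by simp⟩
  have hdf : discreteNorm K p ω F ≠ ⊤ := ne_top_of_le_ne_top
    (ENNReal.mul_ne_top ENNReal.ofReal_ne_top (ENNReal.rpow_ne_top_of_nonneg hp0.le hfin))
    (discreteNorm_le_rpow hω hK hθ1 hg hp hF)
  have ht := ENNReal.Tendsto.const_mul (tendsto_discreteNorm_sub_dilation hK hp hF hdf)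
    (Or.inr (ENNReal.ofReal_ne_top : ENNReal.ofReal (C / π) ≠ ⊤))
  rw [mul_zero] at ht
  have hpos : 0 < (ε / 2) ^ p := pos_iff_ne_zero.2 fun h => by
    rw [ENNReal.rpow_eq_zero_iff_of_pos hp0] at h
    exact hε2 h
  obtain ⟨n, hn⟩ := (ENNReal.tendsto_nhds_zero.1 ht _ hpos).exists
  have hs0 := dilRadius_pos n
  have hs1 : 1 < 1 / dilRadius n := by rw [one_lt_div hs0]; exact dilRadius_lt_one n
  have hdil := differentiableOn_dilation hF hs0
  have hdil1 : DifferentiableOn ℂ (fun z => F (dilRadius n * z)) (ball 0 1) :=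
    hdil.mono (ball_subset_ball hs1.le)
  have h1 : discNorm p ω (fun z => F z - F (dilRadius n * z)) ≤ ε / 2 := by
    rw [← ENNReal.rpow_le_rpow_iff hp0]
    exact (discNorm_rpow_le hω hK (by linarith) hg hp (hF.sub hdil1)).trans hn
  have := hω.isFiniteMeasure
  have hμ : weightMeasure ω Set.univ ^ p⁻¹ ≠ ⊤ :=
    ENNReal.rpow_ne_top_of_nonneg (by positivity) (measure_ne_top _ _)
  obtain ⟨δ, hδ, hδε⟩ := exists_pos_mul_ofReal_le hμ hε2
  obtain ⟨P, hP⟩ := exists_polynomial_near_of_lt zero_le_one hs1 hdil hδ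
  refine ⟨P, ?_⟩
  have h2 : discNorm p ω (fun z => F (dilRadius n * z) - P.eval z) ≤ ε / 2 := by
    have := eLpNorm_le_of_ae_bound (p := ENNReal.ofReal p) (μ := weightMeasure ω)
      (f := fun z : 𝔻 => F (dilRadius n * z) - P.eval (z : ℂ)) (C := δ)
      (.of_forall fun z => hP z (ball_subset_closedBall z.2))
    rw [ENNReal.toReal_ofReal hp0.le] at this
    exact this.trans hδε
  calc _ = discNorm p ω (fun z => (F z - F (dilRadius n * z)) +
        (F (dilRadius n * z) - P.eval z)) := by congr 1; ext z; ring
    _ ≤ _ := discNorm_add_le hp ω (hF.sub hdil1) (hdil1.sub P.differentiable.differentiableOn)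
    _ ≤ ε / 2 + ε / 2 := add_le_add h1 h2
    _ = ε := ENNReal.add_halves ε

/-! ### The two estimates in terms of the norms -/

theorem exists_common_geometric {ω ν η : ℝ → ℝ} (hω : IsDoubling ω) (hν : IsDoubling ν)
    (hη : IsDoubling η) : ∃ K : ℕ, 2 ≤ K ∧
      (∃ θ C : ℝ, 0 < θ ∧ θ < 1 ∧ 1 ≤ C ∧ IsGeometricAlong K θ C ω) ∧
      (∃ θ C : ℝ, 0 < θ ∧ θ < 1 ∧ 1 ≤ C ∧ IsGeometricAlong K θ C ν) ∧
      (∃ θ C : ℝ, 0 < θ ∧ θ < 1 ∧ 1 ≤ C ∧ IsGeometricAlong K θ C η) := by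
  obtain ⟨K₁, θ₁, h₁, h₁', H₁⟩ := hω.exists_isGeometricAlong
  obtain ⟨K₂, θ₂, h₂, h₂', H₂⟩ := hν.exists_isGeometricAlong
  obtain ⟨K₃, θ₃, h₃, h₃', H₃⟩ := hη.exists_isGeometricAlong
  let K := K₁ + K₂ + K₃ + 2
  obtain ⟨C₁, hC₁, G₁⟩ := H₁ K (by omega) (by omega)
  obtain ⟨C₂, hC₂, G₂⟩ := H₂ K (by omega) (by omega)
  obtain ⟨C₃, hC₃, G₃⟩ := H₃ K (by omega) (by omega)
  exact ⟨K, by omega, ⟨θ₁, C₁, h₁, h₁', hC₁, G₁⟩, ⟨θ₂, C₂, h₂, h₂', hC₂, G₂⟩,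
    ⟨θ₃, C₃, h₃, h₃', hC₃, G₃⟩⟩

theorem le_rpow_one_div_mul {x a y : ℝ≥0∞} {p q : ℝ} (hp : 0 < p) (h : x ^ p ≤ a * y ^ q) :
    x ≤ a ^ (1 / p) * y ^ (q / p) := by
  have h1 := ENNReal.rpow_le_rpow h (by positivity : 0 ≤ 1 / p)
  rwa [ENNReal.mul_rpow_of_nonneg _ _ (by positivity), ← ENNReal.rpow_mul, ← ENNReal.rpow_mul,
    mul_one_div_cancel hp.ne', ENNReal.rpow_one, mul_one_div] at h1

theorem exists_discNorm_mul_le {p₁ p₂ q : ℝ} (hp₁ : 1 < p₁) (hp₂ : 1 < p₂) (hq : 1 < q)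
    (hpq : 1 / q = 1 / p₁ + 1 / p₂) {ω ν η : ℝ → ℝ} (hω : IsDoubling ω)
    (hν : IsDoubling ν) (hη : IsDoubling η) {C : ℝ} (hC : 0 < C)
    (hcomp : ∀ r ∈ Set.Ico (0 : ℝ) 1,
      tail η r ^ (1 / q) ≤ C * (tail ω r ^ (1 / p₁) * tail ν r ^ (1 / p₂))) :
    ∃ B : ℝ≥0∞, B ≠ ⊤ ∧ ∀ F G : ℂ → ℂ, DifferentiableOn ℂ F (ball 0 1) →
      DifferentiableOn ℂ G (ball 0 1) →
      discNorm q η (fun z => F z * G z) ≤ B * (discNorm p₁ ω F * discNorm p₂ ν G) := by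
  obtain ⟨K, hK, ⟨θ₁, C₁, h₁, h₁', hC₁, G₁⟩, ⟨θ₂, C₂, h₂, h₂', hC₂, G₂⟩,
    ⟨θ₃, C₃, h₃, h₃', hC₃, G₃⟩⟩ := exists_common_geometric hω hν hη
  have hp₁0 : 0 < p₁ := by linarith
  have hp₂0 : 0 < p₂ := by linarith
  have hq0 : 0 < q := by linarith
  set a := ENNReal.ofReal (C₃ / π) * ENNReal.ofReal (C ^ q)
  set d₁ := ENNReal.ofReal (2 / (1 - θ₁) * π)
  set d₂ := ENNReal.ofReal (2 / (1 - θ₂) * π)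
  refine ⟨(a * (d₁ ^ (q / p₁) * d₂ ^ (q / p₂))) ^ (1 / q), ?_, fun F G hF hG => ?_⟩
  · refine ENNReal.rpow_ne_top_of_nonneg (by positivity) (ENNReal.mul_ne_top
      (ENNReal.mul_ne_top ENNReal.ofReal_ne_top ENNReal.ofReal_ne_top) (ENNReal.mul_ne_top ?_ ?_))
    · exact ENNReal.rpow_ne_top_of_nonneg (by positivity) ENNReal.ofReal_ne_top
    · exact ENNReal.rpow_ne_top_of_nonneg (by positivity) ENNReal.ofReal_ne_top
  have key : discNorm q η (fun z => F z * G z) ^ q ≤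
      a * (d₁ ^ (q / p₁) * d₂ ^ (q / p₂)) * (discNorm p₁ ω F * discNorm p₂ ν G) ^ q := by
    have e : ∀ {p : ℝ}, 0 < p → ∀ d x : ℝ≥0∞, (d * x ^ p) ^ (q / p) = d ^ (q / p) * x ^ q :=
      fun hp d x => by
        rw [ENNReal.mul_rpow_of_nonneg _ _ (by positivity), ← ENNReal.rpow_mul,
          mul_div_cancel₀ _ hp.ne']
    calc _ ≤ ENNReal.ofReal (C₃ / π) * discreteNorm K q η (fun z => F z * G z) :=
          discNorm_rpow_le hη hK (by linarith) G₃ hq.le (hF.mul hG)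
      _ ≤ ENNReal.ofReal (C₃ / π) * (ENNReal.ofReal (C ^ q) *
          (discreteNorm K p₁ ω F ^ (q / p₁) * discreteNorm K p₂ ν G ^ (q / p₂))) := by
          gcongr
          exact discreteNorm_mul_le hp₁0 hp₂0 hq0 hpq hω hν hη hC hcomp hK hF.continuousOn
            hG.continuousOn
      _ ≤ ENNReal.ofReal (C₃ / π) * (ENNReal.ofReal (C ^ q) *
          ((d₁ * discNorm p₁ ω F ^ p₁) ^ (q / p₁) * (d₂ * discNorm p₂ ν G ^ p₂) ^ (q / p₂))) := by
          gcongr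
          · exact discreteNorm_le_rpow hω hK h₁' G₁ hp₁.le hF
          · exact discreteNorm_le_rpow hν hK h₂' G₂ hp₂.le hG
      _ = _ := by
          rw [e hp₁0, e hp₂0, ENNReal.mul_rpow_of_nonneg _ _ hq0.le]
          simp only [a]
          ring
  have := le_rpow_one_div_mul hq0 key
  rwa [div_self hq0.ne', ENNReal.rpow_one] at this

/-- The factors scale like N^{q/p₁} and N^{q/p₂}, with N the norm of P; only their product is linear
in N. -/
theorem exists_discNorm_factors_le {p₁ p₂ q : ℝ} (hp₁ : 1 < p₁) (hp₂ : 1 < p₂) (hq : 1 < q)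
    (hpq : 1 / q = 1 / p₁ + 1 / p₂) {ω ν η : ℝ → ℝ} (hω : IsDoubling ω)
    (hν : IsDoubling ν) (hη : IsDoubling η) {c : ℝ} (hc : 0 < c)
    (hcomp : ∀ r ∈ Set.Ico (0 : ℝ) 1,
      c * (tail ω r ^ (1 / p₁) * tail ν r ^ (1 / p₂)) ≤ tail η r ^ (1 / q)) :
    ∃ B : ℝ≥0∞, B ≠ ⊤ ∧ ∀ P : Polynomial ℂ, discNorm q η (fun z => P.eval z) ≠ ⊤ →
      ∃ (J : ℕ) (F G : ℕ → ℂ → ℂ), J ≠ 0 ∧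
      (∀ k, DifferentiableOn ℂ (F k) (ball 0 1)) ∧ (∀ k, DifferentiableOn ℂ (G k) (ball 0 1)) ∧
      (∀ z ∈ ball (0 : ℂ) 1, (J : ℂ) * P.eval z = ∑ k ∈ Finset.range J, F k z * G k z) ∧
      (∀ k, discNorm p₁ ω (F k) ≠ ⊤) ∧ (∀ k, discNorm p₂ ν (G k) ≠ ⊤) ∧
      ∀ k, discNorm p₁ ω (F k) * discNorm p₂ ν (G k) ≤ B * discNorm q η fun z => P.eval z := by
  obtain ⟨K, hK, ⟨θ₁, C₁, h₁, h₁', hC₁, G₁⟩, ⟨θ₂, C₂, h₂, h₂', hC₂, G₂⟩,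
    ⟨θ₃, C₃, h₃, h₃', hC₃, G₃⟩⟩ := exists_common_geometric hω hν hη
  have hp₁0 : 0 < p₁ := by linarith
  have hp₂0 : 0 < p₂ := by linarith
  have hq0 : 0 < q := by linarith
  obtain ⟨B, hB, hfac⟩ := exists_weak_factorization_polynomial hp₁ hp₂ hq hpq hω hν hη hc hcomp hK
    h₁ h₁' hC₁ G₁ h₂ h₂' hC₂ G₂
  set d := ENNReal.ofReal (2 / (1 - θ₃) * π)
  set a₁ := ENNReal.ofReal (C₁ / π) * (B * d)
  set a₂ := ENNReal.ofReal (C₂ / π) * (B * d)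
  have ha₁ : a₁ ^ (1 / p₁) ≠ ⊤ := ENNReal.rpow_ne_top_of_nonneg (by positivity)
    (ENNReal.mul_ne_top ENNReal.ofReal_ne_top (ENNReal.mul_ne_top hB ENNReal.ofReal_ne_top))
  have ha₂ : a₂ ^ (1 / p₂) ≠ ⊤ := ENNReal.rpow_ne_top_of_nonneg (by positivity)
    (ENNReal.mul_ne_top ENNReal.ofReal_ne_top (ENNReal.mul_ne_top hB ENNReal.ofReal_ne_top))
  refine ⟨a₁ ^ (1 / p₁) * a₂ ^ (1 / p₂), ENNReal.mul_ne_top ha₁ ha₂, fun P hP => ?_⟩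
  obtain ⟨J, F, G, hJ, hF, hG, hsum, hFn, hGn⟩ := hfac P
  set N := discNorm q η fun z => P.eval z
  have hD : discreteNorm K q η (fun z => P.eval z) ≤ d * N ^ q :=
    discreteNorm_le_rpow hη hK h₃' G₃ hq.le P.differentiable.differentiableOn
  have e₁ : ∀ k, discNorm p₁ ω (F k) ≤ a₁ ^ (1 / p₁) * N ^ (q / p₁) := fun k => by
    refine le_rpow_one_div_mul hp₁0
      ((discNorm_rpow_le hω hK (by linarith) G₁ hp₁.le (hF k)).trans ?_)
    simp only [a₁, mul_assoc]
    gcongr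
    exact (hFn k).trans (by gcongr)
  have e₂ : ∀ k, discNorm p₂ ν (G k) ≤ a₂ ^ (1 / p₂) * N ^ (q / p₂) := fun k => by
    refine le_rpow_one_div_mul hp₂0
      ((discNorm_rpow_le hν hK (by linarith) G₂ hp₂.le (hG k)).trans ?_)
    simp only [a₂, mul_assoc]
    gcongr
    exact (hGn k).trans (by gcongr)
  refine ⟨J, F, G, hJ, hF, hG, hsum, fun k => ne_top_of_le_ne_top (ENNReal.mul_ne_top ha₁
    (ENNReal.rpow_ne_top_of_nonneg (by positivity) hP)) (e₁ k), fun k => ne_top_of_le_ne_top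
    (ENNReal.mul_ne_top ha₂ (ENNReal.rpow_ne_top_of_nonneg (by positivity) hP)) (e₂ k),
    fun k => ?_⟩
  calc _ ≤ (a₁ ^ (1 / p₁) * N ^ (q / p₁)) * (a₂ ^ (1 / p₂) * N ^ (q / p₂)) :=
        mul_le_mul' (e₁ k) (e₂ k)
    _ = a₁ ^ (1 / p₁) * a₂ ^ (1 / p₂) * (N ^ (q / p₁) * N ^ (q / p₂)) := by ring
    _ = _ := by
        have hst : q / p₁ + q / p₂ = 1 := by
          rw [div_eq_mul_one_div, div_eq_mul_one_div q p₂, ← mul_add, ← hpq,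
            mul_one_div_cancel hq0.ne']
        rw [← ENNReal.rpow_add_of_nonneg _ _ (by positivity) (by positivity), hst,
          ENNReal.rpow_one]

/-! ### Elements of weighted Bergman spaces -/

theorem mem_bergman_of_discNorm_ne_top {p : ℝ} {ω : ℝ → ℝ} {F : ℂ → ℂ}
    (hF : DifferentiableOn ℂ F (ball 0 1)) (h : discNorm p ω F ≠ ⊤) :
    (fun z : 𝔻 => F z) ∈ bergman p ω :=
  ⟨⟨F, hF, fun _ => rfl⟩, (continuous_restrict_disc hF).aestronglyMeasurable, h.lt_top⟩

theorem exists_extension_of_mem_bergman {p : ℝ} {ω : ℝ → ℝ} {f : 𝔻 → ℂ} (hf : f ∈ bergman p ω) :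
    ∃ F : ℂ → ℂ, DifferentiableOn ℂ F (ball 0 1) ∧ (f = fun z : 𝔻 => F z) ∧
      discNorm p ω F ≠ ⊤ := by
  obtain ⟨⟨F, hF, h⟩, hm⟩ := hf
  obtain rfl : f = fun z : 𝔻 => F z := funext h
  exact ⟨F, hF, rfl, hm.2.ne⟩

theorem bergmanNorm_eq_toReal {p : ℝ} (hp : 1 ≤ p) {ω : ℝ → ℝ} (f : bergman p ω) {F : ℂ → ℂ}
    (h : (f : 𝔻 → ℂ) = fun z : 𝔻 => F z) : bergmanNorm hp ω f = (discNorm p ω F).toReal := by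
  change bergmanNormFun p ω f = _
  rw [bergmanNormFun_eq hp f.2.2, h, discNorm]

/-- The restriction of a polynomial to the disc. -/
def polyFun : Polynomial ℂ →ₗ[ℂ] (𝔻 → ℂ) where
  toFun P z := P.eval (z : ℂ)
  map_add' P Q := by ext z; simp
  map_smul' c P := by ext z; simp

@[simp] theorem polyFun_apply (P : Polynomial ℂ) (z : 𝔻) : polyFun P z = P.eval (z : ℂ) := rfl

theorem polyFun_mul (P Q : Polynomial ℂ) : polyFun (P * Q) = polyFun P * polyFun Q := by
  ext z; simp [polyFun_apply]

theorem discNorm_polynomial_ne_top {ω : ℝ → ℝ} (hω : IsDoubling ω) (p : ℝ) (P : Polynomial ℂ) :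
    discNorm p ω (fun z => P.eval z) ≠ ⊤ := by
  have := hω.isFiniteMeasure
  obtain ⟨M, hM⟩ := (isCompact_closedBall (0 : ℂ) 1).exists_bound_of_continuousOn
    P.continuous.continuousOn
  exact (MemLp.of_bound (f := fun z : 𝔻 => P.eval (z : ℂ)) (continuous_restrict_disc
    P.differentiable.differentiableOn).aestronglyMeasurable M
    (.of_forall fun z => hM z (ball_subset_closedBall z.2))).2.ne

theorem polyFun_mem_bergman {ω : ℝ → ℝ} (hω : IsDoubling ω) (p : ℝ) (P : Polynomial ℂ) :
    polyFun P ∈ bergman p ω :=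
  mem_bergman_of_discNorm_ne_top P.differentiable.differentiableOn (discNorm_polynomial_ne_top hω p P)

/-- Polynomials as elements of a weighted Bergman space. -/
def polyBergman {ω : ℝ → ℝ} (hω : IsDoubling ω) (p : ℝ) : Polynomial ℂ →ₗ[ℂ] bergman p ω :=
  polyFun.codRestrict _ (polyFun_mem_bergman hω p)

theorem exists_polyBergman_sub_lt {ω : ℝ → ℝ} (hω : IsDoubling ω) {p : ℝ} (hp : 1 ≤ p)
    (f : bergman p ω) {ε : ℝ} (hε : 0 < ε) :
    ∃ P : Polynomial ℂ, bergmanNorm hp ω (f - polyBergman hω p P) < ε := by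
  obtain ⟨F, hF, hfF, hfin⟩ := exists_extension_of_mem_bergman f.2
  obtain ⟨P, hP⟩ := exists_polynomial_discNorm_sub_le hω hp hF hfin
    (ε := ENNReal.ofReal (ε / 2)) (by simpa using hε)
  refine ⟨P, ?_⟩
  rw [bergmanNorm_eq_toReal hp _ (F := fun z => F z - P.eval z)
    (by ext z; simp [hfF, polyBergman, polyFun_apply])]
  refine lt_of_le_of_lt (ENNReal.toReal_mono ENNReal.ofReal_ne_top hP) ?_
  rw [ENNReal.toReal_ofReal (by positivity)]
  linarith

theorem exists_norm_le_bergmanNorm {ω : ℝ → ℝ} (hω : IsDoubling ω) {p : ℝ} (hp : 1 ≤ p) {ρ : ℝ}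
    (hρ0 : 0 ≤ ρ) (hρ : ρ < 1) :
    ∃ B : ℝ, 0 ≤ B ∧ ∀ (f : bergman p ω) (z : 𝔻), ‖(z : ℂ)‖ ≤ ρ →
      ‖(f : 𝔻 → ℂ) z‖ ≤ B * bergmanNorm hp ω f := by
  obtain ⟨B, hB, h⟩ := exists_enorm_le_discNorm hω hp hρ0 hρ
  refine ⟨B.toReal, ENNReal.toReal_nonneg, fun f z hz => ?_⟩
  obtain ⟨F, hF, hfF, hfin⟩ := exists_extension_of_mem_bergman f.2
  rw [bergmanNorm_eq_toReal hp f hfF, ← ENNReal.toReal_mul, hfF, ← toReal_enorm]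
  exact ENNReal.toReal_mono (ENNReal.mul_ne_top hB hfin) (h F hF z hz)

theorem exists_mul_mem_bergman {p₁ p₂ q : ℝ} (hp₁ : 1 < p₁) (hp₂ : 1 < p₂) (hq : 1 < q)
    (hpq : 1 / q = 1 / p₁ + 1 / p₂) {ω ν η : ℝ → ℝ} (hω : IsDoubling ω)
    (hν : IsDoubling ν) (hη : IsDoubling η) {C : ℝ} (hC : 0 < C)
    (hcomp : ∀ r ∈ Set.Ico (0 : ℝ) 1,
      tail η r ^ (1 / q) ≤ C * (tail ω r ^ (1 / p₁) * tail ν r ^ (1 / p₂))) :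
    ∃ B : ℝ, 0 ≤ B ∧ ∀ (φ : bergman p₁ ω) (ψ : bergman p₂ ν),
      ∃ h : (φ : 𝔻 → ℂ) * (ψ : 𝔻 → ℂ) ∈ bergman q η,
        bergmanNorm hq.le η ⟨_, h⟩ ≤ B * (bergmanNorm hp₁.le ω φ * bergmanNorm hp₂.le ν ψ) := by
  obtain ⟨B, hB, h⟩ := exists_discNorm_mul_le hp₁ hp₂ hq hpq hω hν hη hC hcomp
  refine ⟨B.toReal, ENNReal.toReal_nonneg, fun φ ψ => ?_⟩
  obtain ⟨F, hF, hφF, hFfin⟩ := exists_extension_of_mem_bergman φ.2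
  obtain ⟨G, hG, hψG, hGfin⟩ := exists_extension_of_mem_bergman ψ.2
  have hfin : B * (discNorm p₁ ω F * discNorm p₂ ν G) ≠ ⊤ :=
    ENNReal.mul_ne_top hB (ENNReal.mul_ne_top hFfin hGfin)
  have hprod : (φ : 𝔻 → ℂ) * (ψ : 𝔻 → ℂ) = fun z : 𝔻 => F z * G z := by
    rw [hφF, hψG]; rfl
  have hmem : (φ : 𝔻 → ℂ) * (ψ : 𝔻 → ℂ) ∈ bergman q η := by
    rw [hprod]
    exact mem_bergman_of_discNorm_ne_top (hF.mul hG) (ne_top_of_le_ne_top hfin (h F G hF hG))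
  refine ⟨hmem, ?_⟩
  rw [bergmanNorm_eq_toReal hq.le ⟨_, hmem⟩ (F := fun z => F z * G z) hprod,
    bergmanNorm_eq_toReal _ φ hφF, bergmanNorm_eq_toReal _ ψ hψG, ← ENNReal.toReal_mul,
    ← ENNReal.toReal_mul]
  exact ENNReal.toReal_mono hfin (h F G hF hG)

theorem exists_weakNormFun_polyFun_le {p₁ p₂ q : ℝ} (hp₁ : 1 < p₁) (hp₂ : 1 < p₂) (hq : 1 < q)
    (hpq : 1 / q = 1 / p₁ + 1 / p₂) {ω ν η : ℝ → ℝ} (hω : IsDoubling ω)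
    (hν : IsDoubling ν) (hη : IsDoubling η) {c : ℝ} (hc : 0 < c)
    (hcomp : ∀ r ∈ Set.Ico (0 : ℝ) 1,
      c * (tail ω r ^ (1 / p₁) * tail ν r ^ (1 / p₂)) ≤ tail η r ^ (1 / q)) :
    ∃ B : ℝ, 0 ≤ B ∧ ∀ P : Polynomial ℂ,
      weakNormFun (bergmanNorm hp₁.le ω) (bergmanNorm hp₂.le ν) (polyFun P) ≤
        B * bergmanNorm hq.le η (polyBergman hη q P) := by
  obtain ⟨B, hB, h⟩ := exists_discNorm_factors_le hp₁ hp₂ hq hpq hω hν hη hc hcomp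
  refine ⟨B.toReal, ENNReal.toReal_nonneg, fun P => ?_⟩
  have hP := discNorm_polynomial_ne_top hη q P
  obtain ⟨J, F, G, hJ, hF, hG, hsum, hFf, hGf, hFG⟩ := h P hP
  have hJ0 : (J : ℂ) ≠ 0 := by exact_mod_cast hJ
  have hJ0' : (J : ℝ) ≠ 0 := by exact_mod_cast hJ
  let φ : ℕ → bergman p₁ ω := fun k => ⟨_, mem_bergman_of_discNorm_ne_top (hF k) (hFf k)⟩
  let ψ : ℕ → bergman p₂ ν := fun k => ⟨_, mem_bergman_of_discNorm_ne_top (hG k) (hGf k)⟩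
  rw [bergmanNorm_eq_toReal hq.le (polyBergman hη q P) (F := fun z => P.eval z) rfl,
    ← ENNReal.toReal_mul]
  -- The weight 1/J of the average is put on the first factors, so J terms of cost at most 1/J times
  -- the bound add up to it.
  refine (csInf_le (representationCosts_bddBelow _ _ _)
    ⟨J, fun k => (J : ℂ)⁻¹ • φ k, fun k => ψ k, ?_, rfl⟩).trans ?_
  · rw [Fin.sum_univ_eq_sum_range (fun k => (((J : ℂ)⁻¹ • φ k : bergman p₁ ω) : 𝔻 → ℂ) *
      (ψ k : 𝔻 → ℂ)) J]
    ext z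
    rw [Finset.sum_apply]
    have h1 := hsum z z.2
    simp only [Submodule.coe_smul, Pi.mul_apply, Pi.smul_apply, smul_eq_mul, mul_assoc, φ, ψ]
    rw [← Finset.mul_sum, ← h1, inv_mul_cancel_left₀ hJ0]
    rfl
  · have hterm : ∀ k : Fin J, bergmanNorm hp₁.le ω ((J : ℂ)⁻¹ • φ k) * bergmanNorm hp₂.le ν (ψ k) ≤
        (J : ℝ)⁻¹ * (B * discNorm q η fun z => P.eval z).toReal := fun k => by
      rw [map_smul_eq_mul, norm_inv, Complex.norm_natCast, mul_assoc,
        bergmanNorm_eq_toReal _ (φ k) (F := F k) rfl, bergmanNorm_eq_toReal _ (ψ k) (F := G k) rfl,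
        ← ENNReal.toReal_mul]
      exact mul_le_mul_of_nonneg_left
        (ENNReal.toReal_mono (ENNReal.mul_ne_top hB hP) (hFG k)) (by positivity)
    refine (Finset.sum_le_sum fun k _ => hterm k).trans (le_of_eq ?_)
    rw [Finset.sum_const, Finset.card_univ, Fintype.card_fin, nsmul_eq_mul,
      mul_inv_cancel_left₀ hJ0']

/-! ### Finite sums of products -/

section FiniteSums

variable {X : Type*} {A B C : Submodule ℂ (X → ℂ)}

/-- The linear map sending a finite sum to the underlying function. -/
def FiniteSums.toFunLin (NA : Seminorm ℂ A) (NB : Seminorm ℂ B) :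
    FiniteSums NA NB →ₗ[ℂ] (X → ℂ) where
  toFun f := f.toFun
  map_add' _ _ := rfl
  map_smul' _ _ := rfl

/-- A product as a finite sum. -/
def FiniteSums.ofMul (NA : Seminorm ℂ A) (NB : Seminorm ℂ B) (φ : A) (ψ : B) : FiniteSums NA NB :=
  (⟨(φ : X → ℂ) * (ψ : X → ℂ), Submodule.mul_mem_mul φ.2 ψ.2⟩ : ↥(A * B))

theorem FiniteSums.ext {NA : Seminorm ℂ A} {NB : Seminorm ℂ B} {f g : FiniteSums NA NB}
    (h : f.toFun = g.toFun) : f = g :=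
  Subtype.ext h

theorem FiniteSums.norm_ofMul_le (NA : Seminorm ℂ A) (NB : Seminorm ℂ B) (φ : A) (ψ : B) :
    ‖FiniteSums.ofMul NA NB φ ψ‖ ≤ NA φ * NB ψ := by
  rw [FiniteSums.norm_def]
  refine csInf_le (representationCosts_bddBelow NA NB _) ⟨1, fun _ => φ, fun _ => ψ, ?_, ?_⟩
  · simp [FiniteSums.ofMul, FiniteSums.toFun]
  · simp

theorem FiniteSums.exists_mem_of_mul {NA : Seminorm ℂ A} {NB : Seminorm ℂ B} {NC : Seminorm ℂ C}
    {b : ℝ} (hb : 0 < b) (h : ∀ (φ : A) (ψ : B), ∃ h : (φ : X → ℂ) * (ψ : X → ℂ) ∈ C,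
      NC ⟨_, h⟩ ≤ b * (NA φ * NB ψ)) (f : FiniteSums NA NB) :
    ∃ h : f.toFun ∈ C, NC ⟨_, h⟩ ≤ b * ‖f‖ := by
  have key : ∀ t ∈ representationCosts NA NB f.toFun, ∃ h : f.toFun ∈ C, NC ⟨_, h⟩ ≤ b * t := by
    rintro t ⟨n, φ, ψ, hf, rfl⟩
    choose hm hle using h
    have hsum : f.toFun =
        ((∑ k, (⟨_, hm (φ k) (ψ k)⟩ : C) : C) : X → ℂ) := by
      rw [hf, Submodule.coe_sum]
    refine ⟨hsum ▸ Subtype.property _, ?_⟩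
    have : (⟨f.toFun, hsum ▸ Subtype.property _⟩ : C) = ∑ k, (⟨_, hm (φ k) (ψ k)⟩ : C) :=
      Subtype.ext hsum
    rw [this, Finset.mul_sum]
    exact (Finset.le_sum_of_subadditive NC (map_zero NC).le (map_add_le_add NC) _ _).trans
      (Finset.sum_le_sum fun k _ => hle _ _)
  obtain ⟨t, ht⟩ := (mem_mul_iff_representationCosts_nonempty NA NB f.toFun).1 f.2
  obtain ⟨hmem, -⟩ := key t ht
  refine ⟨hmem, ?_⟩
  rw [FiniteSums.norm_def, ← div_le_iff₀' hb]
  refine le_csInf ⟨t, ht⟩ fun s hs => ?_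
  rw [div_le_iff₀' hb]
  exact (key s hs).2

theorem FiniteSums.mem_of_ofMul_mem {NA : Seminorm ℂ A} {NB : Seminorm ℂ B}
    (S : Submodule ℂ (FiniteSums NA NB)) (h : ∀ φ ψ, FiniteSums.ofMul NA NB φ ψ ∈ S)
    (f : FiniteSums NA NB) : f ∈ S := by
  obtain ⟨t, n, φ, ψ, hf, -⟩ := (mem_mul_iff_representationCosts_nonempty NA NB f.toFun).1 f.2
  have : f = ∑ k, FiniteSums.ofMul NA NB (φ k) (ψ k) := by
    apply FiniteSums.ext
    rw [hf]
    have h := map_sum (FiniteSums.toFunLin NA NB)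
      (fun k => FiniteSums.ofMul NA NB (φ k) (ψ k)) Finset.univ
    exact h.symm
  rw [this]
  exact Submodule.sum_mem _ fun k _ => h _ _

end FiniteSums

/-- Polynomials as finite sums of products. -/
def polyFiniteSums {A B : Submodule ℂ (𝔻 → ℂ)} (NA : Seminorm ℂ A) (NB : Seminorm ℂ B)
    (hA : ∀ P, polyFun P ∈ A) (hB : ∀ P, polyFun P ∈ B) : Polynomial ℂ →ₗ[ℂ] FiniteSums NA NB :=
  polyFun.codRestrict (A * B) fun P => by
    rw [← mul_one P, polyFun_mul]
    exact Submodule.mul_mem_mul (hA P) (hB 1)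

/-- Density for the weak norm follows from φψ - PQ = φ(ψ - Q) + (φ - P)Q, whose two summands have
norm at most the product of the norms of their factors. -/
theorem denseRange_polyFiniteSums {A B : Submodule ℂ (𝔻 → ℂ)} (NA : Seminorm ℂ A)
    (NB : Seminorm ℂ B) (hA : ∀ P, polyFun P ∈ A) (hB : ∀ P, polyFun P ∈ B)
    (hdA : ∀ (φ : A) (ε : ℝ), 0 < ε → ∃ P, NA (φ - ⟨polyFun P, hA P⟩) < ε)
    (hdB : ∀ (ψ : B) (ε : ℝ), 0 < ε → ∃ P, NB (ψ - ⟨polyFun P, hB P⟩) < ε) :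
    DenseRange (polyFiniteSums NA NB hA hB) := by
  let S := (LinearMap.range (polyFiniteSums NA NB hA hB)).topologicalClosure
  intro f
  refine FiniteSums.mem_of_ofMul_mem S (fun φ ψ => ?_) f
  change FiniteSums.ofMul NA NB φ ψ ∈ closure (Set.range (polyFiniteSums NA NB hA hB))
  rw [Metric.mem_closure_range_iff]
  intro ε hε
  have hφ : 0 < NA φ + 1 := by linarith [apply_nonneg NA φ]
  -- Q is chosen first, because the tolerance for P depends on it.
  obtain ⟨Q, hQ⟩ := hdB ψ (ε / 2 / (NA φ + 1)) (by positivity)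
  set ψ' : B := ⟨polyFun Q, hB Q⟩
  have hψ' : 0 < NB ψ' + 1 := by linarith [apply_nonneg NB ψ']
  obtain ⟨P, hP⟩ := hdA φ (ε / 2 / (NB ψ' + 1)) (by positivity)
  set φ' : A := ⟨polyFun P, hA P⟩
  refine ⟨P * Q, ?_⟩
  have heq : FiniteSums.ofMul NA NB φ ψ - polyFiniteSums NA NB hA hB (P * Q) =
      FiniteSums.ofMul NA NB φ (ψ - ψ') + FiniteSums.ofMul NA NB (φ - φ') ψ' := by
    apply FiniteSums.ext
    change (φ : 𝔻 → ℂ) * (ψ : 𝔻 → ℂ) - polyFun (P * Q) =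
      (φ : 𝔻 → ℂ) * ((ψ : 𝔻 → ℂ) - polyFun Q) + ((φ : 𝔻 → ℂ) - polyFun P) * polyFun Q
    rw [polyFun_mul]
    ring
  rw [dist_eq_norm, heq]
  have e1 : NA φ * NB (ψ - ψ') < ε / 2 := by
    rw [lt_div_iff₀ hφ] at hQ
    nlinarith [apply_nonneg NB (ψ - ψ'), apply_nonneg NA φ]
  have e2 : NA (φ - φ') * NB ψ' < ε / 2 := by
    rw [lt_div_iff₀ hψ'] at hP
    nlinarith [apply_nonneg NA (φ - φ'), apply_nonneg NB ψ']
  calc _ ≤ _ := norm_add_le _ _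
    _ ≤ NA φ * NB (ψ - ψ') + NA (φ - φ') * NB ψ' :=
      add_le_add (FiniteSums.norm_ofMul_le _ _ _ _) (FiniteSums.norm_ofMul_le _ _ _ _)
    _ < ε := by linarith

/-! ### Limits of functions in weighted Bergman spaces -/

/-- Weierstrass gives analyticity of the limit and Fatou the norm bound. -/
theorem mem_bergman_of_tendsto {q : ℝ} (hq : 1 ≤ q) {η : ℝ → ℝ} {f : ℕ → bergman q η} {g : 𝔻 → ℂ}
    (hunif : ∀ ρ : ℝ, 0 ≤ ρ → ρ < 1 → ∀ ε : ℝ, 0 < ε → ∀ᶠ n in atTop, ∀ z : 𝔻, ‖(z : ℂ)‖ ≤ ρ →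
      ‖g z - (f n : 𝔻 → ℂ) z‖ < ε) {M : ℝ}
    (hbound : ∀ ε : ℝ, 0 < ε → ∀ᶠ n in atTop, bergmanNorm hq η (f n) ≤ M + ε) :
    ∃ h : g ∈ bergman q η, bergmanNorm hq η ⟨g, h⟩ ≤ M := by
  choose F hF hfF hfin using fun n => exists_extension_of_mem_bergman (f n).2
  classical
  let G : ℂ → ℂ := fun z => if h : z ∈ ball (0 : ℂ) 1 then g ⟨z, h⟩ else 0
  have hGg : ∀ z : 𝔻, G z = g z := fun z => dif_pos z.2
  have hloc : TendstoLocallyUniformlyOn F G atTop (ball 0 1) := by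
    rw [tendstoLocallyUniformlyOn_iff_forall_isCompact isOpen_ball]
    intro S hS hSc
    rw [Metric.tendstoUniformlyOn_iff]
    intro ε hε
    obtain ⟨ρ, hρ0, hρ1, hρ⟩ : ∃ ρ : ℝ, 0 ≤ ρ ∧ ρ < 1 ∧ ∀ z ∈ S, ‖z‖ ≤ ρ := by
      rcases S.eq_empty_or_nonempty with rfl | hne
      · exact ⟨0, le_rfl, one_pos, by simp⟩
      · obtain ⟨w, hw, hmax⟩ := hSc.exists_isMaxOn hne continuous_norm.continuousOn
        exact ⟨‖w‖, norm_nonneg _, mem_ball_zero_iff.1 (hS hw), fun z hz => hmax hz⟩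
    filter_upwards [hunif ρ hρ0 hρ1 ε hε] with n hn z hz
    have h1 := hn ⟨z, hS hz⟩ (hρ z hz)
    rw [hfF n] at h1
    rwa [dist_eq_norm, hGg ⟨z, hS hz⟩]
  have hGd : DifferentiableOn ℂ G (ball 0 1) :=
    hloc.differentiableOn (.of_forall hF) isOpen_ball
  have hgG : g = fun z : 𝔻 => G z := funext fun z => (hGg z).symm
  have hlim : ∀ z : 𝔻, Tendsto (fun n => F n z) atTop (𝓝 (g z)) := fun z => by
    rw [← hGg z]
    exact hloc.tendsto_at z.2
  have hnorm : ∀ ε : ℝ, 0 < ε → discNorm q η G ≤ ENNReal.ofReal (M + ε) := fun ε hε => by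
    refine Lp.eLpNorm_le_of_ae_tendsto (u := atTop) (f := fun n (z : 𝔻) => F n z) ?_
      (fun n => (continuous_restrict_disc (hF n)).aestronglyMeasurable)
      (.of_forall fun z => by rw [hGg z]; exact hlim z)
    filter_upwards [hbound ε hε] with n hn
    rw [bergmanNorm_eq_toReal hq (f n) (hfF n)] at hn
    exact ENNReal.le_ofReal_iff_toReal_le (hfin n) (ENNReal.toReal_nonneg.trans hn) |>.2 hn
  have hGfin : discNorm q η G ≠ ⊤ := ne_top_of_le_ne_top ENNReal.ofReal_ne_top (hnorm 1 one_pos)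
  refine ⟨hgG ▸ mem_bergman_of_discNorm_ne_top hGd hGfin, ?_⟩
  rw [bergmanNorm_eq_toReal hq _ hgG]
  have hM : ∀ ε : ℝ, 0 < ε → 0 ≤ M + ε := fun ε hε => by
    obtain ⟨n, hn⟩ := (hbound ε hε).exists
    exact (apply_nonneg _ _).trans hn
  refine le_of_forall_pos_le_add fun ε hε => ?_
  have := ENNReal.toReal_mono ENNReal.ofReal_ne_top (hnorm ε hε)
  rwa [ENNReal.toReal_ofReal (hM ε hε)] at this

/-! ### The completion of the space of finite sums -/

/-- Continuous point evaluations realise abstract elements of the completion as functions. The upper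
bound is known on all finite sums but the lower one only on polynomials, so their density in the
weak norm is essential. -/
theorem exists_equiv_of_polynomial_bounds {A B : Submodule ℂ (𝔻 → ℂ)} {NA : Seminorm ℂ A}
    {NB : Seminorm ℂ B} {q : ℝ} (hq : 1 ≤ q) {η : ℝ → ℝ} (hη : IsDoubling η) {b b' : ℝ}
    (hb : 0 < b) (hb' : 0 < b')
    (hmem : ∀ f : FiniteSums NA NB, ∃ h : f.toFun ∈ bergman q η,
      bergmanNorm hq η ⟨_, h⟩ ≤ b * ‖f‖)
    (pX : Polynomial ℂ →ₗ[ℂ] FiniteSums NA NB) (hpX : ∀ P, (pX P).toFun = polyFun P)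
    (hdense : DenseRange pX)
    (hlow : ∀ P, ‖pX P‖ ≤ b' * bergmanNorm hq η (polyBergman hη q P)) :
    ∃ Φ : WeaklyFactored NA NB ≃ₗ[ℂ] bergman q η,
      (∀ f : FiniteSums NA NB, (Φ (f : WeaklyFactored NA NB) : 𝔻 → ℂ) = f.toFun) ∧
      ∃ c C : ℝ, 0 < c ∧ 0 < C ∧ ∀ x : WeaklyFactored NA NB,
        c * ‖x‖ ≤ bergmanNorm hq η (Φ x) ∧ bergmanNorm hq η (Φ x) ≤ C * ‖x‖ := by
  have hevX : ∀ ρ : ℝ, 0 ≤ ρ → ρ < 1 → ∃ D : ℝ, 0 ≤ D ∧ ∀ (f : FiniteSums NA NB) (z : 𝔻),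
      ‖(z : ℂ)‖ ≤ ρ → ‖f.toFun z‖ ≤ D * ‖f‖ := fun ρ h0 h1 => by
    obtain ⟨D, hD, h⟩ := exists_norm_le_bergmanNorm hη hq h0 h1
    refine ⟨D * b, by positivity, fun f z hz => ?_⟩
    obtain ⟨hf, hfb⟩ := hmem f
    calc _ ≤ D * bergmanNorm hq η ⟨_, hf⟩ := h ⟨_, hf⟩ z hz
      _ ≤ D * (b * ‖f‖) := by gcongr
      _ = _ := by ring
  have hev : ∀ z : 𝔻, ∃ L : WeaklyFactored NA NB →L[ℂ] ℂ,
      ∀ f : FiniteSums NA NB, L (f : WeaklyFactored NA NB) = f.toFun z := fun z => by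
    obtain ⟨D, -, h⟩ := hevX ‖(z : ℂ)‖ (norm_nonneg _) (mem_ball_zero_iff.1 z.2)
    let l : FiniteSums NA NB →L[ℂ] ℂ :=
      ((LinearMap.proj z).comp (FiniteSums.toFunLin NA NB)).mkContinuous D fun f => h f z le_rfl
    refine ⟨l.extend UniformSpace.Completion.toComplL, fun f => ?_⟩
    exact ContinuousLinearMap.extend_eq l UniformSpace.Completion.denseRange_coe
      (UniformSpace.Completion.isUniformInducing_coe _) f
  choose L hL using hev
  have hLb : ∀ ρ : ℝ, 0 ≤ ρ → ρ < 1 → ∃ D : ℝ, 0 ≤ D ∧ ∀ (x : WeaklyFactored NA NB) (z : 𝔻),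
      ‖(z : ℂ)‖ ≤ ρ → ‖L z x‖ ≤ D * ‖x‖ := fun ρ h0 h1 => by
    obtain ⟨D, hD, h⟩ := hevX ρ h0 h1
    refine ⟨D, hD, fun x z hz => ?_⟩
    induction x using UniformSpace.Completion.induction_on with
    | hp => exact isClosed_le (L z).continuous.norm (continuous_const.mul continuous_norm)
    | ih f => rw [hL, UniformSpace.Completion.norm_coe]; exact h f z hz
  let Ψ : WeaklyFactored NA NB →ₗ[ℂ] (𝔻 → ℂ) := LinearMap.pi fun z => (L z : _ →ₗ[ℂ] ℂ)
  have hΨmem : ∀ x, ∃ h : Ψ x ∈ bergman q η, bergmanNorm hq η ⟨_, h⟩ ≤ b * ‖x‖ := fun x => by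
    have hx := UniformSpace.Completion.denseRange_coe (α := FiniteSums NA NB) x
    obtain ⟨y, hy, hyx⟩ := mem_closure_iff_seq_limit.1 hx
    choose f hf using hy
    obtain rfl : (fun n => (f n : WeaklyFactored NA NB)) = y := funext hf
    have hnx : Tendsto (fun n => ‖x - (f n : WeaklyFactored NA NB)‖) atTop (𝓝 0) := by
      simpa using ((tendsto_const_nhds (x := x)).sub hyx).norm
    refine mem_bergman_of_tendsto hq (f := fun n => ⟨_, (hmem (f n)).1⟩) (fun ρ h0 h1 ε hε => ?_)
      fun ε hε => ?_
    · obtain ⟨D, hD, h⟩ := hLb ρ h0 h1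
      have ht := hnx.const_mul D
      rw [mul_zero] at ht
      filter_upwards [ht.eventually (gt_mem_nhds hε)] with n hn z hz
      have h2 := h (x - f n) z hz
      rw [map_sub, hL] at h2
      exact h2.trans_lt hn
    · have ht := hyx.norm.const_mul b
      filter_upwards [ht.eventually (gt_mem_nhds (lt_add_of_pos_right _ hε))] with n hn
      rw [UniformSpace.Completion.norm_coe] at hn
      exact (hmem (f n)).2.trans hn.le
  let Φ₀ : WeaklyFactored NA NB →ₗ[ℂ] bergman q η := Ψ.codRestrict _ fun x => (hΨmem x).1
  have hΦ₀ : ∀ f : FiniteSums NA NB, (Φ₀ (f : WeaklyFactored NA NB) : 𝔻 → ℂ) = f.toFun :=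
    fun f => funext fun z => hL z f
  have hup : ∀ x, bergmanNorm hq η (Φ₀ x) ≤ b * ‖x‖ := fun x => (hΨmem x).2
  have hpoly : ∀ P, Φ₀ (pX P : WeaklyFactored NA NB) = polyBergman hη q P := fun P =>
    Subtype.ext ((hΦ₀ _).trans (hpX P))
  have hdenseE : DenseRange fun P => (pX P : WeaklyFactored NA NB) :=
    UniformSpace.Completion.denseRange_coe.comp hdense (UniformSpace.Completion.continuous_coe _)
  have hlowE : ∀ x, ‖x‖ ≤ b' * bergmanNorm hq η (Φ₀ x) := fun x => by
    refine le_of_forall_pos_le_add fun ε hε => ?_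
    -- Replacing x by a polynomial y changes the two sides by at most ‖x - y‖ and b'b‖x - y‖, which
    -- explains the tolerance.
    obtain ⟨P, hP⟩ := Metric.denseRange_iff.1 hdenseE x (ε / (1 + b' * b)) (by positivity)
    rw [dist_eq_norm, lt_div_iff₀ (by positivity)] at hP
    set y : WeaklyFactored NA NB := (pX P : WeaklyFactored NA NB)
    have h1 : ‖y‖ ≤ b' * bergmanNorm hq η (Φ₀ y) := by
      rw [hpoly, UniformSpace.Completion.norm_coe]; exact hlow P
    have h2 : bergmanNorm hq η (Φ₀ y) ≤ bergmanNorm hq η (Φ₀ x) + b * ‖x - y‖ := by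
      have h3 : Φ₀ y = Φ₀ x - Φ₀ (x - y) := by rw [map_sub]; abel
      rw [h3]
      exact (map_sub_le_add _ _ _).trans (add_le_add le_rfl (hup _))
    have h4 : ‖x‖ ≤ ‖y‖ + ‖x - y‖ := by
      have := norm_add_le y (x - y)
      rwa [add_sub_cancel] at this
    have h5 := mul_le_mul_of_nonneg_left h2 hb'.le
    nlinarith
  have hinj : Function.Injective Φ₀ := (injective_iff_map_eq_zero Φ₀).2 fun x hx => by
    have := hlowE x
    rw [hx, map_zero, mul_zero] at this
    exact norm_le_zero_iff.1 this
  -- Polynomials converging to f in A^q_η are Cauchy in the completion by the lower bound; their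
  -- limit there and f have the same point values.
  have hsurj : Function.Surjective Φ₀ := fun f => by
    choose P hP using fun n : ℕ => exists_polyBergman_sub_lt hη hq f
      (ε := 1 / ((n : ℝ) + 1)) Nat.one_div_pos_of_nat
    have htend : Tendsto (fun n : ℕ => 1 / ((n : ℝ) + 1)) atTop (𝓝 0) :=
      tendsto_one_div_add_atTop_nhds_zero_nat
    have hcau : CauchySeq fun n => (pX (P n) : WeaklyFactored NA NB) := by
      refine cauchySeq_of_le_tendsto_0 (fun n : ℕ => b' * (1 / ((n : ℝ) + 1) + 1 / ((n : ℝ) + 1)))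
        (fun n m N hn hm => ?_) (by simpa using (htend.add htend).const_mul b')
      have hanti : ∀ {k : ℕ}, N ≤ k → 1 / ((k : ℝ) + 1) ≤ 1 / ((N : ℝ) + 1) := fun hk =>
        Nat.one_div_le_one_div hk
      rw [dist_eq_norm, ← UniformSpace.Completion.coe_sub, UniformSpace.Completion.norm_coe,
        ← map_sub]
      refine (hlow _).trans ?_
      gcongr
      have h3 : polyBergman hη q (P n - P m) =
          (f - polyBergman hη q (P m)) - (f - polyBergman hη q (P n)) := by
        rw [map_sub]; abel
      rw [h3]
      exact (map_sub_le_add _ _ _).trans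
        (add_le_add ((hP m).le.trans (hanti hm)) ((hP n).le.trans (hanti hn)))
    obtain ⟨x, hx⟩ := cauchySeq_tendsto_of_complete hcau
    refine ⟨x, Subtype.ext (funext fun z => ?_)⟩
    have h1 : Tendsto (fun n => polyFun (P n) z) atTop (𝓝 ((Φ₀ x : 𝔻 → ℂ) z)) := by
      have := ((L z).continuous.tendsto x).comp hx
      refine this.congr fun n => ?_
      rw [Function.comp, hL, hpX]
    have h2 : Tendsto (fun n => polyFun (P n) z) atTop (𝓝 ((f : 𝔻 → ℂ) z)) := by
      obtain ⟨D, hD, h⟩ := exists_norm_le_bergmanNorm hη hq (norm_nonneg (z : ℂ))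
        (mem_ball_zero_iff.1 z.2)
      rw [tendsto_iff_norm_sub_tendsto_zero]
      have ht := htend.const_mul D
      rw [mul_zero] at ht
      refine squeeze_zero (fun _ => norm_nonneg _) (fun n => ?_) ht
      rw [norm_sub_rev]
      exact (h (f - polyBergman hη q (P n)) z le_rfl).trans (by gcongr; exact (hP n).le)
    exact tendsto_nhds_unique h1 h2
  refine ⟨LinearEquiv.ofBijective Φ₀ ⟨hinj, hsurj⟩, hΦ₀, b'⁻¹, b, by positivity, hb, fun x =>
    ⟨?_, hup x⟩⟩
  rw [inv_mul_le_iff₀ hb']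
  exact hlowE x

end WeakFactorization

end

/-! ### Conclusion: from the two estimates to the isomorphism -/

theorem theorem2 (p₁ p₂ q : ℝ) (hp₁ : 1 < p₁) (hp₂ : 1 < p₂) (hq : 1 < q)
    (hpq : 1 / q = 1 / p₁ + 1 / p₂)
    (ω ν η : ℝ → ℝ) (hω : IsDoubling ω) (hν : IsDoubling ν) (hη : IsDoubling η)
    (hcomp : ∃ c C : ℝ, 0 < c ∧ 0 < C ∧ ∀ r ∈ Set.Ico (0 : ℝ) 1,
      c * (tailAvg ω r ^ (1 / p₁) * tailAvg ν r ^ (1 / p₂)) ≤ tailAvg η r ^ (1 / q) ∧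
      tailAvg η r ^ (1 / q) ≤ C * (tailAvg ω r ^ (1 / p₁) * tailAvg ν r ^ (1 / p₂))) :
    ∃ Φ : WeaklyFactored (bergmanNorm hp₁.le ω) (bergmanNorm hp₂.le ν) ≃ₗ[ℂ] bergman q η,
      (∀ f : FiniteSums (bergmanNorm hp₁.le ω) (bergmanNorm hp₂.le ν),
        (Φ (f : WeaklyFactored (bergmanNorm hp₁.le ω) (bergmanNorm hp₂.le ν)) : 𝔻 → ℂ)
          = f.toFun) ∧
      ∃ c C : ℝ, 0 < c ∧ 0 < C ∧
        ∀ x : WeaklyFactored (bergmanNorm hp₁.le ω) (bergmanNorm hp₂.le ν),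
          c * ‖x‖ ≤ bergmanNorm hq.le η (Φ x) ∧ bergmanNorm hq.le η (Φ x) ≤ C * ‖x‖ := by
  obtain ⟨c, C, hc, hC, h⟩ := hcomp
  have hlow : ∀ r ∈ Set.Ico (0 : ℝ) 1,
      c * (tail ω r ^ (1 / p₁) * tail ν r ^ (1 / p₂)) ≤ tail η r ^ (1 / q) := fun r hr => by
    obtain ⟨e₁, e₂⟩ := tailAvg_compare hpq hω hν hη hr.1 hr.2
    have h1 := (h r hr).1
    have hpos : 0 < (1 - r) ^ (1 / q) := Real.rpow_pos_of_pos (sub_pos.2 hr.2) _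
    rwa [e₁, e₂, ← mul_div_assoc, div_le_div_iff_of_pos_right hpos] at h1
  have hup : ∀ r ∈ Set.Ico (0 : ℝ) 1,
      tail η r ^ (1 / q) ≤ C * (tail ω r ^ (1 / p₁) * tail ν r ^ (1 / p₂)) := fun r hr => by
    obtain ⟨e₁, e₂⟩ := tailAvg_compare hpq hω hν hη hr.1 hr.2
    have h1 := (h r hr).2
    have hpos : 0 < (1 - r) ^ (1 / q) := Real.rpow_pos_of_pos (sub_pos.2 hr.2) _
    rwa [e₁, e₂, ← mul_div_assoc, div_le_div_iff_of_pos_right hpos] at h1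
  obtain ⟨b, hb, hmul⟩ := exists_mul_mem_bergman hp₁ hp₂ hq hpq hω hν hη hC hup
  obtain ⟨b', hb', hweak⟩ := exists_weakNormFun_polyFun_le hp₁ hp₂ hq hpq hω hν hη hc hlow
  -- The available constants are only nonnegative; adding 1 makes them positive.
  refine exists_equiv_of_polynomial_bounds hq.le hη (b := b + 1) (b' := b' + 1) (by linarith)
    (by linarith) ?_ (polyFiniteSums _ _ (polyFun_mem_bergman hω p₁) (polyFun_mem_bergman hν p₂))
    (fun _ => rfl)
    (denseRange_polyFiniteSums _ _ _ _ (fun φ ε hε => exists_polyBergman_sub_lt hω hp₁.le φ hε)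
      fun ψ ε hε => exists_polyBergman_sub_lt hν hp₂.le ψ hε) fun P => ?_
  · refine FiniteSums.exists_mem_of_mul (by linarith) fun φ ψ => ?_
    obtain ⟨hm, hle⟩ := hmul φ ψ
    refine ⟨hm, hle.trans ?_⟩
    have := mul_nonneg (apply_nonneg (bergmanNorm hp₁.le ω) φ)
      (apply_nonneg (bergmanNorm hp₂.le ν) ψ)
    nlinarith
  · refine (hweak P).trans ?_
    have := apply_nonneg (bergmanNorm hq.le η) (polyBergman hη q P)
    nlinarith
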